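/- Let $X=(X_t)_{t\ge 0}$ be a real-valued L\'evy process with $X_0=0$ on a probability space $(\Omega,\mathcal F,\mathbb P)$, with characteristic triplet $(\gamma,\sigma,\Pi)$, i.e. $\mathbb E[e^{i\lambda X_t}]=e^{-t\Psi(\lambda)}$ with $$\Psi(\lambda)=-i\gamma\lambda+\tfrac12\sigma^2\lambda^2+\int_{\mathbb R\setminus\{0\}}\bigl(1-e^{i\lambda z}+i\lambda z1_{\{|z|<1\}}\bigr)\,\Pi(dz),$$ where $\sigma\ge0$ and $\int(1\wedge z^2)\,\Pi(dz)<\infty$. Assume that $\int_{|z|\ge1}e^{\bar\theta|z|}\,\Pi(dz)<\infty$ for some $\bar\theta>0$. Let $q>0$, $\alpha>0$, $\beta\in\mathbb R$, and let $f:\mathbb R\to\mathbb R$ be convex, continuously differentiable and of polynomial growth. If $X$ has paths of bounded variation, let $\delta=\gamma-\int_{|z|<1}z\,\Pi(dz)$ be its drift. For $b\in[-\infty,\infty]$ and $y\in\mathbb R$ let $h^b(y)=\alpha1_{\{y>b\}}+\delta1_{\{y=b\}}$ if $X$ has paths of bounded variation and $\delta\in[0,\alpha]$, and $h^b(y)=\alpha1_{\{y>b\}}$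 otherwise. Assume that for all $b,x\in\mathbb R$ the equation $$U_t=x+X_t-\int_0^t h^b(U_s)\,ds,\qquad t\ge0,$$ has a unique strong solution, denoted $U^{b}$ under $\mathbb E_x$; put also $U^{+\infty}_t=x+X_t$ and $U^{-\infty}_t=x+X_t-\alpha t$ under $\mathbb E_x$. Define $$\rho(b)=\mathbb E_b\Bigl[\int_0^\infty e^{-qt}f'(U^b_t)\,dt\Bigr]\ (b\in\mathbb R),\qquad b^*=\inf\{b\in\mathbb R:\rho(b)-\beta\ge0\}\in[-\infty,\infty]$$ (with $\inf\emptyset=+\infty$), and for $b\in[-\infty,\infty]$ $$v_b(x)=\mathbb E_x\Bigl[\int_0^\infty e^{-qt}\bigl(f(U^b_t)+\beta h^b(U^b_t)\bigr)\,dt\Bigr],\qquad x\in\mathbb R.$$ Then the expectations defining $\rho(b)$ (for all $b\in\mathbb R$) and $v_{b^*}(x)$ (for all $x\in\mathbb R$) converge absolutely, $v_{b^*}$ is differentiable on $\mathbb R$, and for every $x\in\mathbb R$ $$v_{b^*}'(x)\ \begin{cases}\ge\beta & \text{if } x>b^*,\\ =\beta & \text{if } x=b^*,\\ \le\beta & \text{if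 } x<b^*,\end{cases}$$ including the cases $b^*=+\infty$ (so that $v_{b^*}'\le\beta$ on $\mathbb R$) and $b^*=-\infty$ (so that $v_{b^*}'\ge\beta$ on $\mathbb R$). -/

import Mathlib

open MeasureTheory ProbabilityTheory Set Filter Topology
open scoped NNReal ENNReal

noncomputable section

namespace Refraction

/-! ### Lévy processes and their characteristics -/

/-- A càdlàg path: right-continuous with finite left limits. -/
def IsCadlag (x : ℝ≥0 → ℝ) : Prop :=
  ∀ t, ContinuousWithinAt x (Ici t) t ∧ ∃ l : ℝ, Tendsto x (𝓝[<] t) (𝓝 l)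

/-- A one-dimensional Lévy process started at `0`. -/
structure IsLevyProcess {Ω : Type*} [MeasurableSpace Ω] (P : Measure Ω)
    (X : ℝ≥0 → Ω → ℝ) : Prop where
  measurable : ∀ t, Measurable (X t)
  zero : ∀ᵐ ω ∂P, X 0 ω = 0
  indep : HasIndepIncrements X P
  stationary : ∀ s t, IdentDistrib (fun ω => X (s + t) ω - X s ω) (X t) P P
  cadlag : ∀ᵐ ω ∂P, IsCadlag (fun t => X t ω)

/-- A Lévy measure on `ℝ ∖ {0}`, regarded as a measure on `ℝ` without mass at `0`. -/
def IsLevyMeasure (ν : Measure ℝ) : Prop :=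
  ν {0} = 0 ∧ ∫⁻ z, ENNReal.ofReal (min 1 (z ^ 2)) ∂ν < ∞

/-- The exponent
`Ψ(u) = -iγu + σ²u²/2 + ∫ (1 - e^{iuz} + iuz 1_{|z| < 1}) ν(dz)`. -/
def levyExponent (γ σ : ℝ) (ν : Measure ℝ) (u : ℝ) : ℂ :=
  -Complex.I * γ * u + (1 / 2 : ℂ) * σ ^ 2 * u ^ 2
    + ∫ z, (1 - Complex.exp (Complex.I * u * z)
        + Complex.I * u * (if |z| < 1 then (z : ℂ) else 0)) ∂ν

/-- `(γ, σ, ν)` is the characteristic triplet of `X`: `E[e^{iuX_t}] = e^{-tΨ(u)}`. -/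
structure HasTriplet {Ω : Type*} [MeasurableSpace Ω] (P : Measure Ω)
    (X : ℝ≥0 → Ω → ℝ) (γ σ : ℝ) (ν : Measure ℝ) : Prop where
  sigma_nonneg : 0 ≤ σ
  levyMeasure : IsLevyMeasure ν
  charFun_eq : ∀ (t : ℝ≥0) (u : ℝ),
    ∫ ω, Complex.exp (Complex.I * u * X t ω) ∂P
      = Complex.exp (-((t : ℝ) : ℂ) * levyExponent γ σ ν u)

/-- Exponential moment condition on the large jumps. -/
def HasExpMoment (ν : Measure ℝ) : Prop :=
  ∃ θ : ℝ, 0 < θ ∧ ∫⁻ z in {z : ℝ | 1 ≤ |z|}, ENNReal.ofReal (Real.exp (θ * |z|)) ∂ν < ∞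

/-- `X` has paths of bounded variation (on every compact time interval). -/
def HasBVPaths {Ω : Type*} [MeasurableSpace Ω] (P : Measure Ω) (X : ℝ≥0 → Ω → ℝ) : Prop :=
  ∀ᵐ ω ∂P, LocallyBoundedVariationOn (fun t => X t ω) univ

/-- The drift `δ = γ - ∫_{|z| < 1} z ν(dz)`; only used for paths of bounded variation. -/
def drift (γ : ℝ) (ν : Measure ℝ) : ℝ := γ - ∫ z in {z : ℝ | |z| < 1}, z ∂ν

/-- Case 2: bounded variation paths with drift in `[0, α]`. Case 1 is its complement. -/
def Case2 {Ω : Type*} [MeasurableSpace Ω] (P : Measure Ω) (X : ℝ≥0 → Ω → ℝ)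
    (γ : ℝ) (ν : Measure ℝ) (α : ℝ) : Prop :=
  HasBVPaths P X ∧ drift γ ν ∈ Icc 0 α

/-! ### Refraction strategies -/

open Classical in
/-- The rate `h^b(y)`: `α` above `b`, `0` below `b`; at `b` it is `δ` in Case 2 and `0` in
Case 1. It makes sense for `b = -∞` (constant rate `α`) and `b = +∞` (constant rate `0`). -/
def rate {Ω : Type*} [MeasurableSpace Ω] (P : Measure Ω) (X : ℝ≥0 → Ω → ℝ)
    (γ : ℝ) (ν : Measure ℝ) (α : ℝ) (b : EReal) (y : ℝ) : ℝ :=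
  if b < (y : EReal) then α
  else if (y : EReal) = b ∧ Case2 P X γ ν α then drift γ ν
  else 0

/-- The σ-algebra generated by `X` up to time `t`. -/
abbrev past {Ω : Type*} (X : ℝ≥0 → Ω → ℝ) (t : ℝ≥0) : MeasurableSpace Ω :=
  ⨆ s ≤ t, MeasurableSpace.comap (X s) inferInstance

/-- `U` is a strong solution of `U_t = x + X_t - ∫_0^t h(U_s) ds`, `t ≥ 0`: the equation holds
almost surely for all times and `U` is adapted to the natural filtration of `X` augmented by the
null sets, i.e. each `U_t` is a.s. equal to a variable measurable with respect to `past X t`. -/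
structure IsStrongSolution {Ω : Type*} [MeasurableSpace Ω] (P : Measure Ω) (X : ℝ≥0 → Ω → ℝ)
    (h : ℝ → ℝ) (x : ℝ) (U : ℝ≥0 → Ω → ℝ) : Prop where
  adapted : ∀ t, AEStronglyMeasurable[past X t] (U t) P
  equation : ∀ᵐ ω ∂P, ∀ t : ℝ≥0,
    U t ω = x + X t ω - ∫ s in (0 : ℝ)..t, h (U s.toNNReal ω)

/-- `U` is the unique (up to indistinguishability) strong solution. -/
def IsUniqueStrongSolution {Ω : Type*} [MeasurableSpace Ω] (P : Measure Ω) (X : ℝ≥0 → Ω → ℝ)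
    (h : ℝ → ℝ) (x : ℝ) (U : ℝ≥0 → Ω → ℝ) : Prop :=
  IsStrongSolution P X h x U ∧
    ∀ U', IsStrongSolution P X h x U' → ∀ᵐ ω ∂P, ∀ t, U' t ω = U t ω

/-- The controlled process for a threshold `b ∈ [-∞, ∞]` started at `x`, where `U b x` is the
refracted process for real `b`: it is `x + X` for `b = +∞` and `x + X_t - α t` for `b = -∞`. -/
def controlled {Ω : Type*} (X : ℝ≥0 → Ω → ℝ) (α : ℝ) (U : ℝ → ℝ → ℝ≥0 → Ω → ℝ)
    (b : EReal) (x : ℝ) (t : ℝ≥0) (ω : Ω) : ℝ :=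
  if b = ⊤ then x + X t ω
  else if b = ⊥ then x + X t ω - α * t
  else U b.toReal x t ω

/-! ### Discounted expectations, costs and the candidate threshold -/

/-- `∫_0^∞ e^{-qt} Y_t dt` converges absolutely in expectation. -/
def DiscountedIntegrable {Ω : Type*} [MeasurableSpace Ω] (P : Measure Ω) (q : ℝ)
    (Y : ℝ≥0 → Ω → ℝ) : Prop :=
  Integrable (fun p : Ω × ℝ => Real.exp (-q * p.2) * Y p.2.toNNReal p.1)
    (P.prod (volume.restrict (Ioi 0)))

/-- `E[∫_0^∞ e^{-qt} Y_t dt]`. -/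
def discounted {Ω : Type*} [MeasurableSpace Ω] (P : Measure Ω) (q : ℝ)
    (Y : ℝ≥0 → Ω → ℝ) : ℝ :=
  ∫ ω, (∫ t in Ioi (0 : ℝ), Real.exp (-q * t) * Y t.toNNReal ω) ∂P

/-- A running cost function: `C¹`, convex and of polynomial growth. -/
structure IsRunningCost (f : ℝ → ℝ) : Prop where
  contDiff : ContDiff ℝ 1 f
  convex : ConvexOn ℝ univ f
  growth : ∃ (k₁ k₂ : ℝ) (N : ℕ), 0 < k₁ ∧ 0 < k₂ ∧ ∀ x, |f x| < k₁ + k₂ * |x| ^ N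

/-- `ρ(b) = E_b[∫_0^∞ e^{-qt} f'(U^b_t) dt]`. -/
def rho {Ω : Type*} [MeasurableSpace Ω] (P : Measure Ω) (q : ℝ) (f : ℝ → ℝ)
    (U : ℝ → ℝ → ℝ≥0 → Ω → ℝ) (b : ℝ) : ℝ :=
  discounted P q (fun t ω => deriv f (U b b t ω))

/-- `b* = inf {b ∈ ℝ : ρ(b) - β ≥ 0}` in `[-∞, ∞]`, with `inf ∅ = +∞`. -/
def bStar {Ω : Type*} [MeasurableSpace Ω] (P : Measure Ω) (q β : ℝ) (f : ℝ → ℝ)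
    (U : ℝ → ℝ → ℝ≥0 → Ω → ℝ) : EReal :=
  sInf ((fun b : ℝ => (b : EReal)) '' {b : ℝ | 0 ≤ rho P q f U b - β})

/-- The total running and control cost rate `f(U^b_t) + β l^b_t` with `l^b_t = h^b(U^b_t)`. -/
def costRate {Ω : Type*} [MeasurableSpace Ω] (P : Measure Ω) (X : ℝ≥0 → Ω → ℝ)
    (γ : ℝ) (ν : Measure ℝ) (α β : ℝ) (f : ℝ → ℝ) (U : ℝ → ℝ → ℝ≥0 → Ω → ℝ)
    (b : EReal) (x : ℝ) (t : ℝ≥0) (ω : Ω) : ℝ :=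
  f (controlled X α U b x t ω) + β * rate P X γ ν α b (controlled X α U b x t ω)

/-- The expected discounted total cost `v_b(x)` of the refraction strategy at `b`. -/
def value {Ω : Type*} [MeasurableSpace Ω] (P : Measure Ω) (X : ℝ≥0 → Ω → ℝ)
    (γ : ℝ) (ν : Measure ℝ) (q α β : ℝ) (f : ℝ → ℝ) (U : ℝ → ℝ → ℝ≥0 → Ω → ℝ)
    (b : EReal) (x : ℝ) : ℝ :=
  discounted P q (costRate P X γ ν α β f U b x)

end Refraction

end

/-!
# The slope of the cost of the refraction strategy at the candidate threshold

Write `U` for the solution at the threshold `b` started at `x`, and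
`R x = E_x[∫_0^∞ e^{-qt} f'(U_t) dt]` for the discounted marginal running cost. The slope conditions
follow from the identity `v' = R` at `b = b*`: the function `R` is nondecreasing because the flow of
solutions is monotone and `f` is convex, and `R b* = ρ b* = β`.

*The identity `v' = R`.* For `x < y` let `V ≤ W` be the solutions started at `x` and `y`, and put
`k = h(W) - h(V) ≥ 0`, so that `W_t - V_t = (y - x) - ∫_0^t k_s ds` (`IsStrongSolution.flow`).
Convexity of `f` bounds `v y - v x` from both sides by `(y - x) R` minus the discounted expectation
of `f'` along `V` or `W` weighted by the loss of distance `∫_0^t k_s ds`, plus `β E[∫ e^{-qs} k_s ds]`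
(`totalCost_sub_bounds`). Where `k_s ≠ 0` both solutions are within `y - x` of `b`. Hence, by an
approximate Markov property at the fixed time `s` and by the monotonicity of `f'`, the future
marginal cost on that event is that of the solution started at `b`, up to a spatial shift by at most
`2 (y - x)` (`integral_mul_le_of_near`). Since the Laplace transform turns the convolution in time
into a product, the weighted loss is `E[∫ e^{-qs} k_s ds] · (R b + o(1))` (`integral_mul_loss_le`),
and with a constant weight the same argument shows that `E[∫ e^{-qs} k_s ds] ≤ y - x`
(`controlGap_le`). If `R b = β`, the weighted loss and the cost of control therefore cancel up to
`o(y - x)` (`totalCost_sub_sandwich`). No stopping times or path decompositions are needed, because the Markov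
property enters only at deterministic times; it is obtained by comparing the solution with a discrete
scheme driven by the increments of `X` after time `s`, which are independent of the past.

*The threshold.* Solutions for translated thresholds are translates of each other, so
`ρ (b + c) = E_b[∫ e^{-qt} f'(U_t + c) dt]` (`rho_add_eq_marginalCost`), which is continuous and
nondecreasing in `c`. Hence `ρ b* = β` when `b*` is finite.

*Infinite thresholds.* For `b* = ±∞` the rate is constant, solutions keep their distance, and
`v' = R` holds without any condition on `R`. The sign of `R - β` follows by letting real thresholds
tend to `±∞`: the solutions converge pathwise (`tendsto_solution_of_tendsto_rate`), and for a
threshold beyond the starting point the marginal cost is compared with `ρ` at that threshold.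

*Integrability.* The exponential moment condition makes the Lévy exponent smooth, which gives
absolute moments of `X_t` of all orders with polynomial growth in `t`
(`HasTriplet.exists_moment_bound`); the discounting absorbs these.
-/

namespace Refraction

/-! ### Moments from smoothness of the characteristic function -/

lemma exists_second_difference_bound {φ : ℝ → ℂ} (h : ContDiff ℝ 2 φ) :
    ∃ C : ℝ, ∀ u ∈ Icc (0 : ℝ) 1, ‖φ u + φ (-u) - 2 * φ 0‖ ≤ C * u ^ 2 := by
  set g : ℝ → ℂ := fun u => φ u + φ (-u) with hg
  have hgc : ContDiff ℝ 2 g := h.add (h.comp contDiff_neg)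
  obtain ⟨C, hC⟩ := exists_taylor_mean_remainder_bound (f := g) (n := 1) (a := 0) (b := 1)
    zero_le_one hgc.contDiffOn
  refine ⟨C, fun u hu => ?_⟩
  have h1 := hC u hu
  have hd : HasDerivAt φ (deriv φ 0) 0 :=
    (h.differentiable (by norm_num)).differentiableAt.hasDerivAt
  have hd' : HasDerivAt (fun u : ℝ => φ (-u)) (-deriv φ 0) 0 := by
    have hd0 : HasDerivAt φ (deriv φ 0) (-0) := by simpa only [neg_zero] using hd
    have := HasDerivAt.scomp (g₁ := φ) (h := fun u : ℝ => -u) (0 : ℝ) hd0 (hasDerivAt_neg 0)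
    simpa [Function.comp_def] using this
  have hgd : HasDerivAt g 0 0 := by
    have := hd.fun_add hd'
    rwa [add_neg_cancel] at this
  have h2 : derivWithin g (Icc 0 1) 0 = 0 :=
    hgd.hasDerivWithinAt.derivWithin (uniqueDiffOn_Icc zero_lt_one 0 (by simp))
  rw [taylorWithinEval_succ, taylor_within_zero_eval] at h1
  simp only [zero_add, iteratedDerivWithin_one, h2, smul_zero, add_zero, sub_zero] at h1
  have h3 : g 0 = 2 * φ 0 := by simp [hg]; ring
  rw [h3] at h1
  simpa using h1

lemma integral_two_sub_two_cos (μ : Measure ℝ) [IsFiniteMeasure μ] (u : ℝ) :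
    ∫ x, (2 - 2 * Real.cos (u * x)) ∂μ
      = -(charFun μ u + charFun μ (-u) - 2 * charFun μ 0).re := by
  have hi : ∀ v : ℝ, Integrable (fun x : ℝ => Complex.exp (v * x * Complex.I)) μ := fun v => by
    refine Integrable.of_bound (C := 1) (by fun_prop) (Eventually.of_forall fun x => ?_)
    rw [← Complex.ofReal_mul, Complex.norm_exp_ofReal_mul_I]
  have hre : ∀ v : ℝ, (charFun μ v).re = ∫ x, Real.cos (v * x) ∂μ := fun v => by
    rw [charFun_apply_real, ← RCLike.re_eq_complex_re, ← integral_re (hi v)]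
    refine integral_congr_ae (Eventually.of_forall fun x => ?_)
    simp only [RCLike.re_eq_complex_re]
    rw [← Complex.ofReal_mul, Complex.exp_ofReal_mul_I_re]
  have hc : ∀ v : ℝ, Integrable (fun x : ℝ => Real.cos (v * x)) μ := fun v =>
    Integrable.of_bound (C := 1) (by fun_prop) (Eventually.of_forall fun x => by
      simpa using Real.abs_cos_le_one _)
  rw [Complex.sub_re, Complex.add_re, hre, hre, Complex.mul_re, hre,
    integral_sub (integrable_const _) ((hc u).const_mul 2), integral_const_mul]
  simp
  ring

/-- Fatou's lemma applied to the second difference quotients of the characteristic function. -/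
lemma integrable_sq_of_contDiff_charFun (μ : Measure ℝ) [IsFiniteMeasure μ]
    (h : ContDiff ℝ 2 (charFun μ)) : Integrable (fun x : ℝ => x ^ 2) μ := by
  obtain ⟨C, hC⟩ := exists_second_difference_bound h
  set F : ℕ → ℝ → ℝ := fun n x => ((n : ℝ) + 1) ^ 2 * (2 - 2 * Real.cos (((n : ℝ) + 1)⁻¹ * x))
    with hF
  have hFnn : ∀ n x, 0 ≤ F n x := fun n x => by
    have := Real.cos_le_one (((n : ℝ) + 1)⁻¹ * x)
    have : 0 ≤ 2 - 2 * Real.cos (((n : ℝ) + 1)⁻¹ * x) := by linarith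
    positivity
  have hFi : ∀ n, Integrable (F n) μ := fun n => by
    refine Integrable.const_mul (Integrable.of_bound (C := 4) (by fun_prop)
      (Eventually.of_forall fun x => ?_)) _
    have := Real.abs_cos_le_one (((n : ℝ) + 1)⁻¹ * x)
    rw [abs_le] at this
    rw [Real.norm_eq_abs, abs_le]
    constructor <;> linarith
  have hFb : ∀ n, ∫⁻ x, ENNReal.ofReal (F n x) ∂μ ≤ ENNReal.ofReal C := fun n => by
    rw [← ofReal_integral_eq_lintegral_ofReal (hFi n) (Eventually.of_forall (hFnn n))]
    refine ENNReal.ofReal_le_ofReal ?_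
    have hn : (0 : ℝ) < (n : ℝ) + 1 := by positivity
    simp only [hF]
    rw [integral_const_mul, integral_two_sub_two_cos]
    have h1 := hC ((n : ℝ) + 1)⁻¹ ⟨by positivity,
      inv_le_one_of_one_le₀ (by linarith [n.cast_nonneg (α := ℝ)])⟩
    have h2 := (Complex.abs_re_le_norm _).trans h1
    have h3 := (neg_le_abs _).trans h2
    calc _ ≤ ((n : ℝ) + 1) ^ 2 * (C * (((n : ℝ) + 1)⁻¹) ^ 2) := by gcongr
      _ = C := by field_simp
  -- `2 - 2 cos y ≥ 4 y² / π²` for `|y| ≤ π`, which applies at `y = x / (n + 1)` for large `n`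
  have hlim : ∀ x : ℝ, ENNReal.ofReal (4 / Real.pi ^ 2 * x ^ 2)
      ≤ liminf (fun n => ENNReal.ofReal (F n x)) atTop := fun x => by
    refine le_liminf_of_le (by isBoundedDefault) ?_
    obtain ⟨m, hm⟩ := exists_nat_ge |x|
    filter_upwards [eventually_ge_atTop m] with n hn
    refine ENNReal.ofReal_le_ofReal ?_
    have hn' : |x| ≤ (n : ℝ) + 1 := hm.trans (by exact_mod_cast (hn.trans n.le_succ))
    have hp : (0 : ℝ) < (n : ℝ) + 1 := by positivity
    have h1 : |((n : ℝ) + 1)⁻¹ * x| ≤ Real.pi := by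
      rw [abs_mul, abs_of_pos (by positivity)]
      calc ((n : ℝ) + 1)⁻¹ * |x| ≤ ((n : ℝ) + 1)⁻¹ * ((n : ℝ) + 1) := by gcongr
        _ = 1 := by field_simp
        _ ≤ Real.pi := by linarith [Real.pi_gt_three]
    have h2 := Real.cos_le_one_sub_mul_cos_sq h1
    have h3 : 4 / Real.pi ^ 2 * (((n : ℝ) + 1)⁻¹ * x) ^ 2
        ≤ 2 - 2 * Real.cos (((n : ℝ) + 1)⁻¹ * x) := by
      have : 4 / Real.pi ^ 2 * (((n : ℝ) + 1)⁻¹ * x) ^ 2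
        = 2 * (2 / Real.pi ^ 2 * (((n : ℝ) + 1)⁻¹ * x) ^ 2) := by ring
      linarith
    calc 4 / Real.pi ^ 2 * x ^ 2
        = ((n : ℝ) + 1) ^ 2 * (4 / Real.pi ^ 2 * (((n : ℝ) + 1)⁻¹ * x) ^ 2) := by field_simp
      _ ≤ F n x := by simp only [hF]; gcongr
  have hfin : ∫⁻ x, ENNReal.ofReal (4 / Real.pi ^ 2 * x ^ 2) ∂μ ≤ ENNReal.ofReal C :=
    calc _ ≤ ∫⁻ x, liminf (fun n => ENNReal.ofReal (F n x)) atTop ∂μ := lintegral_mono hlim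
      _ ≤ liminf (fun n => ∫⁻ x, ENNReal.ofReal (F n x) ∂μ) atTop :=
          lintegral_liminf_le fun n => by fun_prop
      _ ≤ ENNReal.ofReal C := by
          refine liminf_le_of_frequently_le' (Frequently.of_forall hFb)
  have hI : Integrable (fun x : ℝ => 4 / Real.pi ^ 2 * x ^ 2) μ := by
    refine ⟨by fun_prop, ?_⟩
    rw [hasFiniteIntegral_iff_ofReal (Eventually.of_forall fun x => by positivity)]
    exact hfin.trans_lt ENNReal.ofReal_lt_top
  have := hI.const_mul (Real.pi ^ 2 / 4)
  refine this.congr (Eventually.of_forall fun x => ?_)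
  have := Real.pi_pos
  simp only
  field_simp

lemma charFun_withDensity_even_pow (μ : Measure ℝ) [IsFiniteMeasure μ] (k : ℕ)
    (h : MemLp id ((2 * k : ℕ) : ℝ≥0∞) μ) (t : ℝ) :
    charFun (μ.withDensity fun x => ENNReal.ofReal (x ^ (2 * k))) t
      = (-1) ^ k * iteratedDeriv (2 * k) (charFun μ) t := by
  rw [iteratedDeriv_charFun h, charFun_apply_real,
    integral_withDensity_eq_integral_toReal_smul (by fun_prop)
      (Eventually.of_forall fun x => ENNReal.ofReal_lt_top), pow_mul Complex.I, Complex.I_sq,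
    ← mul_assoc, ← mul_pow]
  simp only [mul_neg, mul_one, neg_neg, one_pow, one_mul]
  refine integral_congr_ae (Eventually.of_forall fun x => ?_)
  have : (0 : ℝ) ≤ x ^ (2 * k) := by rw [pow_mul]; positivity
  simp only [ENNReal.toReal_ofReal this, Complex.real_smul, Complex.ofReal_pow]

/-- A measure with a smooth characteristic function has moments of all orders. -/
lemma memLp_id_of_contDiff_charFun (μ : Measure ℝ) [IsFiniteMeasure μ]
    (h : ∀ n : ℕ, ContDiff ℝ n (charFun μ)) (n : ℕ) : MemLp id n μ := by
  have key : ∀ k : ℕ, MemLp id ((2 * k : ℕ) : ℝ≥0∞) μ := fun k => by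
    induction k with
    | zero => simpa using (by fun_prop : AEStronglyMeasurable (id : ℝ → ℝ) μ)
    | succ k ih =>
      have hint : Integrable (fun x : ℝ => x ^ (2 * k)) μ := by
        have := ih.integrable_norm_pow'
        refine this.congr (Eventually.of_forall fun x => ?_)
        simp only [id_eq, Real.norm_eq_abs, pow_mul, sq_abs]
      have hnn : ∀ x : ℝ, (0 : ℝ) ≤ x ^ (2 * k) := fun x => by rw [pow_mul]; positivity
      -- the measure `x^(2k) μ` has, up to sign, the `2k`-th derivative of `charFun μ` as its
      -- characteristic function, so its second moment is finite
      set μ' := μ.withDensity fun x => ENNReal.ofReal (x ^ (2 * k)) with hμ'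
      have : IsFiniteMeasure μ' := isFiniteMeasure_withDensity_ofReal hint.2
      have hc : ContDiff ℝ 2 (charFun μ') := by
        have : charFun μ' = fun t => (-1) ^ k * iteratedDeriv (2 * k) (charFun μ) t :=
          funext fun t => charFun_withDensity_even_pow μ k ih t
        rw [this]
        refine contDiff_const.mul ?_
        rw [iteratedDeriv_eq_iterate]
        exact ContDiff.iterate_deriv' 2 (2 * k) (by exact_mod_cast h (2 + 2 * k))
      have h2 := integrable_sq_of_contDiff_charFun μ' hc
      rw [hμ', integrable_withDensity_iff_integrable_smul' (by fun_prop)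
        (Eventually.of_forall fun x => ENNReal.ofReal_lt_top)] at h2
      have h3 : Integrable (fun x : ℝ => ‖(id x : ℝ)‖ ^ (2 * (k + 1))) μ := by
        refine h2.congr (Eventually.of_forall fun x => ?_)
        simp only [id_eq, Real.norm_eq_abs, pow_mul, sq_abs, smul_eq_mul]
        rw [← pow_mul, ENNReal.toReal_ofReal (hnn x)]
        ring
      refine (integrable_norm_rpow_iff (by fun_prop) (by simp)
        (ENNReal.natCast_ne_top _)).1 ?_
      simpa only [ENNReal.toReal_natCast, Real.rpow_natCast] using h3
  exact (key n).mono_exponent (by exact_mod_cast Nat.le_mul_of_pos_left n two_pos)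

section

/-! ### Smoothness of the Lévy exponent -/

lemma IsLevyMeasure.integrable_abs_pow {ν : Measure ℝ} (hν : IsLevyMeasure ν)
    (hexp : HasExpMoment ν) {n : ℕ} (hn : 2 ≤ n) : Integrable (fun z : ℝ => |z| ^ n) ν := by
  obtain ⟨θ, hθ, hE⟩ := hexp
  refine ⟨by fun_prop, ?_⟩
  rw [hasFiniteIntegral_iff_ofReal (Eventually.of_forall fun x => by positivity)]
  have hS : MeasurableSet {z : ℝ | 1 ≤ |z|} := measurableSet_le measurable_const (by fun_prop)
  rw [← lintegral_add_compl _ hS]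
  refine ENNReal.add_lt_top.2 ⟨?_, ?_⟩
  · calc ∫⁻ z in {z : ℝ | 1 ≤ |z|}, ENNReal.ofReal (|z| ^ n) ∂ν
        ≤ ∫⁻ z in {z : ℝ | 1 ≤ |z|},
            ENNReal.ofReal (n.factorial / θ ^ n) * ENNReal.ofReal (Real.exp (θ * |z|)) ∂ν := by
          refine lintegral_mono fun z => ?_
          rw [← ENNReal.ofReal_mul (by positivity)]
          refine ENNReal.ofReal_le_ofReal ?_
          have h1 := Real.pow_div_factorial_le_exp (θ * |z|) (by positivity) n
          rw [mul_pow] at h1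
          calc |z| ^ n = n.factorial / θ ^ n * (θ ^ n * |z| ^ n / n.factorial) := by
                have : (0 : ℝ) < n.factorial := by exact_mod_cast n.factorial_pos
                field_simp
            _ ≤ _ := by gcongr
      _ < ∞ := by
          rw [lintegral_const_mul _ (by fun_prop)]
          exact ENNReal.mul_lt_top ENNReal.ofReal_lt_top hE
  · calc ∫⁻ z in {z : ℝ | 1 ≤ |z|}ᶜ, ENNReal.ofReal (|z| ^ n) ∂ν
        ≤ ∫⁻ z in {z : ℝ | 1 ≤ |z|}ᶜ, ENNReal.ofReal (min 1 (z ^ 2)) ∂ν := by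
          refine setLIntegral_mono' hS.compl fun z hz => ?_
          refine ENNReal.ofReal_le_ofReal ?_
          have hz' : |z| < 1 := by simpa using hz
          have h2 : |z| ^ n ≤ |z| ^ 2 := pow_le_pow_of_le_one (abs_nonneg z) hz'.le hn
          have h3 : |z| ^ 2 ≤ 1 := pow_le_one₀ (abs_nonneg z) hz'.le
          rw [sq_abs] at h2 h3
          rw [min_eq_right h3]
          exact h2
      _ ≤ ∫⁻ z, ENNReal.ofReal (min 1 (z ^ 2)) ∂ν := setLIntegral_le_lintegral _ _
      _ < ∞ := hν.2

lemma norm_one_sub_exp_add_le (x : ℝ) :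
    ‖1 - Complex.exp (Complex.I * x) + Complex.I * x‖ ≤ 3 * x ^ 2 := by
  rcases le_or_gt |x| 1 with h | h
  · have h1 := Complex.norm_exp_sub_one_sub_id_le (x := Complex.I * x) (by simpa using h)
    rw [← norm_neg] at h1
    have h2 : -(Complex.exp (Complex.I * x) - 1 - Complex.I * x)
      = 1 - Complex.exp (Complex.I * x) + Complex.I * x := by ring
    rw [h2] at h1
    refine h1.trans ?_
    simp
    nlinarith [sq_nonneg x]
  · have h1 : ‖Complex.exp (Complex.I * x) - 1‖ ≤ ‖x‖ := Real.norm_exp_I_mul_ofReal_sub_one_le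
    rw [← norm_neg, neg_sub] at h1
    calc _ ≤ ‖1 - Complex.exp (Complex.I * x)‖ + ‖Complex.I * (x : ℂ)‖ := norm_add_le _ _
      _ ≤ |x| + |x| := by
        refine add_le_add (by simpa using h1) (by simp)
      _ ≤ 3 * x ^ 2 := by rw [← sq_abs]; nlinarith

lemma norm_one_sub_exp_le (x : ℝ) : ‖1 - Complex.exp (Complex.I * x)‖ ≤ |x| := by
  have h1 : ‖Complex.exp (Complex.I * x) - 1‖ ≤ ‖x‖ := Real.norm_exp_I_mul_ofReal_sub_one_le
  rwa [← norm_neg, neg_sub] at h1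

/-- The jump part of the exponent, compensated by the full linear term instead of its truncation to
`|z| < 1`. Its second derivative is the characteristic function of `z² ν(dz)`, a finite measure with
moments of all orders. -/
noncomputable def compensatedExponent (ν : Measure ℝ) (u : ℝ) : ℂ :=
  ∫ z : ℝ, (1 - Complex.exp (Complex.I * u * z) + Complex.I * u * z) ∂ν

variable {ν : Measure ℝ}

lemma integrable_compensated (h2 : Integrable (fun z : ℝ => z ^ 2) ν) (u : ℝ) :
    Integrable (fun z : ℝ => 1 - Complex.exp (Complex.I * u * z) + Complex.I * u * z) ν := by
  refine (h2.const_mul (3 * u ^ 2)).mono' (by fun_prop) (Eventually.of_forall fun z => ?_)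
  have := norm_one_sub_exp_add_le (u * z)
  simp only [Complex.ofReal_mul, ← mul_assoc] at this
  refine this.trans (le_of_eq (by ring))

lemma integrable_compensated_deriv (h2 : Integrable (fun z : ℝ => z ^ 2) ν) (u : ℝ) :
    Integrable (fun z : ℝ => Complex.I * z * (1 - Complex.exp (Complex.I * u * z))) ν := by
  refine (h2.const_mul |u|).mono' (by fun_prop) (Eventually.of_forall fun z => ?_)
  have := norm_one_sub_exp_le (u * z)
  simp only [Complex.ofReal_mul, ← mul_assoc] at this
  rw [norm_mul]
  calc _ ≤ |z| * |u * z| := by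
        gcongr
        simp
    _ = |u| * z ^ 2 := by rw [abs_mul, ← sq_abs z]; ring

lemma hasDerivAt_compensatedExponent (h2 : Integrable (fun z : ℝ => z ^ 2) ν) (u : ℝ) :
    HasDerivAt (compensatedExponent ν)
      (∫ z : ℝ, Complex.I * z * (1 - Complex.exp (Complex.I * u * z)) ∂ν) u := by
  refine (hasDerivAt_integral_of_dominated_loc_of_deriv_le
    (F' := fun (v : ℝ) (z : ℝ) => Complex.I * z * (1 - Complex.exp (Complex.I * v * z)))
    (bound := fun z => (|u| + 1) * z ^ 2) (Metric.ball_mem_nhds u one_pos)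
    (Eventually.of_forall fun v => by fun_prop) (integrable_compensated h2 u) (by fun_prop)
    (Eventually.of_forall fun z v hv => ?_) (h2.const_mul _)
    (Eventually.of_forall fun z v hv => ?_)).2
  · have := norm_one_sub_exp_le (v * z)
    simp only [Complex.ofReal_mul, ← mul_assoc] at this
    have hv' : |v| ≤ |u| + 1 := by
      rw [Metric.mem_ball, Real.dist_eq] at hv
      have := abs_sub_abs_le_abs_sub v u
      linarith
    rw [norm_mul]
    calc _ ≤ |z| * |v * z| := by
          gcongr
          simp
      _ = |v| * z ^ 2 := by rw [abs_mul, ← sq_abs z]; ring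
      _ ≤ _ := by gcongr
  · have h0 : HasDerivAt (fun v : ℝ => Complex.I * v * z) (Complex.I * z) v := by
      have := ((Complex.ofRealCLM.hasDerivAt (x := v)).const_mul Complex.I).mul_const (z : ℂ)
      simpa using this
    have h3 := ((h0.cexp).const_sub 1).add h0
    refine h3.congr_deriv ?_
    ring

lemma hasDerivAt_compensatedExponent_deriv (h2 : Integrable (fun z : ℝ => z ^ 2) ν) (u : ℝ) :
    HasDerivAt (fun u : ℝ => ∫ z : ℝ, Complex.I * z * (1 - Complex.exp (Complex.I * u * z)) ∂ν)
      (charFun (ν.withDensity fun z => ENNReal.ofReal (z ^ 2)) u) u := by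
  have hd := (hasDerivAt_integral_of_dominated_loc_of_deriv_le
    (F := fun (u z : ℝ) => Complex.I * z * (1 - Complex.exp (Complex.I * u * z)))
    (F' := fun (v : ℝ) (z : ℝ) => (z : ℂ) ^ 2 * Complex.exp (Complex.I * v * z))
    (bound := fun z => z ^ 2) (x₀ := u) (μ := ν) (Metric.ball_mem_nhds u one_pos)
    (Eventually.of_forall fun v => by fun_prop) (integrable_compensated_deriv h2 u) (by fun_prop)
    (Eventually.of_forall fun z v hv => ?_) h2
    (Eventually.of_forall fun z v hv => ?_)).2
  · refine hd.congr_deriv ?_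
    rw [charFun_apply_real, integral_withDensity_eq_integral_toReal_smul (by fun_prop)
      (Eventually.of_forall fun x => ENNReal.ofReal_lt_top)]
    refine integral_congr_ae (Eventually.of_forall fun z => ?_)
    simp only [ENNReal.toReal_ofReal (sq_nonneg z), Complex.real_smul, Complex.ofReal_pow]
    congr 2
    ring
  · rw [norm_mul, mul_assoc, ← Complex.ofReal_mul, Complex.norm_exp_I_mul_ofReal]
    simp
  · have h0 : HasDerivAt (fun v : ℝ => Complex.I * v * z) (Complex.I * z) v := by
      have := ((Complex.ofRealCLM.hasDerivAt (x := v)).const_mul Complex.I).mul_const (z : ℂ)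
      simpa using this
    have h3 := ((h0.cexp).const_sub 1).const_mul (Complex.I * (z : ℂ))
    refine h3.congr_deriv ?_
    linear_combination (- (z : ℂ) ^ 2 * Complex.exp (Complex.I * v * z)) * Complex.I_sq

lemma contDiff_compensatedExponent (hν : IsLevyMeasure ν) (hexp : HasExpMoment ν) (n : ℕ) :
    ContDiff ℝ n (compensatedExponent ν) := by
  have h2 : Integrable (fun z : ℝ => z ^ 2) ν := by
    simpa using hν.integrable_abs_pow hexp le_rfl
  set ν' := ν.withDensity fun z => ENNReal.ofReal (z ^ 2) with hν'
  have : IsFiniteMeasure ν' := isFiniteMeasure_withDensity_ofReal h2.2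
  have hm : ∀ k : ℕ, MemLp id k ν' := fun k => by
    rcases Nat.eq_zero_or_pos k with rfl | hk
    · simpa using (by fun_prop : AEStronglyMeasurable (id : ℝ → ℝ) ν')
    refine (integrable_norm_rpow_iff (by fun_prop) (by simpa using hk.ne')
      (ENNReal.natCast_ne_top _)).1 ?_
    simp only [ENNReal.toReal_natCast, Real.rpow_natCast]
    rw [hν', integrable_withDensity_iff_integrable_smul' (by fun_prop)
        (Eventually.of_forall fun x => ENNReal.ofReal_lt_top)]
    refine (hν.integrable_abs_pow hexp (n := 2 + k) (by omega)).congr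
      (Eventually.of_forall fun z => ?_)
    simp only [ENNReal.toReal_ofReal (sq_nonneg z), smul_eq_mul, id, Real.norm_eq_abs, pow_add,
      sq_abs]
  have hc : ContDiff ℝ n (charFun ν') := contDiff_charFun (hm n)
  have h1 : ContDiff ℝ (n + 1 + 1 : ℕ) (compensatedExponent ν) := by
    have e1 : deriv (compensatedExponent ν)
        = fun u : ℝ => ∫ z : ℝ, Complex.I * z * (1 - Complex.exp (Complex.I * u * z)) ∂ν :=
      funext fun u => (hasDerivAt_compensatedExponent h2 u).deriv
    have e2 : deriv (deriv (compensatedExponent ν)) = charFun ν' := by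
      rw [e1]
      exact funext fun u => (hasDerivAt_compensatedExponent_deriv h2 u).deriv
    push_cast
    refine contDiff_succ_iff_deriv.2
      ⟨fun u => (hasDerivAt_compensatedExponent h2 u).differentiableAt, by simp, ?_⟩
    refine contDiff_succ_iff_deriv.2 ⟨?_, by simp, ?_⟩
    · rw [e1]
      exact fun u => (hasDerivAt_compensatedExponent_deriv h2 u).differentiableAt
    · rw [e2]
      exact hc
  exact h1.of_le (by exact_mod_cast (by omega : n ≤ n + 1 + 1))

lemma levyExponent_eq (hν : IsLevyMeasure ν) (hexp : HasExpMoment ν) (γ σ u : ℝ) :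
    levyExponent γ σ ν u = -Complex.I * γ * u + (1 / 2 : ℂ) * σ ^ 2 * u ^ 2
      + (compensatedExponent ν u
        - Complex.I * u * ∫ z : ℝ, (if |z| < 1 then 0 else (z : ℂ)) ∂ν) := by
  have h2 : Integrable (fun z : ℝ => z ^ 2) ν := by
    simpa using hν.integrable_abs_pow hexp le_rfl
  have hS : MeasurableSet {z : ℝ | |z| < 1} := measurableSet_lt (by fun_prop) measurable_const
  have hi : Integrable (fun z : ℝ => if |z| < 1 then 0 else (z : ℂ)) ν := by
    refine h2.mono' ?_ (Eventually.of_forall fun z => ?_)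
    · exact (Measurable.ite hS measurable_const (by fun_prop)).aestronglyMeasurable
    · split_ifs with h
      · simpa using sq_nonneg z
      · simp only [Complex.norm_real, Real.norm_eq_abs]
        rw [← sq_abs]
        nlinarith
  rw [levyExponent, compensatedExponent, ← integral_const_mul,
    ← integral_sub (integrable_compensated h2 u) (hi.const_mul _)]
  congr 1
  refine integral_congr_ae (Eventually.of_forall fun z => ?_)
  simp only
  split_ifs <;> ring

lemma contDiff_levyExponent (hν : IsLevyMeasure ν) (hexp : HasExpMoment ν) (γ σ : ℝ) (n : ℕ) :
    ContDiff ℝ n (levyExponent γ σ ν) := by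
  rw [funext (levyExponent_eq hν hexp γ σ)]
  have h0 : ContDiff ℝ n (fun u : ℝ => (u : ℂ)) := Complex.ofRealCLM.contDiff
  have h1 := contDiff_compensatedExponent hν hexp n
  fun_prop

lemma levyExponent_zero (γ σ : ℝ) : levyExponent γ σ ν 0 = 0 := by
  simp [levyExponent]

/-! ### Moments of the process -/

/-- By the Faà di Bruno bound for the composition of `exp` with `-tΨ`. As `Ψ 0 = 0`, the derivatives of
`exp` enter only through their values at `0`, which do not depend on `t`. -/
lemma exists_iteratedDeriv_exp_bound {Ψ : ℝ → ℂ} {n : ℕ} (hΨ : ContDiff ℝ n Ψ) (h0 : Ψ 0 = 0) :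
    ∃ C : ℝ, ∀ t : ℝ≥0,
      ‖iteratedDeriv n (fun u => Complex.exp (-((t : ℝ) : ℂ) * Ψ u)) 0‖ ≤ C * (1 + t) ^ n := by
  set M : ℝ := 1 + ∑ i ∈ Finset.range (n + 1), ‖iteratedFDeriv ℝ i Ψ 0‖ with hM
  set C₀ : ℝ := ∑ i ∈ Finset.range (n + 1), ‖iteratedFDeriv ℝ i Complex.exp 0‖ with hC₀
  refine ⟨n.factorial * C₀ * M ^ n, fun t => ?_⟩
  have hle : ∀ i ≤ n, ‖iteratedFDeriv ℝ i Ψ 0‖ ≤ M := fun i hi => by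
    have := Finset.single_le_sum (f := fun i => ‖iteratedFDeriv ℝ i Ψ 0‖)
      (fun j _ => norm_nonneg _) (Finset.mem_range.2 (Nat.lt_succ_of_le hi))
    linarith
  have hM1 : 1 ≤ M := by
    have : 0 ≤ ∑ i ∈ Finset.range (n + 1), ‖iteratedFDeriv ℝ i Ψ 0‖ :=
      Finset.sum_nonneg fun _ _ => norm_nonneg _
    linarith
  have hf : ContDiff ℝ n (fun u => -((t : ℝ) : ℂ) * Ψ u) := contDiff_const.mul hΨ
  have h := norm_iteratedFDeriv_comp_le (𝕜 := ℝ) (g := Complex.exp)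
    (f := fun u => -((t : ℝ) : ℂ) * Ψ u) (n := n) (N := n) (C := C₀) (D := M * (1 + t))
    Complex.contDiff_exp hf le_rfl 0 ?_ ?_
  · rw [iteratedDeriv_eq_iteratedFDeriv]
    refine (ContinuousMultilinearMap.le_opNorm _ _).trans ?_
    simp only [norm_one, Finset.prod_const_one, mul_one]
    refine h.trans (le_of_eq ?_)
    rw [mul_pow]
    ring
  · intro i hi
    simp only [h0, mul_zero]
    exact Finset.single_le_sum (f := fun i => ‖iteratedFDeriv ℝ i Complex.exp 0‖)
      (fun j _ => norm_nonneg _) (Finset.mem_range.2 (Nat.lt_succ_of_le hi))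
  · intro i hi1 hi
    have e : (fun u => -((t : ℝ) : ℂ) * Ψ u) = fun u => (-(t : ℝ)) • Ψ u := by
      funext u; simp
    rw [e, iteratedFDeriv_const_smul_apply' (hΨ.of_le (by exact_mod_cast hi)).contDiffAt, norm_smul]
    have ht : (0 : ℝ) ≤ t := t.2
    calc ‖-(t : ℝ)‖ * ‖iteratedFDeriv ℝ i Ψ 0‖ ≤ (1 + t) * M := by
          gcongr
          · simp
          · exact hle i hi
      _ = M * (1 + t) := mul_comm _ _
      _ ≤ (M * (1 + t)) ^ i := le_self_pow₀ (by nlinarith) (by omega)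

variable {Ω : Type*} [MeasurableSpace Ω] {P : Measure Ω} {X : ℝ≥0 → Ω → ℝ} {γ σ : ℝ}

lemma HasTriplet.charFun_map (hν : HasTriplet P X γ σ ν) {t : ℝ≥0} (hX : Measurable (X t)) :
    charFun (P.map (X t)) = fun u => Complex.exp (-((t : ℝ) : ℂ) * levyExponent γ σ ν u) := by
  funext u
  rw [← hν.charFun_eq, charFun_apply_real, integral_map hX.aemeasurable (by fun_prop)]
  congr with ω
  ring_nf

/-- The even moments of the Lévy process grow at most polynomially in time. -/
lemma HasTriplet.exists_moment_bound [IsProbabilityMeasure P]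
    (hν : HasTriplet P X γ σ ν) (hexp : HasExpMoment ν)
    (hX : ∀ t, Measurable (X t)) (n : ℕ) :
    ∃ C : ℝ, ∀ t : ℝ≥0, Integrable (fun ω => |X t ω| ^ (2 * n)) P ∧
      ∫ ω, |X t ω| ^ (2 * n) ∂P ≤ C * (1 + t) ^ (2 * n) := by
  obtain ⟨C, hC⟩ := exists_iteratedDeriv_exp_bound
    (contDiff_levyExponent hν.levyMeasure hexp γ σ (2 * n)) (levyExponent_zero γ σ)
  refine ⟨C, fun t => ?_⟩
  have : IsProbabilityMeasure (P.map (X t)) := Measure.isProbabilityMeasure_map (hX t).aemeasurable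
  have hm : MemLp id ((2 * n : ℕ) : ℝ≥0∞) (P.map (X t)) := by
    refine memLp_id_of_contDiff_charFun _ (fun m => ?_) _
    rw [hν.charFun_map (hX t)]
    exact (contDiff_const.mul (contDiff_levyExponent hν.levyMeasure hexp γ σ m)).cexp
  have hi : Integrable (fun x : ℝ => |x| ^ (2 * n)) (P.map (X t)) := hm.integrable_norm_pow'
  refine ⟨(integrable_map_measure hi.1 (hX t).aemeasurable).1 hi, ?_⟩
  have h1 := hC t
  rw [← hν.charFun_map (hX t), iteratedDeriv_charFun_zero hm,
    integral_map (hX t).aemeasurable (by fun_prop)] at h1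
  refine le_trans (le_of_eq ?_) h1
  have hnn : (0 : ℝ) ≤ ∫ ω, X t ω ^ (2 * n) ∂P :=
    integral_nonneg fun ω => by simp only [pow_mul]; positivity
  rw [norm_mul, norm_pow, Complex.norm_I, one_pow, one_mul, Complex.norm_real, Real.norm_eq_abs,
    abs_of_nonneg hnn]
  simp only [pow_mul, sq_abs]

end

section

/-! ### Deterministic analysis of the refraction equation -/

/-- The grid point of mesh `1 / (n + 1)` strictly to the right of `t`. -/
noncomputable def rightGrid (n : ℕ) (t : ℝ) : ℝ := (⌊(n + 1 : ℝ) * t⌋ + 1 : ℝ) / (n + 1)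

lemma tendsto_rightGrid (t : ℝ) : Tendsto (fun n => rightGrid n t) atTop (𝓝[≥] t) := by
  have hb : ∀ n : ℕ, t ≤ rightGrid n t ∧ rightGrid n t ≤ t + 1 / ((n : ℝ) + 1) := fun n => by
    have hn : (0 : ℝ) < (n : ℝ) + 1 := by positivity
    have h1 := Int.lt_floor_add_one ((n + 1 : ℝ) * t)
    have h2 := Int.floor_le ((n + 1 : ℝ) * t)
    rw [rightGrid]
    constructor
    · rw [le_div_iff₀ hn]
      linarith
    · rw [div_le_iff₀ hn]
      calc _ ≤ t * (n + 1) + 1 := by linarith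
        _ = _ := by field_simp
  refine tendsto_nhdsWithin_iff.2 ⟨?_, Eventually.of_forall fun n => (hb n).1⟩
  refine tendsto_of_tendsto_of_tendsto_of_le_of_le tendsto_const_nhds ?_
    (fun n => (hb n).1) (fun n => (hb n).2)
  simpa only [add_zero] using
    (tendsto_const_nhds (x := t)).add (tendsto_one_div_add_atTop_nhds_zero_nat (𝕜 := ℝ))

lemma measurable_of_rightContinuous {p : ℝ → ℝ} (hp : ∀ t, ContinuousWithinAt p (Ici t) t) :
    Measurable p := by
  refine measurable_of_tendsto_metrizable (f := fun n t => p (rightGrid n t)) (fun n => ?_)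
    (tendsto_pi_nhds.2 fun t => (hp t).tendsto.comp (tendsto_rightGrid t))
  have : (fun t => p (rightGrid n t))
      = (fun k : ℤ => p ((k + 1 : ℝ) / (n + 1))) ∘ fun t : ℝ => ⌊(n + 1 : ℝ) * t⌋ := rfl
  rw [this]
  exact (measurable_from_top).comp (Int.measurable_floor.comp (by fun_prop))

/-- `u` solves `u_t = p_t - ∫_0^t h(u_s) ds` for all `t ≥ 0`. -/
def SolvesPath (h p u : ℝ → ℝ) : Prop :=
  ∀ t, 0 ≤ t → u t = p t - ∫ s in (0 : ℝ)..t, h (u s)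

/-- A rate of control: nondecreasing, with values in `[0, α]`. -/
structure IsRate (α : ℝ) (h : ℝ → ℝ) : Prop where
  mono : Monotone h
  nonneg : ∀ y, 0 ≤ h y
  le : ∀ y, h y ≤ α

variable {α : ℝ} {h p u : ℝ → ℝ}

lemma IsRate.abs_le (hh : IsRate α h) (y : ℝ) : |h y| ≤ α := by
  rw [abs_of_nonneg (hh.nonneg y)]
  exact hh.le y

lemma IsRate.alpha_nonneg (hh : IsRate α h) : 0 ≤ α := (hh.nonneg 0).trans (hh.le 0)

/-- Solutions are measurable although the equation alone does not presuppose that the rate along them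
is integrable: up to the last time at which it is, the integral is monotone in time, and after that
time it is `0` by convention, so that `u = p` there. -/
lemma SolvesPath.aemeasurable (hu : SolvesPath h p u) (hh : IsRate α h) (hp : Measurable p) :
    AEMeasurable u (volume.restrict (Ici 0)) := by
  set I : ℝ → ℝ := fun t => ∫ s in (0 : ℝ)..t, h (u s) with hI
  set S : Set ℝ := {t | 0 ≤ t ∧ IntervalIntegrable (fun s => h (u s)) volume 0 t} with hS
  have hSc : S.OrdConnected := ⟨fun a ha b hb t ht =>
    ⟨ha.1.trans ht.1, hb.2.mono_set (by
      rw [uIcc_of_le (ha.1.trans ht.1), uIcc_of_le hb.1]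
      exact Icc_subset_Icc le_rfl ht.2)⟩⟩
  have hSm : MeasurableSet S := hSc.measurableSet
  have hmono : MonotoneOn I S := fun a ha b hb hab =>
    intervalIntegral.integral_mono_interval le_rfl ha.1 hab
      (Eventually.of_forall fun s => hh.nonneg _) hb.2
  have hIm : AEMeasurable I (volume.restrict (Ici 0)) := by
    have hU : Ici (0 : ℝ) = S ∪ (Ici 0 \ S) := (union_sdiff_cancel fun t ht => ht.1).symm
    rw [hU, aemeasurable_union_iff]
    refine ⟨aemeasurable_restrict_of_monotoneOn hSm hmono, ?_⟩
    refine aemeasurable_const (b := (0 : ℝ)) |>.congr ?_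
    filter_upwards [ae_restrict_mem (measurableSet_Ici.diff hSm)] with t ht
    exact (intervalIntegral.integral_undef fun hi => ht.2 ⟨ht.1, hi⟩).symm
  refine (hp.aemeasurable.sub hIm).congr ?_
  filter_upwards [ae_restrict_mem measurableSet_Ici] with t ht
  exact (hu t ht).symm

lemma SolvesPath.intervalIntegrable (hu : SolvesPath h p u) (hh : IsRate α h)
    (hp : Measurable p) {a b : ℝ} (ha : 0 ≤ a) (hb : 0 ≤ b) :
    IntervalIntegrable (fun s => h (u s)) volume a b := by
  have hm : AEMeasurable (fun s => h (u s)) (volume.restrict (Ici 0)) :=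
    hh.mono.measurable.comp_aemeasurable (hu.aemeasurable hh hp)
  rw [intervalIntegrable_iff]
  have : IsFiniteMeasure (volume.restrict (uIoc a b)) := ⟨by simp [uIoc]⟩
  refine Integrable.of_bound (C := α) ?_ (Eventually.of_forall fun s => hh.abs_le _)
  refine (hm.mono_measure (Measure.restrict_mono ?_ le_rfl)).aestronglyMeasurable
  intro s hs
  rw [uIoc, mem_Ioc] at hs
  exact (le_min ha hb).trans hs.1.le

lemma SolvesPath.integral_mem (hu : SolvesPath h p u) (hh : IsRate α h)
    (hp : Measurable p) {t : ℝ} (ht : 0 ≤ t) :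
    (∫ s in (0 : ℝ)..t, h (u s)) ∈ Icc 0 (α * t) := by
  refine ⟨intervalIntegral.integral_nonneg ht fun s _ => hh.nonneg _, ?_⟩
  have := intervalIntegral.integral_mono_on ht (hu.intervalIntegrable hh hp le_rfl ht)
    (intervalIntegrable_const (c := α)) fun s _ => hh.le _
  refine this.trans (le_of_eq ?_)
  simp [mul_comm]

lemma SolvesPath.abs_sub_le (hu : SolvesPath h p u) (hh : IsRate α h)
    (hp : Measurable p) {t : ℝ} (ht : 0 ≤ t) : |u t - p t| ≤ α * t := by
  have := hu.integral_mem hh hp ht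
  rw [hu t ht, sub_sub_cancel_left, abs_neg, abs_of_nonneg this.1]
  exact this.2

lemma SolvesPath.sub_eq (hu : SolvesPath h p u) (hh : IsRate α h) (hp : Measurable p)
    {s t : ℝ} (hs : 0 ≤ s) (ht : 0 ≤ t) :
    u (s + t) - u s = p (s + t) - p s - ∫ v in (0 : ℝ)..t, h (u (s + v)) := by
  rw [hu _ (add_nonneg hs ht), hu s hs, intervalIntegral.integral_comp_add_left (fun v => h (u v)),
    add_zero, ← intervalIntegral.integral_add_adjacent_intervals
      (hu.intervalIntegrable hh hp le_rfl hs)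
      (hu.intervalIntegrable hh hp hs (add_nonneg hs ht))]
  ring

/-- One-sided comparison: an absolutely continuous function which can grow only at rate `k` while
it exceeds the level `c` stays below `c + ∫ k`. -/
lemma le_add_integral_of_rate {D g k : ℝ → ℝ} {c d T : ℝ} (hT : 0 ≤ T)
    (hg : IntervalIntegrable g volume 0 T) (hk : IntervalIntegrable k volume 0 T)
    (hk0 : ∀ t, 0 ≤ k t) (hD : ∀ t ∈ Icc 0 T, D t = d - ∫ s in (0 : ℝ)..t, g s)
    (hd : d ≤ c) (hstep : ∀ t ∈ Ioc 0 T, c < D t → -k t ≤ g t) :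
    D T ≤ c + ∫ s in (0 : ℝ)..T, k s := by
  have hcont : ContinuousOn D (Icc 0 T) := by
    have h1 : ContinuousOn (fun t => ∫ s in (0 : ℝ)..t, g s) (Icc 0 T) := by
      have := intervalIntegral.continuousOn_primitive_interval (μ := volume)
        (f := g) (a := 0) (b := T) (by rwa [← intervalIntegrable_iff'])
      rwa [uIcc_of_le hT] at this
    exact (continuousOn_const.sub h1).congr hD
  set A : Set ℝ := {t ∈ Icc 0 T | D t ≤ c} with hA
  have hAc : IsCompact A := by
    have : A = Icc 0 T ∩ D ⁻¹' Iic c := rfl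
    rw [this]
    exact isCompact_Icc.of_isClosed_subset (hcont.preimage_isClosed_of_isClosed isClosed_Icc
      isClosed_Iic) inter_subset_left
  have hA0 : A.Nonempty := ⟨0, ⟨le_rfl, hT⟩, by rw [hD 0 ⟨le_rfl, hT⟩]; simpa using hd⟩
  -- from the last time `τ` at which `D` is at most `c` on, the rate of growth is at most `k`
  obtain ⟨⟨hτ0, hτT⟩, hτ⟩ := hAc.sSup_mem hA0
  set τ := sSup A
  have hgt : ∀ t ∈ Ioc τ T, c < D t := fun t ht => by
    by_contra hle
    exact absurd (le_csSup hAc.bddAbove ⟨⟨hτ0.trans ht.1.le, ht.2⟩, not_lt.1 hle⟩)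
      (not_le.2 ht.1)
  have hsub1 : uIcc 0 τ ⊆ uIcc 0 T := by
    rw [uIcc_of_le hτ0, uIcc_of_le hT]; exact Icc_subset_Icc le_rfl hτT
  have hsub2 : uIcc τ T ⊆ uIcc 0 T := by
    rw [uIcc_of_le hτT, uIcc_of_le hT]; exact Icc_subset_Icc hτ0 le_rfl
  have e1 : D T = D τ - ∫ s in τ..T, g s := by
    rw [hD T ⟨hT, le_rfl⟩, hD τ ⟨hτ0, hτT⟩, ← intervalIntegral.integral_add_adjacent_intervals
      (hg.mono_set hsub1) (hg.mono_set hsub2)]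
    ring
  have e2 : -∫ s in τ..T, k s ≤ ∫ s in τ..T, g s := by
    rw [← intervalIntegral.integral_neg]
    refine intervalIntegral.integral_mono_on_of_le_Ioo hτT (hk.mono_set hsub2).neg
      (hg.mono_set hsub2) fun t ht => ?_
    exact hstep t ⟨hτ0.trans_lt ht.1, ht.2.le⟩ (hgt t ⟨ht.1, ht.2.le⟩)
  have e3 : ∫ s in τ..T, k s ≤ ∫ s in (0 : ℝ)..T, k s := by
    rw [← intervalIntegral.integral_add_adjacent_intervals
      (hk.mono_set hsub1) (hk.mono_set hsub2)]
    have := intervalIntegral.integral_nonneg (μ := volume) hτ0 fun s _ => hk0 s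
    linarith
  linarith

lemma abs_le_add_integral_of_rate {D g k : ℝ → ℝ} {c d T : ℝ} (hT : 0 ≤ T)
    (hg : IntervalIntegrable g volume 0 T) (hk : IntervalIntegrable k volume 0 T)
    (hk0 : ∀ t, 0 ≤ k t) (hD : ∀ t ∈ Icc 0 T, D t = d - ∫ s in (0 : ℝ)..t, g s)
    (hd : |d| ≤ c) (hup : ∀ t ∈ Ioc 0 T, c < D t → -k t ≤ g t)
    (hdown : ∀ t ∈ Ioc 0 T, D t < -c → g t ≤ k t) :
    |D T| ≤ c + ∫ s in (0 : ℝ)..T, k s := by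
  rw [abs_le] at hd ⊢
  have h1 := le_add_integral_of_rate hT hg hk hk0 hD hd.2 hup
  have h2 := le_add_integral_of_rate (D := fun t => -D t) (g := fun t => -g t) (d := -d) (c := c)
    hT hg.neg hk hk0 (fun t ht => by rw [hD t ht, intervalIntegral.integral_neg]; ring)
    (by linarith) (fun t ht hlt => neg_le_neg (hdown t ht (by linarith)))
  constructor <;> linarith

variable {p' u' : ℝ → ℝ} {c : ℝ}

/-- The flow property: the difference of two solutions with the same driving path and ordered
starting points stays nonnegative. -/
lemma SolvesPath.le_of_le (hu : SolvesPath h p u) (hu' : SolvesPath h (fun t => p t + c) u')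
    (hh : IsRate α h) (hp : Measurable p) (hc : 0 ≤ c) {t : ℝ} (ht : 0 ≤ t) : u t ≤ u' t := by
  have hp' : Measurable fun t => p t + c := hp.add_const c
  have h1 : ∀ s, 0 ≤ s → IntervalIntegrable (fun v => h (u v)) volume 0 s := fun s hs =>
    hu.intervalIntegrable hh hp le_rfl hs
  have h2 : ∀ s, 0 ≤ s → IntervalIntegrable (fun v => h (u' v)) volume 0 s := fun s hs =>
    hu'.intervalIntegrable hh hp' le_rfl hs
  have := le_add_integral_of_rate (D := fun t => u t - u' t) (g := fun v => h (u v) - h (u' v))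
    (k := fun _ => 0) (c := 0) (d := -c) ht ((h1 t ht).sub (h2 t ht)) intervalIntegrable_const
    (fun _ => le_rfl) (fun s hs => by
      rw [hu s hs.1, hu' s hs.1, intervalIntegral.integral_sub (h1 s hs.1) (h2 s hs.1)]
      ring) (by linarith) (fun s _ hlt => by
      have : h (u' s) ≤ h (u s) := hh.mono (by linarith)
      linarith)
  simp at this
  linarith

lemma SolvesPath.sub_eq_sub_integral (hu : SolvesPath h p u)
    (hu' : SolvesPath h (fun t => p t + c) u') (hh : IsRate α h) (hp : Measurable p)
    {t : ℝ} (ht : 0 ≤ t) : u' t - u t = c - ∫ s in (0 : ℝ)..t, (h (u' s) - h (u s)) := by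
  rw [intervalIntegral.integral_sub (hu'.intervalIntegrable hh (hp.add_const c) le_rfl ht)
    (hu.intervalIntegrable hh hp le_rfl ht), hu t ht, hu' t ht]
  ring

lemma SolvesPath.le_add (hu : SolvesPath h p u) (hu' : SolvesPath h (fun t => p t + c) u')
    (hh : IsRate α h) (hp : Measurable p) (hc : 0 ≤ c) {t : ℝ} (ht : 0 ≤ t) :
    u' t ≤ u t + c := by
  have h1 := hu.sub_eq_sub_integral hu' hh hp ht
  have h2 : 0 ≤ ∫ s in (0 : ℝ)..t, (h (u' s) - h (u s)) :=
    intervalIntegral.integral_nonneg ht fun s hs =>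
      sub_nonneg.2 (hh.mono (hu.le_of_le hu' hh hp hc hs.1))
  linarith

lemma SolvesPath.unique (hu : SolvesPath h p u) (hu' : SolvesPath h p u')
    (hh : IsRate α h) (hp : Measurable p) {t : ℝ} (ht : 0 ≤ t) : u t = u' t := by
  refine le_antisymm (hu.le_of_le (c := 0) ?_ hh hp le_rfl ht)
    (hu'.le_of_le (c := 0) ?_ hh hp le_rfl ht)
  · simpa using hu'
  · simpa using hu

lemma SolvesPath.rightContinuous (hu : SolvesPath h p u) (hh : IsRate α h)
    (hp : ∀ t, ContinuousWithinAt p (Ici t) t) {t : ℝ} (ht : 0 ≤ t) :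
    ContinuousWithinAt u (Ici t) t := by
  have hpm := measurable_of_rightContinuous hp
  have h1 : ContinuousWithinAt (fun t => ∫ s in (0 : ℝ)..t, h (u s)) (Ici t) t := by
    have := intervalIntegral.continuousOn_primitive_interval (μ := volume)
      (f := fun s => h (u s)) (a := 0) (b := t + 1)
      (by rw [← intervalIntegrable_iff']; exact hu.intervalIntegrable hh hpm le_rfl (by linarith))
    rw [uIcc_of_le (by linarith)] at this
    refine (this t ⟨ht, by linarith⟩).mono_of_mem_nhdsWithin ?_
    filter_upwards [self_mem_nhdsWithin, nhdsWithin_le_nhds (Iio_mem_nhds (lt_add_one t))]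
      with s hs hs'
    exact ⟨ht.trans hs, le_of_lt hs'⟩
  exact ((hp t).sub h1).congr (fun s hs => hu s (ht.trans hs)) (hu t ht)

end

section

/-! ### A discrete scheme for the refraction equation -/

/-- A splitting scheme for the equation `u_t = p_t - ∫_0^t h(u_s) ds` with time step `δ`, driven by
the increments `ξ` of the path: in each step the full increment of the path is added first, and the
rate of control is evaluated afterwards. Reading the path at the right end of each step makes the
scheme converge for every right-continuous path. -/
noncomputable def scheme (h : ℝ → ℝ) (δ b : ℝ) (ξ : ℕ → ℝ) : ℕ → ℝ
  | 0 => b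
  | k + 1 => scheme h δ b ξ k + ξ k - δ * h (scheme h δ b ξ k + ξ k)

lemma measurable_scheme {h : ℝ → ℝ} (hh : Measurable h) (δ b : ℝ) (n : ℕ) :
    Measurable fun ξ : ℕ → ℝ => scheme h δ b ξ n := by
  induction n with
  | zero => exact measurable_const
  | succ k ih =>
    have h1 : Measurable fun ξ : ℕ → ℝ => scheme h δ b ξ k + ξ k := ih.add (measurable_pi_apply k)
    exact h1.sub ((hh.comp h1).const_mul δ)

variable {α : ℝ} {h p u : ℝ → ℝ}

/-- The increments of `p` from time `s` on over steps of length `δ`. -/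
def increments (p : ℝ → ℝ) (s δ : ℝ) (k : ℕ) : ℝ := p (s + (k + 1) * δ) - p (s + k * δ)

/-- The rate of control of the scheme as a function of continuous time: the rate of the `k`-th step
on the interval `(k δ, (k + 1) δ]`. -/
noncomputable def schemeRate (h p : ℝ → ℝ) (s δ b : ℝ) (r : ℝ) : ℝ :=
  h (scheme h δ b (increments p s δ) (⌈r / δ⌉₊ - 1) + increments p s δ (⌈r / δ⌉₊ - 1))

lemma schemeRate_eq {s δ b r : ℝ} (hδ : 0 < δ) {k : ℕ} (hr : r ∈ Ioc (k * δ) ((k + 1) * δ)) :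
    schemeRate h p s δ b r
      = h (scheme h δ b (increments p s δ) k + increments p s δ k) := by
  have : ⌈r / δ⌉₊ = k + 1 := by
    rw [Nat.ceil_eq_iff (by omega)]
    push_cast
    rw [lt_div_iff₀ hδ, div_le_iff₀ hδ]
    exact hr
  rw [schemeRate, this, Nat.add_sub_cancel]

lemma intervalIntegrable_schemeRate (hh : IsRate α h) (s δ b x y : ℝ) :
    IntervalIntegrable (schemeRate h p s δ b) volume x y := by
  rw [intervalIntegrable_iff]
  have : IsFiniteMeasure (volume.restrict (uIoc x y)) := ⟨by simp [uIoc]⟩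
  refine Integrable.of_bound (C := α) ?_ (Eventually.of_forall fun s => hh.abs_le _)
  have : schemeRate h p s δ b = (fun m : ℕ => h (scheme h δ b (increments p s δ) (m - 1)
    + increments p s δ (m - 1))) ∘ fun r : ℝ => ⌈r / δ⌉₊ := rfl
  rw [this]
  exact ((measurable_from_top).comp
    (Nat.measurable_ceil.comp (measurable_id.div_const δ))).aestronglyMeasurable

lemma scheme_eq (hh : IsRate α h) {s δ b : ℝ} (hδ : 0 < δ) (k : ℕ) :
    scheme h δ b (increments p s δ) k
      = b + p (s + k * δ) - p s - ∫ r in (0 : ℝ)..k * δ, schemeRate h p s δ b r := by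
  induction k with
  | zero => simp [scheme]
  | succ k ih =>
    have e : ∫ r in (k * δ)..((k + 1 : ℕ) * δ), schemeRate h p s δ b r
        = δ * h (scheme h δ b (increments p s δ) k + increments p s δ k) := by
      have hle : k * δ ≤ (k + 1 : ℕ) * δ := by push_cast; nlinarith
      rw [intervalIntegral.integral_congr_ae (g := fun _ =>
        h (scheme h δ b (increments p s δ) k + increments p s δ k))]
      · rw [intervalIntegral.integral_const, smul_eq_mul]
        push_cast
        ring
      · refine Eventually.of_forall fun r hr => ?_
        rw [uIoc_of_le hle] at hr
        exact schemeRate_eq hδ (by push_cast at hr; exact hr)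
    rw [scheme, ← intervalIntegral.integral_add_adjacent_intervals
      (intervalIntegrable_schemeRate hh s δ b 0 (k * δ))
      (intervalIntegrable_schemeRate hh s δ b (k * δ) _), e]
    have e2 : increments p s δ k = p (s + (k + 1 : ℕ) * δ) - p (s + k * δ) := by
      simp [increments]
    rw [e2]
    linear_combination ih

/-- The distance between the scheme after the jump of a step and its continuous interpolation. -/
lemma scheme_interpolation_error (hh : IsRate α h) {s δ b r : ℝ} (hδ : 0 < δ) (hr : 0 < r) :
    ∃ z : ℝ, schemeRate h p s δ b r = h z ∧
      |z - (b + p (s + r) - p s - ∫ v in (0 : ℝ)..r, schemeRate h p s δ b v)|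
        ≤ |p (s + ⌈r / δ⌉₊ * δ) - p (s + r)| + α * δ := by
  obtain ⟨k, hk⟩ : ∃ k : ℕ, ⌈r / δ⌉₊ = k + 1 :=
    Nat.exists_eq_succ_of_ne_zero (Nat.ceil_pos.2 (by positivity)).ne'
  have hk' := hk
  rw [Nat.ceil_eq_iff (by omega)] at hk'
  push_cast at hk'
  rw [lt_div_iff₀ hδ, div_le_iff₀ hδ] at hk'
  refine ⟨_, schemeRate_eq hδ hk', ?_⟩
  have e2 : increments p s δ k = p (s + ⌈r / δ⌉₊ * δ) - p (s + k * δ) := by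
    simp [increments, hk]
  have e3 := intervalIntegral.integral_add_adjacent_intervals
    (intervalIntegrable_schemeRate (p := p) hh s δ b 0 (k * δ))
    (intervalIntegrable_schemeRate hh s δ b (k * δ) r)
  have e4 : ∫ v in (k * δ)..r, schemeRate h p s δ b v ∈ Icc 0 (α * δ) := by
    refine ⟨intervalIntegral.integral_nonneg hk'.1.le fun v _ => hh.nonneg _, ?_⟩
    have := intervalIntegral.integral_mono_on hk'.1.le
      (intervalIntegrable_schemeRate (p := p) hh s δ b (k * δ) r)
      (intervalIntegrable_const (c := α)) fun v _ => hh.le _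
    refine this.trans ?_
    rw [intervalIntegral.integral_const, smul_eq_mul, mul_comm]
    exact mul_le_mul_of_nonneg_left (by linarith) hh.alpha_nonneg
  rw [scheme_eq hh hδ k, e2, ← e3]
  refine (le_of_eq ?_).trans ((abs_add_le _ _).trans
    (add_le_add le_rfl ((abs_of_nonneg e4.1).trans_le e4.2)))
  congr 1
  ring

lemma tendsto_ceil_grid {t r : ℝ} (ht : 0 < t) (hr : 0 < r) :
    Tendsto (fun n : ℕ => (⌈r / (t / (n + 1 : ℕ))⌉₊ : ℝ) * (t / (n + 1 : ℕ))) atTop (𝓝[≥] r) := by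
  have hδ : ∀ n : ℕ, 0 < t / (n + 1 : ℕ) := fun n => by positivity
  have hb : ∀ n : ℕ, r ≤ (⌈r / (t / (n + 1 : ℕ))⌉₊ : ℝ) * (t / (n + 1 : ℕ)) ∧
      (⌈r / (t / (n + 1 : ℕ))⌉₊ : ℝ) * (t / (n + 1 : ℕ)) ≤ r + t * (1 / ((n : ℝ) + 1)) := fun n => by
    have h1 := Nat.le_ceil (r / (t / (n + 1 : ℕ)))
    have h2 := (Nat.ceil_lt_add_one (div_pos hr (hδ n)).le).le
    constructor
    · rwa [div_le_iff₀ (hδ n)] at h1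
    · have h3 := mul_le_mul_of_nonneg_right h2 (hδ n).le
      refine h3.trans (le_of_eq ?_)
      push_cast
      field_simp
  refine tendsto_nhdsWithin_iff.2 ⟨?_, Eventually.of_forall fun n => (hb n).1⟩
  refine tendsto_of_tendsto_of_tendsto_of_le_of_le tendsto_const_nhds ?_
    (fun n => (hb n).1) (fun n => (hb n).2)
  simpa only [add_zero, mul_zero] using (tendsto_const_nhds (x := r)).add
    ((tendsto_one_div_add_atTop_nhds_zero_nat (𝕜 := ℝ)).const_mul t)

/-- Asymptotically, the scheme started at `b` at time `s` stays as close to the solution as it is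
at time `s`. -/
lemma SolvesPath.eventually_abs_sub_scheme_le (hu : SolvesPath h p u) (hh : IsRate α h)
    (hp : ∀ t, ContinuousWithinAt p (Ici t) t) {s t : ℝ} (hs : 0 ≤ s) (ht : 0 < t) (b : ℝ)
    {η : ℝ} (hη : 0 < η) :
    ∀ᶠ n : ℕ in atTop, |u (s + t)
      - scheme h (t / (n + 1 : ℕ)) b (increments p s (t / (n + 1 : ℕ))) (n + 1)|
        ≤ |u s - b| + η := by
  have hpm := measurable_of_rightContinuous hp
  set δ : ℕ → ℝ := fun n => t / (n + 1 : ℕ) with hδdef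
  have hδ : ∀ n : ℕ, 0 < δ n := fun n => by simp only [hδdef]; positivity
  have hδ0 : Tendsto δ atTop (𝓝 0) := by
    have := (tendsto_one_div_add_atTop_nhds_zero_nat (𝕜 := ℝ)).const_mul t
    simp only [mul_zero] at this
    refine this.congr fun n => ?_
    simp only [hδdef]
    push_cast
    ring
  set e : ℕ → ℝ → ℝ := fun n r => |p (s + ⌈r / δ n⌉₊ * δ n) - p (s + r)| + α * δ n with he
  have hem : ∀ n, Measurable (e n) := fun n => by
    have h1 : Measurable fun r : ℝ => p (s + ⌈r / δ n⌉₊ * δ n) :=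
      (measurable_from_top (f := fun m : ℕ => p (s + m * δ n))).comp
        (Nat.measurable_ceil.comp (measurable_id.div_const _))
    have h2 : Measurable fun r : ℝ => p (s + r) := hpm.comp (measurable_const_add s)
    exact ((h1.sub h2).abs).add_const _
  -- `e` bounds the interpolation error; while it is at most `η / 2`, monotonicity of `h` prevents
  -- the distance from growing above `|u s - b| + η / 2`, and the growth rate is at most `α` otherwise
  set k : ℕ → ℝ → ℝ := fun n r => if e n r ≤ η / 2 then 0 else α with hk
  have hk0 : ∀ n r, 0 ≤ k n r := fun n r => by
    simp only [hk]; split_ifs; exacts [le_rfl, hh.alpha_nonneg]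
  have hkα : ∀ n r, k n r ≤ α := fun n r => by
    simp only [hk]; split_ifs; exacts [hh.alpha_nonneg, le_rfl]
  have hkm : ∀ n, Measurable (k n) := fun n =>
    Measurable.ite (measurableSet_le (hem n) measurable_const) measurable_const measurable_const
  have hki : ∀ n, IntervalIntegrable (k n) volume 0 t := fun n => by
    rw [intervalIntegrable_iff]
    have : IsFiniteMeasure (volume.restrict (uIoc 0 t)) := ⟨by simp [uIoc]⟩
    exact Integrable.of_bound (C := α) (hkm n).aestronglyMeasurable
      (Eventually.of_forall fun r => by
        rw [Real.norm_eq_abs, abs_of_nonneg (hk0 n r)]; exact hkα n r)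
  have hklim : Tendsto (fun n => ∫ r in (0 : ℝ)..t, k n r) atTop (𝓝 0) := by
    have := intervalIntegral.tendsto_integral_filter_of_dominated_convergence (μ := volume)
      (F := k) (f := fun _ => 0) (l := atTop) (a := 0) (b := t) (fun _ => α)
      (Eventually.of_forall fun n => (hkm n).aestronglyMeasurable)
      (Eventually.of_forall fun n => Eventually.of_forall fun r _ => by
        rw [Real.norm_eq_abs, abs_of_nonneg (hk0 n r)]; exact hkα n r)
      intervalIntegrable_const (Eventually.of_forall fun r hr => ?_)
    · simpa using this
    rw [uIoc_of_le ht.le] at hr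
    have h1 : Tendsto (fun n => s + ⌈r / δ n⌉₊ * δ n) atTop (𝓝[≥] (s + r)) := by
      have h0 := tendsto_nhdsWithin_iff.1 (tendsto_ceil_grid ht hr.1)
      refine tendsto_nhdsWithin_iff.2 ⟨h0.1.const_add s, ?_⟩
      filter_upwards [h0.2] with n hn
      exact add_le_add (le_refl s) (mem_Ici.1 hn)
    have h2 : Tendsto (fun n => e n r) atTop (𝓝 0) := by
      have := (((hp (s + r)).tendsto.comp h1).sub_const (p (s + r))).abs.add (hδ0.const_mul α)
      simpa using this
    refine (tendsto_congr' ?_).2 tendsto_const_nhds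
    filter_upwards [h2.eventually_lt_const (half_pos hη)] with n hn
    simp only [hk, if_pos hn.le]
  filter_upwards [hklim.eventually_lt_const (half_pos hη)] with n hn
  set W : ℝ → ℝ := fun r => ∫ v in (0 : ℝ)..r, schemeRate h p s (δ n) b v with hW
  have hn1 : ((n + 1 : ℕ) : ℝ) * δ n = t := by
    simp only [hδdef]; field_simp
  have hsch := scheme_eq (p := p) (s := s) (b := b) hh (hδ n) (n + 1)
  rw [hn1] at hsch
  have hgi : ∀ r, 0 ≤ r → IntervalIntegrable (fun v => h (u (s + v))) volume 0 r := fun r hr => by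
    have h0 := hu.intervalIntegrable hh hpm hs (add_nonneg hs hr)
    have := h0.comp_add_left s
    simpa using this
  have hbound := abs_le_add_integral_of_rate (T := t) (c := |u s - b| + η / 2) (d := u s - b)
    (D := fun r => u (s + r) - (b + p (s + r) - p s - W r))
    (g := fun v => h (u (s + v)) - schemeRate h p s (δ n) b v) (k := k n) ht.le
    ((hgi t ht.le).sub (intervalIntegrable_schemeRate hh s (δ n) b 0 t)) (hki n) (hk0 n)
    (fun r hr => by
      rw [intervalIntegral.integral_sub (hgi r hr.1)
        (intervalIntegrable_schemeRate hh s (δ n) b 0 r)]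
      have := hu.sub_eq hh hpm hs hr.1
      simp only [hW]
      linarith) (by linarith) (fun r hr hlt => ?_) (fun r hr hlt => ?_)
  · rw [hsch]
    linarith
  · obtain ⟨z, hz, hze⟩ := scheme_interpolation_error (p := p) (s := s) (b := b) hh (hδ n) hr.1
    rw [hz]
    by_cases hle : e n r ≤ η / 2
    · have h1 := (abs_le.1 (hze.trans hle)).2
      have h2 : h z ≤ h (u (s + r)) := hh.mono (by
        have := abs_nonneg (u s - b)
        simp only [hW] at hlt
        linarith)
      simp only [hk, if_pos hle]
      linarith
    · simp only [hk, if_neg hle]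
      have := hh.nonneg (u (s + r))
      have := hh.le z
      linarith
  · obtain ⟨z, hz, hze⟩ := scheme_interpolation_error (p := p) (s := s) (b := b) hh (hδ n) hr.1
    rw [hz]
    by_cases hle : e n r ≤ η / 2
    · have h1 := (abs_le.1 (hze.trans hle)).1
      have h2 : h (u (s + r)) ≤ h z := hh.mono (by
        have := abs_nonneg (u s - b)
        simp only [hW] at hlt
        linarith)
      simp only [hk, if_pos hle]
      linarith
    · simp only [hk, if_neg hle]
      have := hh.le (u (s + r))
      have := hh.nonneg z
      linarith

lemma abs_scheme_sub_le (hh : IsRate α h) {s t b : ℝ} (ht : 0 < t) (n : ℕ) :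
    |scheme h (t / (n + 1 : ℕ)) b (increments p s (t / (n + 1 : ℕ))) (n + 1)
      - (b + p (s + t) - p s)| ≤ α * t := by
  have hδ : 0 < t / (n + 1 : ℕ) := by positivity
  have hn1 : ((n + 1 : ℕ) : ℝ) * (t / (n + 1 : ℕ)) = t := by field_simp
  have hsch := scheme_eq (p := p) (s := s) (b := b) hh hδ (n + 1)
  rw [hn1] at hsch
  rw [hsch, sub_sub_cancel_left, abs_neg]
  have := intervalIntegral.norm_integral_le_of_norm_le_const (a := 0) (b := t)
    (f := schemeRate h p s (t / (n + 1 : ℕ)) b) (C := α) fun r _ => hh.abs_le _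
  rwa [Real.norm_eq_abs, sub_zero, abs_of_pos ht] at this

end

section

/-! ### The increments of a Lévy process after a fixed time -/

variable {Ω : Type*} [MeasurableSpace Ω] {P : Measure Ω} {X : ℝ≥0 → Ω → ℝ}

/-- The increments of the process from time `s` on over steps of length `δ`. -/
def futureIncrements (X : ℝ≥0 → Ω → ℝ) (s δ : ℝ≥0) (ω : Ω) (k : ℕ) : ℝ :=
  X (s + (k + 1) * δ) ω - X (s + k * δ) ω

lemma measurable_futureIncrements (hX : ∀ t, Measurable (X t)) (s δ : ℝ≥0) :
    Measurable (futureIncrements X s δ) :=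
  measurable_pi_lambda _ fun _ => (hX _).sub (hX _)

lemma IsLevyProcess.identDistrib_futureIncrements [IsProbabilityMeasure P]
    (hX : IsLevyProcess P X) (s δ : ℝ≥0) :
    IdentDistrib (futureIncrements X s δ) (futureIncrements X 0 δ) P P := by
  have hmono : ∀ a : ℝ≥0, Monotone fun k : ℕ => a + k * δ := fun a i j hij => by
    have : (i : ℝ≥0) ≤ j := by exact_mod_cast hij
    exact add_le_add le_rfl (mul_le_mul_left this δ)
  have hind : ∀ a : ℝ≥0, iIndepFun (fun k ω => futureIncrements X a δ ω k) P := fun a => by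
    have := hX.indep.nat (hmono a)
    simpa only [futureIncrements, Nat.cast_add, Nat.cast_one] using this
  have hid : ∀ (a : ℝ≥0) (k : ℕ),
      IdentDistrib (fun ω => futureIncrements X a δ ω k) (X δ) P P := fun a k => by
    have := hX.stationary (a + k * δ) δ
    have e : a + k * δ + δ = a + (k + 1) * δ := by ring
    rwa [e] at this
  exact IdentDistrib.pi (fun k => (hid s k).trans (hid 0 k).symm) (hind s) (hind 0)

/-- The simple Markov property: the increments after time `s` are independent of the path
before `s`. -/
lemma IsLevyProcess.indepFun_futureIncrements [IsProbabilityMeasure P]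
    (hX : IsLevyProcess P X) (s δ : ℝ≥0) :
    IndepFun (fun ω (r : Iic s) => X r ω) (futureIncrements X s δ) P := by
  have h0 : IndepFun (fun ω (r : Iic s) => X r ω - X 0 ω) (futureIncrements X s δ) P := by
    refine IndepFun.process_indepFun_process (X := fun (r : Iic s) ω => X r ω - X 0 ω)
      (Y := fun k ω => futureIncrements X s δ ω k)
      (fun r => (hX.measurable _).sub (hX.measurable _))
      (fun k => (hX.measurable _).sub (hX.measurable _)) fun I J => ?_
    set A : Finset ℝ≥0 := insert 0 (I.image Subtype.val) with hA
    have hAs : ∀ a ∈ A, a ≤ s := fun a ha => by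
      rcases Finset.mem_insert.1 ha with rfl | h
      · exact zero_le
      · obtain ⟨r, _, rfl⟩ := Finset.mem_image.1 h
        exact r.2
    set n := A.card with hn
    set e := A.orderEmbOfFin hn.symm with he
    -- an increasing sequence which runs through `0` and the times in `I`, and then through the grid
    -- after `s`, so that the independence of increments along it applies
    set τ : ℕ → ℝ≥0 := fun k => if h : k < n then e ⟨k, h⟩ else s + (k - n : ℕ) * δ with hτ
    have hτ1 : ∀ k (h : k < n), τ k = e ⟨k, h⟩ := fun k h => dif_pos h
    have hτ2 : ∀ k, n ≤ k → τ k = s + (k - n : ℕ) * δ := fun k h => dif_neg (not_lt.2 h)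
    have hmono : Monotone τ := by
      intro i j hij
      by_cases hj : j < n
      · rw [hτ1 j hj, hτ1 i (hij.trans_lt hj)]
        exact e.monotone hij
      · rw [hτ2 j (not_lt.1 hj)]
        by_cases hi : i < n
        · rw [hτ1 i hi]
          exact (hAs _ (A.orderEmbOfFin_mem hn.symm _)).trans le_self_add
        · rw [hτ2 i (not_lt.1 hi)]
          have : ((i - n : ℕ) : ℝ≥0) ≤ (j - n : ℕ) := by
            exact_mod_cast Nat.sub_le_sub_right hij n
          exact add_le_add le_rfl (mul_le_mul_left this δ)
    have hτ0 : τ 0 = 0 := by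
      have hpos : 0 < n := Finset.card_pos.2 ⟨0, Finset.mem_insert_self _ _⟩
      rw [hτ1 0 hpos, he, Finset.orderEmbOfFin_zero hn.symm hpos]
      exact le_antisymm (Finset.min'_le _ _ (Finset.mem_insert_self _ _)) zero_le
    have hsurj : ∀ r : I, ∃ k, k < n ∧ τ k = (r : Iic s) := fun r => by
      have hr : ((r : Iic s) : ℝ≥0) ∈ A :=
        Finset.mem_insert_of_mem (Finset.mem_image_of_mem _ r.2)
      have : ((r : Iic s) : ℝ≥0) ∈ Set.range e := by
        rw [he, Finset.range_orderEmbOfFin]; exact hr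
      obtain ⟨⟨k, hk⟩, hk'⟩ := this
      exact ⟨k, hk, by rw [hτ1 k hk, hk']⟩
    choose κ hκ hκτ using hsurj
    have hind := (hX.indep.nat hmono).indepFun_finset (Finset.range n)
      (J.map (addRightEmbedding n)) (by
        rw [Finset.disjoint_left]
        intro a ha hb
        simp only [Finset.mem_range, Finset.mem_map, addRightEmbedding_apply] at ha hb
        obtain ⟨b, _, rfl⟩ := hb
        omega) (fun k => (hX.measurable _).sub (hX.measurable _))
    have hsum : ∀ (k : ℕ) (ω : Ω), X (τ k) ω - X 0 ω
        = ∑ i ∈ Finset.range k, (X (τ (i + 1)) ω - X (τ i) ω) := fun k ω => by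
      rw [Finset.sum_range_sub (fun i => X (τ i) ω), hτ0]
    have hcomp := hind.comp
      (φ := fun (y : Finset.range n → ℝ) (r : I) => ∑ i : Fin (κ r),
        y ⟨i, Finset.mem_range.2 (i.2.trans (hκ r))⟩)
      (ψ := fun (y : (J.map (addRightEmbedding n) : Finset ℕ) → ℝ) (j : J) =>
        y ⟨(j : ℕ) + n, Finset.mem_map.2 ⟨j, j.2, rfl⟩⟩)
      (measurable_pi_lambda _ fun r => Finset.measurable_sum _ fun i _ => measurable_pi_apply _)
      (measurable_pi_lambda _ fun j => measurable_pi_apply _)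
    convert hcomp using 1
    · funext ω r
      simp only [Function.comp]
      rw [← hκτ r, hsum, Finset.sum_range]
    · funext ω j
      simp only [Function.comp, futureIncrements]
      rw [hτ2 _ (by omega), hτ2 _ (by omega)]
      congr 3
      · rw [show (j : ℕ) + n + 1 - n = j + 1 by omega]
        push_cast
        ring
      · rw [show (j : ℕ) + n - n = j by omega]
  refine h0.process_congr_left (X := fun (r : Iic s) ω => X r ω - X 0 ω)
    (X' := fun (r : Iic s) ω => X r ω) fun r => ?_
  filter_upwards [hX.zero] with ω hω
  simp [hω]

lemma past_le_comap {Ω : Type*} (X : ℝ≥0 → Ω → ℝ) (s : ℝ≥0) :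
    past X s ≤ MeasurableSpace.comap (fun ω (r : Iic s) => X r ω) inferInstance := by
  refine iSup₂_le fun r hr => ?_
  have : X r = (fun y : Iic s → ℝ => y ⟨r, hr⟩) ∘ fun ω (r : Iic s) => X r ω := rfl
  rw [this, ← MeasurableSpace.comap_comp]
  exact MeasurableSpace.comap_mono (measurable_pi_apply _).comap_le

lemma past_le (hX : ∀ t, Measurable (X t)) (s : ℝ≥0) : past X s ≤ ‹MeasurableSpace Ω› :=
  iSup₂_le fun r _ => (hX r).comap_le

/-- In particular, the increments after time `s` may be replaced by those after time `0`. -/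
lemma IsLevyProcess.integral_mul_futureIncrements [IsProbabilityMeasure P]
    (hX : IsLevyProcess P X) (s δ : ℝ≥0) {K : Ω → ℝ} (hK : AEStronglyMeasurable[past X s] K P)
    {F : (ℕ → ℝ) → ℝ} (hF : Measurable F) :
    ∫ ω, K ω * F (futureIncrements X s δ ω) ∂P
      = (∫ ω, K ω ∂P) * ∫ ω, F (futureIncrements X 0 δ ω) ∂P := by
  obtain ⟨K', hK'm, hKK'⟩ := hK
  have hpast := past_le hX.measurable s
  have hind : IndepFun K' (fun ω => F (futureIncrements X s δ ω)) P := by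
    have h1 := (hX.indepFun_futureIncrements s δ).comp measurable_id hF
    rw [IndepFun_iff_Indep] at h1 ⊢
    refine indep_of_indep_of_le_left h1 ?_
    exact (hK'm.measurable.comap_le).trans (past_le_comap X s)
  have h2 := (hX.identDistrib_futureIncrements s δ).comp hF
  have hFm : Measurable fun ω => F (futureIncrements X s δ ω) :=
    hF.comp (measurable_futureIncrements hX.measurable s δ)
  have h3 : ∫ ω, F (futureIncrements X s δ ω) ∂P = ∫ ω, F (futureIncrements X 0 δ ω) ∂P :=
    h2.integral_eq
  rw [← h3, integral_congr_ae hKK', ← hind.integral_fun_mul_eq_mul_integral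
    (hK'm.mono hpast).aestronglyMeasurable hFm.aestronglyMeasurable]
  refine integral_congr_ae ?_
  filter_upwards [hKK'] with ω hω
  rw [hω]

end

section

/-! ### The discounted occupation measure -/

/-- The measure `e^{-qt} dt` on `(0, ∞)`. -/
noncomputable def discountMeasure (q : ℝ) : Measure ℝ :=
  (volume.restrict (Ioi 0)).withDensity fun t => ENNReal.ofReal (Real.exp (-q * t))

instance (q : ℝ) : SFinite (discountMeasure q) := by
  unfold discountMeasure; infer_instance

lemma ae_discountMeasure_pos (q : ℝ) : ∀ᵐ t ∂discountMeasure q, 0 < t :=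
  (withDensity_absolutelyContinuous _ _).ae_le (ae_restrict_mem measurableSet_Ioi)

lemma integrable_discountMeasure_iff {q : ℝ} {g : ℝ → ℝ} :
    Integrable g (discountMeasure q)
      ↔ IntegrableOn (fun t => Real.exp (-q * t) * g t) (Ioi 0) := by
  rw [discountMeasure, integrable_withDensity_iff_integrable_smul' (by fun_prop)
    (Eventually.of_forall fun x => ENNReal.ofReal_lt_top), IntegrableOn]
  simp only [ENNReal.toReal_ofReal (Real.exp_pos _).le, smul_eq_mul]

lemma integral_discountMeasure (q : ℝ) (g : ℝ → ℝ) :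
    ∫ t, g t ∂discountMeasure q = ∫ t in Ioi (0 : ℝ), Real.exp (-q * t) * g t := by
  rw [discountMeasure, integral_withDensity_eq_integral_toReal_smul (by fun_prop)
    (Eventually.of_forall fun x => ENNReal.ofReal_lt_top)]
  simp only [ENNReal.toReal_ofReal (Real.exp_pos _).le, smul_eq_mul]

lemma integrable_discountMeasure_pow {q : ℝ} (hq : 0 < q) (n : ℕ) :
    Integrable (fun t : ℝ => (1 + t) ^ n) (discountMeasure q) := by
  rw [integrable_discountMeasure_iff]
  have h1 : IntegrableOn (fun t : ℝ => Real.exp (-(q / 2) * t)) (Ioi 0) :=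
    exp_neg_integrableOn_Ioi 0 (half_pos hq)
  refine (h1.const_mul (n.factorial / (q / 2) ^ n * Real.exp (q / 2))).mono' (by fun_prop) ?_
  filter_upwards [ae_restrict_mem measurableSet_Ioi] with t ht
  have ht' : (0 : ℝ) ≤ 1 + t := by have := mem_Ioi.1 ht; linarith
  have h2 := Real.pow_div_factorial_le_exp (q / 2 * (1 + t)) (by positivity) n
  rw [mul_pow] at h2
  have hf : (0 : ℝ) < n.factorial := by exact_mod_cast n.factorial_pos
  have h3 : (1 + t) ^ n ≤ n.factorial / (q / 2) ^ n * Real.exp (q / 2 * (1 + t)) := by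
    calc (1 + t) ^ n
        = n.factorial / (q / 2) ^ n * ((q / 2) ^ n * (1 + t) ^ n / n.factorial) := by field_simp
      _ ≤ _ := by gcongr
  rw [Real.norm_eq_abs, abs_of_nonneg (by positivity)]
  calc Real.exp (-q * t) * (1 + t) ^ n
      ≤ Real.exp (-q * t) * (n.factorial / (q / 2) ^ n * Real.exp (q / 2 * (1 + t))) := by gcongr
    _ = n.factorial / (q / 2) ^ n * (Real.exp (-q * t) * Real.exp (q / 2 * (1 + t))) := by ring
    _ = n.factorial / (q / 2) ^ n * (Real.exp (q / 2) * Real.exp (-(q / 2) * t)) := by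
        rw [← Real.exp_add, ← Real.exp_add]; ring_nf
    _ = _ := by ring

lemma isFiniteMeasure_discountMeasure {q : ℝ} (hq : 0 < q) :
    IsFiniteMeasure (discountMeasure q) := by
  have := integrable_discountMeasure_pow hq 0
  simp only [pow_zero] at this
  rw [integrable_const_iff] at this
  exact this.resolve_left one_ne_zero

variable {Ω : Type*} [MeasurableSpace Ω] {P : Measure Ω} {X : ℝ≥0 → Ω → ℝ}

lemma discountedIntegrable_iff [SFinite P] {q : ℝ} {Y : ℝ≥0 → Ω → ℝ} :
    DiscountedIntegrable P q Y
      ↔ Integrable (fun p : Ω × ℝ => Y p.2.toNNReal p.1) (P.prod (discountMeasure q)) := by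
  rw [discountMeasure, prod_withDensity_right (by fun_prop),
    integrable_withDensity_iff_integrable_smul' (by fun_prop)
    (Eventually.of_forall fun x => ENNReal.ofReal_lt_top), DiscountedIntegrable]
  simp only [ENNReal.toReal_ofReal (Real.exp_pos _).le, smul_eq_mul]

lemma discounted_eq_integral_prod [SFinite P] {q : ℝ} {Y : ℝ≥0 → Ω → ℝ}
    (h : Integrable (fun p : Ω × ℝ => Y p.2.toNNReal p.1) (P.prod (discountMeasure q))) :
    discounted P q Y = ∫ p, Y p.2.toNNReal p.1 ∂(P.prod (discountMeasure q)) := by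
  rw [integral_prod _ h]
  simp only [integral_discountMeasure, discounted]

/-! ### Joint measurability and integrability of the processes -/

/-- Only the variables `Y t` at fixed times are assumed to be measurable up to null sets, so the joint
measurability is obtained from countably many of them through the grid. -/
lemma aemeasurable_uncurry_of_rightContinuous [SFinite P] {Y : ℝ≥0 → Ω → ℝ}
    (hY : ∀ t, AEMeasurable (Y t) P) {μ : Measure ℝ} [SFinite μ]
    (hcont : ∀ᵐ p ∂(P.prod μ),
      ContinuousWithinAt (fun t : ℝ => Y t.toNNReal p.1) (Ici p.2) p.2) :
    AEMeasurable (fun p : Ω × ℝ => Y p.2.toNNReal p.1) (P.prod μ) := by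
  refine aemeasurable_of_tendsto_metrizable_ae (u := atTop)
    (f := fun n (p : Ω × ℝ) => Y (rightGrid n p.2).toNNReal p.1) (fun n => ?_) ?_
  · have hmk : AEMeasurable (fun p : Ω × ℝ => (hY (rightGrid n p.2).toNNReal).mk _ p.1)
        (P.prod μ) := by
      have hcomp : (fun p : Ω × ℝ => (hY (rightGrid n p.2).toNNReal).mk _ p.1)
        = (fun z : Ω × ℤ => (hY ((z.2 + 1 : ℝ) / (n + 1)).toNNReal).mk _ z.1) ∘
          fun p : Ω × ℝ => (p.1, ⌊(n + 1 : ℝ) * p.2⌋) := rfl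
      have h1 : Measurable fun z : Ω × ℤ => (hY ((z.2 + 1 : ℝ) / (n + 1)).toNNReal).mk _ z.1 :=
        measurable_from_prod_countable_left fun k =>
          (hY ((k + 1 : ℝ) / (n + 1)).toNNReal).measurable_mk
      have h2 : Measurable fun p : Ω × ℝ => (p.1, ⌊(n + 1 : ℝ) * p.2⌋) :=
        measurable_fst.prodMk (Int.measurable_floor.comp (measurable_snd.const_mul _))
      rw [hcomp]
      exact (h1.comp h2).aemeasurable
    refine hmk.congr ?_
    have hall : ∀ᵐ ω ∂P, ∀ k : ℤ, Y ((k + 1 : ℝ) / (n + 1)).toNNReal ω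
        = (hY ((k + 1 : ℝ) / (n + 1)).toNNReal).mk _ ω :=
      ae_all_iff.2 fun k => (hY _).ae_eq_mk
    have := Measure.quasiMeasurePreserving_fst (μ := P) (ν := μ) |>.ae hall
    filter_upwards [this] with p hp
    exact (hp _).symm
  · filter_upwards [hcont] with p hp
    exact hp.tendsto.comp (tendsto_rightGrid p.2)

lemma IsLevyProcess.rightContinuous (hX : IsLevyProcess P X) :
    ∀ᵐ ω ∂P, ∀ t : ℝ, ContinuousWithinAt (fun t : ℝ => X t.toNNReal ω) (Ici t) t := by
  filter_upwards [hX.cadlag] with ω hω t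
  exact ContinuousWithinAt.comp (t := Ici t.toNNReal) (hω t.toNNReal).1
    continuous_real_toNNReal.continuousWithinAt
    fun s hs => Real.toNNReal_le_toNNReal hs

lemma ae_prod_discountMeasure [SFinite P] {q : ℝ} {p : Ω → Prop} (h : ∀ᵐ ω ∂P, p ω) :
    ∀ᵐ z ∂(P.prod (discountMeasure q)), p z.1 ∧ 0 < z.2 := by
  have h1 := Measure.quasiMeasurePreserving_fst (μ := P) (ν := discountMeasure q) |>.ae h
  have h2 := Measure.quasiMeasurePreserving_snd (μ := P) (ν := discountMeasure q) |>.ae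
    (ae_discountMeasure_pos q)
  filter_upwards [h1, h2] with z hz1 hz2
  exact ⟨hz1, hz2⟩

lemma IsLevyProcess.aemeasurable_uncurry [SFinite P] (hX : IsLevyProcess P X) (μ : Measure ℝ)
    [SFinite μ] : AEMeasurable (fun p : Ω × ℝ => X p.2.toNNReal p.1) (P.prod μ) := by
  refine aemeasurable_uncurry_of_rightContinuous (fun t => (hX.measurable t).aemeasurable) ?_
  have := Measure.quasiMeasurePreserving_fst (μ := P) (ν := μ) |>.ae hX.rightContinuous
  filter_upwards [this] with p hp
  exact hp p.2

/-- All moments of the process exist and grow at most polynomially in time; stated for the even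
moments, which dominate the others. -/
def HasPolynomialMoments (P : Measure Ω) (X : ℝ≥0 → Ω → ℝ) : Prop :=
  ∀ n : ℕ, ∃ C : ℝ, ∀ t : ℝ≥0, Integrable (fun ω => |X t ω| ^ (2 * n)) P ∧
    ∫ ω, |X t ω| ^ (2 * n) ∂P ≤ C * (1 + t) ^ (2 * n)

lemma HasPolynomialMoments.memLp (hm : HasPolynomialMoments P X) [IsFiniteMeasure P]
    (hX : ∀ t, Measurable (X t)) (t : ℝ≥0) (n : ℕ) : MemLp (X t) n P := by
  obtain ⟨C, hC⟩ := hm (n + 1)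
  have h1 : MemLp (X t) ((2 * (n + 1) : ℕ) : ℝ≥0∞) P := by
    refine (integrable_norm_rpow_iff (hX t).aestronglyMeasurable (by simp)
      (ENNReal.natCast_ne_top _)).1 ?_
    simpa only [ENNReal.toReal_natCast, Real.rpow_natCast, Real.norm_eq_abs] using (hC t).1
  exact h1.mono_exponent (by exact_mod_cast (by omega : n ≤ 2 * (n + 1)))

lemma HasPolynomialMoments.integrable_pow [IsProbabilityMeasure P]
    (hm : HasPolynomialMoments P X) (hX : IsLevyProcess P X) {q : ℝ} (hq : 0 < q) (n : ℕ) :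
    Integrable (fun p : Ω × ℝ => (1 + p.2 + |X p.2.toNNReal p.1|) ^ n)
      (P.prod (discountMeasure q)) := by
  obtain ⟨C, hC⟩ := hm n
  have hXm := hX.aemeasurable_uncurry (discountMeasure q)
  have hpos : ∀ᵐ z ∂(P.prod (discountMeasure q)), 0 < z.2 := by
    filter_upwards [ae_prod_discountMeasure (P := P) (q := q) (p := fun _ => True) (by simp)]
      with z hz using hz.2
  have key : Integrable (fun p : Ω × ℝ => (1 + p.2) ^ (2 * n) + |X p.2.toNNReal p.1| ^ (2 * n))
      (P.prod (discountMeasure q)) := by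
    refine Integrable.add ?_ ?_
    · have := isFiniteMeasure_discountMeasure hq
      exact (integrable_discountMeasure_pow hq (2 * n)).comp_snd P
    · have hms : AEStronglyMeasurable (fun p : Ω × ℝ => |X p.2.toNNReal p.1| ^ (2 * n))
        (P.prod (discountMeasure q)) := (hXm.abs.pow_const _).aestronglyMeasurable
      refine (integrable_prod_iff' hms).2
        ⟨Eventually.of_forall fun t => (hC t.toNNReal).1, ?_⟩
      have hB := (integrable_discountMeasure_pow hq (2 * n)).const_mul C
      refine hB.mono' hms.norm.prod_swap.integral_prod_right' ?_
      filter_upwards [ae_discountMeasure_pos q] with t ht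
      have h1 := (hC t.toNNReal).2
      rw [Real.coe_toNNReal t ht.le] at h1
      rw [Real.norm_eq_abs, abs_of_nonneg (integral_nonneg fun ω => norm_nonneg _)]
      refine le_trans (le_of_eq ?_) h1
      refine integral_congr_ae (Eventually.of_forall fun ω => ?_)
      simp only [Real.norm_eq_abs, abs_pow, abs_abs]
  refine (key.const_mul (2 ^ (2 * n - 1))).mono' ?_ ?_
  · exact (((measurable_snd.const_add 1).aemeasurable.add hXm.abs).pow_const n).aestronglyMeasurable
  · filter_upwards [hpos] with z hz
    have h1 : (1 : ℝ) ≤ 1 + z.2 + |X z.2.toNNReal z.1| := by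
      have := abs_nonneg (X z.2.toNNReal z.1)
      linarith
    rw [Real.norm_eq_abs, abs_of_nonneg (by positivity)]
    calc (1 + z.2 + |X z.2.toNNReal z.1|) ^ n
        ≤ (1 + z.2 + |X z.2.toNNReal z.1|) ^ (2 * n) := pow_le_pow_right₀ h1 (by omega)
      _ ≤ _ := add_pow_le (by linarith) (abs_nonneg _) _

end

section

variable {Ω : Type*} [MeasurableSpace Ω] {P : Measure Ω} {X : ℝ≥0 → Ω → ℝ}

/-! ### Integrability of functions of polynomial growth -/

/-- `G` grows at most polynomially. -/
def HasPolynomialGrowth (G : ℝ → ℝ) : Prop :=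
  ∃ (C : ℝ) (N : ℕ), 0 ≤ C ∧ ∀ y, |G y| ≤ C * (1 + |y|) ^ N

/-- A form of polynomial growth suited to arguments that are bounded by a multiple of `B`. -/
lemma HasPolynomialGrowth.exists_bound {G : ℝ → ℝ} (hG : HasPolynomialGrowth G) {c : ℝ}
    (hc : 0 ≤ c) : ∃ (C : ℝ) (N : ℕ), 0 ≤ C ∧ ∀ y B, 1 ≤ B → |y| ≤ c * B → |G y| ≤ C * B ^ N := by
  obtain ⟨C, N, hC, h⟩ := hG
  refine ⟨C * (1 + c) ^ N, N, by positivity, fun y B hB hy => (h y).trans ?_⟩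
  rw [mul_assoc, ← mul_pow]
  gcongr
  linarith

lemma HasPolynomialGrowth.comp_add_const {G : ℝ → ℝ} (hG : HasPolynomialGrowth G) (c : ℝ) :
    HasPolynomialGrowth fun y => G (y + c) := by
  obtain ⟨C, N, hC, h⟩ := hG.exists_bound (c := 1 + |c|) (by positivity)
  refine ⟨C, N, hC, fun y => h _ _ (by simp) ?_⟩
  have := abs_add_le y c
  nlinarith [abs_nonneg y, abs_nonneg c]

lemma HasPolynomialGrowth.neg {G : ℝ → ℝ} (hG : HasPolynomialGrowth G) :
    HasPolynomialGrowth fun y => -G y := by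
  obtain ⟨C, N, hC, h⟩ := hG
  exact ⟨C, N, hC, fun y => by simpa using h y⟩

lemma integrable_prod_of_le [IsProbabilityMeasure P] (hX : IsLevyProcess P X)
    (hm : HasPolynomialMoments P X) {q : ℝ} (hq : 0 < q) {F : Ω × ℝ → ℝ}
    (hF : AEStronglyMeasurable F (P.prod (discountMeasure q))) (C : ℝ) (N : ℕ)
    (hle : ∀ᵐ z ∂(P.prod (discountMeasure q)),
      |F z| ≤ C * (1 + z.2 + |X z.2.toNNReal z.1|) ^ N) :
    Integrable F (P.prod (discountMeasure q)) :=
  ((hm.integrable_pow hX hq N).const_mul C).mono' hF hle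

lemma integrable_prod_comp [IsProbabilityMeasure P] (hX : IsLevyProcess P X)
    (hm : HasPolynomialMoments P X) {q : ℝ} (hq : 0 < q) {G : ℝ → ℝ} (hG : Continuous G)
    (hGp : HasPolynomialGrowth G) {Y : Ω × ℝ → ℝ}
    (hY : AEMeasurable Y (P.prod (discountMeasure q))) {c : ℝ} (hc : 0 ≤ c)
    (hle : ∀ᵐ z ∂(P.prod (discountMeasure q)), |Y z| ≤ c * (1 + z.2 + |X z.2.toNNReal z.1|)) :
    Integrable (fun z => G (Y z)) (P.prod (discountMeasure q)) := by
  obtain ⟨C, N, hC, h⟩ := hGp.exists_bound hc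
  refine integrable_prod_of_le hX hm hq
    (hG.measurable.comp_aemeasurable hY).aestronglyMeasurable C N ?_
  filter_upwards [hle, ae_prod_discountMeasure (P := P) (q := q) (p := fun _ => True) (by simp)]
    with z hz hz2
  exact h _ _ (by have := abs_nonneg (X z.2.toNNReal z.1); linarith [hz2.2]) hz

lemma integrable_of_le_pow [IsProbabilityMeasure P] (hX : IsLevyProcess P X)
    (hm : HasPolynomialMoments P X) {F : Ω → ℝ} (hF : AEStronglyMeasurable F P) (C c : ℝ) (N : ℕ)
    (s t : ℝ≥0) (hle : ∀ᵐ ω ∂P, |F ω| ≤ C * (c + |X s ω| + |X t ω|) ^ N) : Integrable F P := by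
  have h1 : MemLp (fun ω => c + |X s ω| + |X t ω|) N P :=
    ((memLp_const c).add (hm.memLp hX.measurable s N).abs).add (hm.memLp hX.measurable t N).abs
  refine (h1.integrable_norm_pow'.const_mul |C|).mono' hF ?_
  filter_upwards [hle] with ω hω
  refine hω.trans ((le_abs_self _).trans (le_of_eq ?_))
  rw [abs_mul, abs_pow, Real.norm_eq_abs]

/-! ### Strong solutions -/

variable {α x : ℝ} {h : ℝ → ℝ} {V : ℝ≥0 → Ω → ℝ}

lemma IsStrongSolution.solvesPath (hX : IsLevyProcess P X) (hV : IsStrongSolution P X h x V) :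
    ∀ᵐ ω ∂P, (∀ t : ℝ, ContinuousWithinAt (fun t : ℝ => X t.toNNReal ω + x) (Ici t) t) ∧
      X 0 ω = 0 ∧
      SolvesPath h (fun t => X t.toNNReal ω + x) (fun t => V t.toNNReal ω) := by
  filter_upwards [hX.rightContinuous, hX.zero, hV.equation] with ω h1 h2 h3
  refine ⟨fun t => (h1 t).add_const x, h2, fun t ht => ?_⟩
  have := h3 t.toNNReal
  rw [Real.coe_toNNReal t ht] at this
  exact this.trans (by ring)

/-- Domination by the driving process, uniformly in time. -/
lemma IsStrongSolution.abs_le (hX : IsLevyProcess P X) (hh : IsRate α h)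
    (hV : IsStrongSolution P X h x V) :
    ∀ᵐ ω ∂P, ∀ t : ℝ≥0, |V t ω| ≤ (1 + α + |x|) * (1 + t + |X t ω|) := by
  filter_upwards [hV.solvesPath hX] with ω h1 t
  have h2 := h1.2.2.abs_sub_le hh (measurable_of_rightContinuous h1.1) t.2
  simp only [NNReal.val_eq_coe, Real.toNNReal_coe] at h2
  have h3 : |V t ω| ≤ α * t + (|X t ω| + |x|) := by
    have e : V t ω = (V t ω - (X t ω + x)) + (X t ω + x) := by ring
    rw [e]
    exact (abs_add_le _ _).trans (add_le_add h2 (abs_add_le _ _))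
  have := hh.alpha_nonneg
  have ht : (0 : ℝ) ≤ t := t.2
  have hx := abs_nonneg x
  have hXt := abs_nonneg (X t ω)
  nlinarith [mul_nonneg this hXt, mul_nonneg hx hXt, mul_nonneg hx ht]

lemma IsStrongSolution.aemeasurable (hX : ∀ t, Measurable (X t))
    (hV : IsStrongSolution P X h x V) (t : ℝ≥0) : AEMeasurable (V t) P :=
  ((hV.adapted t).mono (past_le hX t)).aemeasurable

lemma IsStrongSolution.aemeasurable_uncurry [SFinite P] (hX : IsLevyProcess P X)
    (hh : IsRate α h) (hV : IsStrongSolution P X h x V) {μ : Measure ℝ} [SFinite μ]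
    (hμ : ∀ᵐ t ∂μ, 0 < t) : AEMeasurable (fun p : Ω × ℝ => V p.2.toNNReal p.1) (P.prod μ) := by
  refine aemeasurable_uncurry_of_rightContinuous (hV.aemeasurable hX.measurable) ?_
  filter_upwards [Measure.quasiMeasurePreserving_fst.ae (hV.solvesPath hX),
    Measure.quasiMeasurePreserving_snd.ae hμ] with z hz hz2
  exact hz.2.2.rightContinuous hh hz.1 hz2.le

lemma increments_eq_futureIncrements {Ω : Type*} (X : ℝ≥0 → Ω → ℝ) (x : ℝ) (s δ : ℝ≥0) (ω : Ω) :
    increments (fun t => X t.toNNReal ω + x) s δ = futureIncrements X s δ ω := by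
  funext k
  have h1 : ((s : ℝ) + (k + 1) * δ).toNNReal = s + (k + 1) * δ := by
    rw [← Real.toNNReal_coe (r := s + (k + 1) * δ)]
    push_cast
    rfl
  have h2 : ((s : ℝ) + k * δ).toNNReal = s + k * δ := by
    rw [← Real.toNNReal_coe (r := s + k * δ)]
    push_cast
    rfl
  simp only [increments, futureIncrements, h1, h2, add_sub_add_right_eq_sub]

/-- The value at time `s + t` of the scheme with `n + 1` steps started at `b` at time `s`. -/
noncomputable def schemeAt (X : ℝ≥0 → Ω → ℝ) (h : ℝ → ℝ) (b : ℝ) (s t : ℝ≥0) (n : ℕ) (ω : Ω) : ℝ :=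
  scheme h (t / (n + 1 : ℕ)) b (futureIncrements X s (t / (n + 1 : ℕ)) ω) (n + 1)

lemma measurable_schemeAt (hX : ∀ t, Measurable (X t)) (hh : IsRate α h) (b : ℝ) (s t : ℝ≥0)
    (n : ℕ) : Measurable (schemeAt X h b s t n) :=
  (measurable_scheme hh.mono.measurable _ b _).comp (measurable_futureIncrements hX _ _)

lemma abs_schemeAt_sub_le {Ω : Type*} (X : ℝ≥0 → Ω → ℝ) (hh : IsRate α h) (b : ℝ) (s : ℝ≥0)
    {t : ℝ≥0} (ht : 0 < t) (n : ℕ) (ω : Ω) :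
    |schemeAt X h b s t n ω - (b + X (s + t) ω - X s ω)| ≤ α * t := by
  have := abs_scheme_sub_le (p := fun t => X t.toNNReal ω + 0) (s := s) (b := b) (t := t) hh
    (by exact_mod_cast ht) n
  have e := increments_eq_futureIncrements X 0 s (t / (n + 1 : ℕ)) ω
  rw [NNReal.coe_div, NNReal.coe_natCast] at e
  rw [e] at this
  simpa only [schemeAt, add_zero, ← NNReal.coe_add, Real.toNNReal_coe] using this

lemma IsStrongSolution.eventually_abs_sub_schemeAt_le (hX : IsLevyProcess P X) (hh : IsRate α h)
    (hV : IsStrongSolution P X h x V) (b : ℝ) (s : ℝ≥0) {t : ℝ≥0} (ht : 0 < t) :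
    ∀ᵐ ω ∂P, ∀ η > 0, ∀ᶠ n : ℕ in atTop,
      |V (s + t) ω - schemeAt X h b s t n ω| ≤ |V s ω - b| + η := by
  filter_upwards [hV.solvesPath hX] with ω hω η hη
  filter_upwards [hω.2.2.eventually_abs_sub_scheme_le hh hω.1 (s := s) (t := t) s.2
    (by exact_mod_cast ht) b hη] with n hn
  have e := increments_eq_futureIncrements X x s (t / (n + 1 : ℕ)) ω
  rw [NNReal.coe_div, NNReal.coe_natCast] at e
  rw [e] at hn
  simpa only [schemeAt, ← NNReal.coe_add, Real.toNNReal_coe] using hn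

/-- The expectation of a function of the scheme converges to that of the solution started at
the same point. -/
lemma IsStrongSolution.tendsto_integral_schemeAt [IsProbabilityMeasure P] (hX : IsLevyProcess P X)
    (hm : HasPolynomialMoments P X) (hh : IsRate α h) (hV : IsStrongSolution P X h x V)
    {t : ℝ≥0} (ht : 0 < t) {H : ℝ → ℝ} (hH : Continuous H) (hHp : HasPolynomialGrowth H) :
    Tendsto (fun n => ∫ ω, H (schemeAt X h x 0 t n ω) ∂P) atTop (𝓝 (∫ ω, H (V t ω) ∂P)) := by
  obtain ⟨C, N, hC, hb⟩ := hHp.exists_bound zero_le_one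
  set c : ℝ := 1 + |x| + α * t with hc
  have hα := hh.alpha_nonneg
  have hbound : ∀ n ω, |H (schemeAt X h x 0 t n ω)| ≤ C * (c + |X 0 ω| + |X t ω|) ^ N := by
    intro n ω
    have h1 := abs_schemeAt_sub_le X hh x 0 ht n ω
    rw [zero_add] at h1
    have ht' : (0 : ℝ) ≤ α * t := mul_nonneg hα t.2
    have h0 := abs_nonneg (X 0 ω)
    have h2 := abs_nonneg (X t ω)
    have h3 := abs_nonneg x
    refine hb _ _ (by linarith) ?_
    rw [one_mul]
    have e : schemeAt X h x 0 t n ω = (schemeAt X h x 0 t n ω - (x + X t ω - X 0 ω))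
      + (x + X t ω - X 0 ω) := by ring
    rw [e]
    have h4 := abs_add_le (schemeAt X h x 0 t n ω - (x + X t ω - X 0 ω)) (x + X t ω - X 0 ω)
    have h5 := abs_sub (x + X t ω) (X 0 ω)
    have h6 := abs_add_le x (X t ω)
    linarith
  have hint : Integrable (fun ω => C * (c + |X 0 ω| + |X t ω|) ^ N) P := by
    have hXm := hX.measurable
    refine integrable_of_le_pow hX hm (by fun_prop) C c N 0 t (Eventually.of_forall fun ω => ?_)
    rw [abs_of_nonneg]
    have ht' : (0 : ℝ) ≤ α * t := mul_nonneg hα t.2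
    positivity
  refine tendsto_integral_of_dominated_convergence _
    (fun n => (hH.measurable.comp (measurable_schemeAt hX.measurable hh x 0 t n)
      ).aestronglyMeasurable) hint (fun n => Eventually.of_forall fun ω => hbound n ω) ?_
  filter_upwards [hV.eventually_abs_sub_schemeAt_le hX hh x 0 ht, hV.solvesPath hX] with ω h1 h2
  have h3 : V 0 ω = x := by
    have := h2.2.2 0 le_rfl
    simpa [h2.2.1] using this
  rw [h3, sub_self, abs_zero, zero_add] at h1
  refine (hH.tendsto _).comp (Metric.tendsto_atTop.2 fun η hη => ?_)
  obtain ⟨N, hN⟩ := eventually_atTop.1 (h1 (η / 2) (half_pos hη))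
  refine ⟨N, fun n hn => ?_⟩
  have := hN n hn
  rw [zero_add] at this
  rw [Real.dist_eq, abs_sub_comm]
  linarith

/-- An approximate Markov property at the fixed time `s`: on an event of the past on which the
solution is within `ε` of `b`, its future is within `2 ε` of an independent copy of the solution
started at `b`. -/
lemma integral_mul_le_of_near [IsProbabilityMeasure P] (hX : IsLevyProcess P X)
    (hm : HasPolynomialMoments P X) (hh : IsRate α h) {b : ℝ} {W : ℝ≥0 → Ω → ℝ}
    (hV : IsStrongSolution P X h x V) (hW : IsStrongSolution P X h b W)
    {s t : ℝ≥0} (ht : 0 < t) {ε κ : ℝ} (hε : 0 < ε) {K : Ω → ℝ}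
    (hK : AEStronglyMeasurable[past X s] K P) (hK0 : ∀ᵐ ω ∂P, 0 ≤ K ω) (hKκ : ∀ᵐ ω ∂P, K ω ≤ κ)
    (hKε : ∀ᵐ ω ∂P, K ω ≠ 0 → |V s ω - b| ≤ ε)
    {G H : ℝ → ℝ} (hG : Continuous G) (hH : Continuous H) (hGp : HasPolynomialGrowth G)
    (hHp : HasPolynomialGrowth H) (hGH : ∀ a c, |a - c| ≤ 2 * ε → G a ≤ H c) :
    ∫ ω, K ω * G (V (s + t) ω) ∂P ≤ (∫ ω, K ω ∂P) * ∫ ω, H (W t ω) ∂P := by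
  have hα := hh.alpha_nonneg
  have hKm : AEStronglyMeasurable K P := hK.mono (past_le hX.measurable s)
  have hVm : AEMeasurable (V (s + t)) P := hV.aemeasurable hX.measurable _
  obtain ⟨C, N, hC, hHb⟩ := hHp.exists_bound zero_le_one
  obtain ⟨C', N', hC', hGb⟩ := hGp.exists_bound (c := 1 + α + |x|) (by positivity)
  set c : ℝ := 1 + |b| + α * t + s + t with hc
  have hs0 : (0 : ℝ) ≤ s := s.2
  have ht0 : (0 : ℝ) ≤ t := t.2
  have hαt : (0 : ℝ) ≤ α * t := mul_nonneg hα ht0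
  set B : Ω → ℝ := fun ω => c + |X s ω| + |X (s + t) ω| with hB
  have hB1 : ∀ ω, 1 ≤ B ω := fun ω => by
    have h1 := abs_nonneg (X s ω)
    have h2 := abs_nonneg (X (s + t) ω)
    have h3 := abs_nonneg b
    simp only [hB, hc]
    linarith
  have hXm := hX.measurable
  have hBi : ∀ M, Integrable (fun ω => B ω ^ M) P := fun M =>
    integrable_of_le_pow hX hm (by fun_prop) 1 c M s (s + t) (Eventually.of_forall fun ω => by
      rw [one_mul, abs_of_nonneg (pow_nonneg (zero_le_one.trans (hB1 ω)) M)])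
  have hHbound : ∀ n ω, |H (schemeAt X h b s t n ω)| ≤ C * B ω ^ N := by
    intro n ω
    refine hHb _ _ (hB1 ω) ?_
    have h1 := abs_schemeAt_sub_le X hh b s ht n ω
    have e : schemeAt X h b s t n ω = (schemeAt X h b s t n ω - (b + X (s + t) ω - X s ω))
      + (b + X (s + t) ω - X s ω) := by ring
    have h4 := abs_add_le (schemeAt X h b s t n ω - (b + X (s + t) ω - X s ω))
      (b + X (s + t) ω - X s ω)
    have h5 := abs_sub (b + X (s + t) ω) (X s ω)
    have h6 := abs_add_le b (X (s + t) ω)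
    rw [e]
    simp only [hB, hc]
    linarith
  have hGbound : ∀ᵐ ω ∂P, |G (V (s + t) ω)| ≤ C' * B ω ^ N' := by
    filter_upwards [hV.abs_le hX hh] with ω hω
    refine hGb _ _ (hB1 ω) ((hω (s + t)).trans ?_)
    gcongr
    have h1 := abs_nonneg (X s ω)
    have h3 := abs_nonneg b
    simp only [hB, hc]
    push_cast
    linarith
  have hKabs : ∀ᵐ ω ∂P, |K ω| ≤ κ := by
    filter_upwards [hK0, hKκ] with ω h1 h2
    rwa [abs_of_nonneg h1]
  have hHm : ∀ n, AEStronglyMeasurable (fun ω => H (schemeAt X h b s t n ω)) P := fun n =>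
    (hH.measurable.comp (measurable_schemeAt hX.measurable hh b s t n)).aestronglyMeasurable
  have hGm : AEStronglyMeasurable (fun ω => G (V (s + t) ω)) P :=
    (hG.measurable.comp_aemeasurable hVm).aestronglyMeasurable
  have hHi : ∀ n, Integrable (fun ω => K ω * H (schemeAt X h b s t n ω)) P := fun n =>
    (((hBi N).const_mul C).mono' (hHm n) (Eventually.of_forall fun ω => hHbound n ω)).bdd_mul
      hKm hKabs
  have hGi : Integrable (fun ω => K ω * G (V (s + t) ω)) P :=
    (((hBi N').const_mul C').mono' hGm hGbound).bdd_mul hKm hKabs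
  -- the excess of `G` at the solution over `H` at the scheme vanishes in the limit
  set D : ℕ → Ω → ℝ := fun n ω =>
    max (K ω * G (V (s + t) ω) - K ω * H (schemeAt X h b s t n ω)) 0 with hD
  have hDi : ∀ n, Integrable (D n) P := fun n => (hGi.sub (hHi n)).pos_part
  have hDlim : Tendsto (fun n => ∫ ω, D n ω ∂P) atTop (𝓝 0) := by
    have := tendsto_integral_of_dominated_convergence (μ := P) (F := D) (f := fun _ => 0)
      (fun ω => κ * (C' * B ω ^ N' + C * B ω ^ N)) (fun n => (hDi n).1)
      ((((hBi N').const_mul C').add ((hBi N).const_mul C)).const_mul κ) (fun n => ?_) ?_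
    · simpa using this
    · filter_upwards [hKabs, hGbound] with ω h1 h2
      have h3 := hHbound n ω
      rw [Real.norm_eq_abs, abs_of_nonneg (le_max_right _ _)]
      refine max_le ?_ ?_
      · rw [← mul_sub]
        refine (le_abs_self _).trans ?_
        rw [abs_mul]
        refine mul_le_mul h1 ((abs_sub _ _).trans (add_le_add h2 h3)) (abs_nonneg _)
          ((abs_nonneg _).trans h1)
      · exact mul_nonneg ((abs_nonneg _).trans h1)
          (add_nonneg ((abs_nonneg _).trans h2) ((abs_nonneg _).trans h3))
    · filter_upwards [hK0, hKε, hV.eventually_abs_sub_schemeAt_le hX hh b s ht] with ω h1 h2 h3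
      refine (tendsto_congr' ?_).2 tendsto_const_nhds
      by_cases hK' : K ω = 0
      · exact Eventually.of_forall fun n => by simp [hD, hK']
      · filter_upwards [h3 ε hε] with n hn
        have := hGH _ _ (hn.trans (by linarith [h2 hK'] : _ ≤ 2 * ε))
        exact max_eq_right (sub_nonpos.2 (mul_le_mul_of_nonneg_left this h1))
  have hle : ∀ n, ∫ ω, K ω * G (V (s + t) ω) ∂P
      ≤ (∫ ω, K ω ∂P) * (∫ ω, H (schemeAt X h b 0 t n ω) ∂P) + ∫ ω, D n ω ∂P := fun n => by
    have h1 := hX.integral_mul_futureIncrements s (t / (n + 1 : ℕ)) hK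
      (F := fun ξ => H (scheme h (t / (n + 1 : ℕ)) b ξ (n + 1)))
      (hH.measurable.comp (measurable_scheme hh.mono.measurable _ b _))
    have h2 : (∫ ω, K ω ∂P) * (∫ ω, H (schemeAt X h b 0 t n ω) ∂P)
      = ∫ ω, K ω * H (schemeAt X h b s t n ω) ∂P := h1.symm
    rw [h2, ← integral_add (hHi n) (hDi n)]
    refine integral_mono hGi ((hHi n).add (hDi n)) fun ω => ?_
    have := le_max_left (K ω * G (V (s + t) ω) - K ω * H (schemeAt X h b s t n ω)) 0
    simp only [hD]
    linarith
  have hlim := ((hW.tendsto_integral_schemeAt hX hm hh ht hH hHp).const_mul (∫ ω, K ω ∂P)).add hDlim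
  rw [add_zero] at hlim
  exact ge_of_tendsto' hlim hle

end

section

variable {Ω : Type*} [MeasurableSpace Ω] {P : Measure Ω} {X : ℝ≥0 → Ω → ℝ}

/-! ### The flow of solutions and the cost of a difference of rates -/

lemma integrableOn_exp_mul_integral [SFinite P] {q : ℝ} {F : Ω × ℝ → ℝ}
    (hF : Integrable F (P.prod (discountMeasure q))) :
    IntegrableOn (fun t => Real.exp (-q * t) * ∫ ω, F (ω, t) ∂P) (Ioi 0) :=
  integrable_discountMeasure_iff.1 hF.integral_prod_right

lemma integral_prod_discountMeasure [SFinite P] {q : ℝ} {F : Ω × ℝ → ℝ}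
    (hF : Integrable F (P.prod (discountMeasure q))) :
    ∫ z, F z ∂(P.prod (discountMeasure q))
      = ∫ t in Ioi (0 : ℝ), Real.exp (-q * t) * ∫ ω, F (ω, t) ∂P := by
  rw [integral_prod_symm _ hF, integral_discountMeasure]

variable {α x y x' b : ℝ} {h : ℝ → ℝ} {V W Y Z : ℝ≥0 → Ω → ℝ}

lemma IsStrongSolution.flow (hX : IsLevyProcess P X) (hh : IsRate α h)
    (hV : IsStrongSolution P X h x V) (hW : IsStrongSolution P X h y W) (hxy : x ≤ y) :
    ∀ᵐ ω ∂P, ∀ t : ℝ≥0, V t ω ≤ W t ω ∧ W t ω ≤ V t ω + (y - x) ∧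
      W t ω - V t ω
        = (y - x) - ∫ s in (0 : ℝ)..t, (h (W s.toNNReal ω) - h (V s.toNNReal ω)) := by
  filter_upwards [hV.solvesPath hX, hW.solvesPath hX] with ω h1 h2 t
  have hp := measurable_of_rightContinuous h1.1
  have h3 : SolvesPath h (fun t => (X t.toNNReal ω + x) + (y - x)) fun t => W t.toNNReal ω := by
    have e : (fun t : ℝ => (X t.toNNReal ω + x) + (y - x)) = fun t => X t.toNNReal ω + y := by
      funext t; ring
    rw [e]
    exact h2.2.2
  have hc : 0 ≤ y - x := sub_nonneg.2 hxy
  have a1 := h1.2.2.le_of_le h3 hh hp hc t.2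
  have a2 := h1.2.2.le_add h3 hh hp hc t.2
  have a3 := h1.2.2.sub_eq_sub_integral h3 hh hp t.2
  simp only [NNReal.val_eq_coe, Real.toNNReal_coe] at a1 a2 a3
  exact ⟨a1, a2, a3⟩

lemma IsStrongSolution.integrable_comp [IsProbabilityMeasure P] (hX : IsLevyProcess P X)
    (hm : HasPolynomialMoments P X) (hh : IsRate α h) (hV : IsStrongSolution P X h x V)
    {q : ℝ} (hq : 0 < q) {G : ℝ → ℝ} (hG : Continuous G) (hGp : HasPolynomialGrowth G) :
    Integrable (fun z : Ω × ℝ => G (V z.2.toNNReal z.1)) (P.prod (discountMeasure q)) := by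
  have hα := hh.alpha_nonneg
  refine integrable_prod_comp hX hm hq hG hGp
    (hV.aemeasurable_uncurry hX hh (ae_discountMeasure_pos q)) (c := 1 + α + |x|)
    (by positivity) ?_
  filter_upwards [ae_prod_discountMeasure (hV.abs_le hX hh)] with z hz
  have := hz.1 z.2.toNNReal
  rwa [Real.coe_toNNReal _ hz.2.le] at this

lemma IsStrongSolution.integrable_comp_apply [IsProbabilityMeasure P] (hX : IsLevyProcess P X)
    (hm : HasPolynomialMoments P X) (hh : IsRate α h) (hV : IsStrongSolution P X h x V)
    {G : ℝ → ℝ} (hG : Continuous G) (hGp : HasPolynomialGrowth G) (t : ℝ≥0) :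
    Integrable (fun ω => G (V t ω)) P := by
  have hα := hh.alpha_nonneg
  obtain ⟨C, N, hC, hGb⟩ := hGp.exists_bound (c := 1 + α + |x|) (by positivity)
  refine integrable_of_le_pow hX hm
    (hG.measurable.comp_aemeasurable (hV.aemeasurable hX.measurable t)).aestronglyMeasurable
    C (1 + t) N t t ?_
  filter_upwards [hV.abs_le hX hh] with ω hω
  have h1 := abs_nonneg (X t ω)
  have ht : (0 : ℝ) ≤ t := t.2
  refine hGb _ _ (by linarith) ((hω t).trans ?_)
  exact mul_le_mul_of_nonneg_left (by linarith) (by positivity)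

lemma aemeasurable_rate_sub [SFinite P] (hX : IsLevyProcess P X) (hh : IsRate α h)
    (hV : IsStrongSolution P X h x V) (hW : IsStrongSolution P X h y W) {μ : Measure ℝ} [SFinite μ]
    (hμ : ∀ᵐ t ∂μ, 0 < t) :
    AEMeasurable (fun z : Ω × ℝ => h (W z.2.toNNReal z.1) - h (V z.2.toNNReal z.1))
      (P.prod μ) :=
  (hh.mono.measurable.comp_aemeasurable (hW.aemeasurable_uncurry hX hh hμ)).sub
    (hh.mono.measurable.comp_aemeasurable (hV.aemeasurable_uncurry hX hh hμ))

lemma IsRate.abs_sub_le (hh : IsRate α h) (a c : ℝ) : |h a - h c| ≤ α := by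
  rw [_root_.abs_le]
  constructor <;> linarith [hh.nonneg a, hh.nonneg c, hh.le a, hh.le c]

lemma integrable_rate_sub [IsProbabilityMeasure P] (hX : IsLevyProcess P X) (hh : IsRate α h)
    (hV : IsStrongSolution P X h x V) (hW : IsStrongSolution P X h y W) {q : ℝ} (hq : 0 < q) :
    Integrable (fun z : Ω × ℝ => h (W z.2.toNNReal z.1) - h (V z.2.toNNReal z.1))
      (P.prod (discountMeasure q)) := by
  have := isFiniteMeasure_discountMeasure hq
  exact Integrable.of_bound (C := α)
    (aemeasurable_rate_sub hX hh hV hW (ae_discountMeasure_pos q)).aestronglyMeasurable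
    (Eventually.of_forall fun z => hh.abs_sub_le _ _)

/-- The Fubini step: the loss of distance `∫_0^t (h(W) - h(V)) ds` between two solutions occurs only
while they are near `b`, and from each such time on the future of `Y` is comparable to a fresh copy
of the solution `Z` started at `b`. Integrating over time gives a convolution, whose discounted
integral factorizes. -/
lemma integral_mul_loss_le [IsProbabilityMeasure P] (hX : IsLevyProcess P X)
    (hm : HasPolynomialMoments P X) (hh : IsRate α h) (hV : IsStrongSolution P X h x V)
    (hW : IsStrongSolution P X h y W) (hY : IsStrongSolution P X h x' Y)
    (hZ : IsStrongSolution P X h b Z) (hxy : x < y)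
    (hnear : ∀ᵐ ω ∂P, ∀ s : ℝ≥0, h (W s ω) - h (V s ω) ≠ 0 → |Y s ω - b| ≤ y - x)
    {q : ℝ} (hq : 0 < q) {G H : ℝ → ℝ} (hG : Continuous G) (hH : Continuous H)
    (hGp : HasPolynomialGrowth G) (hHp : HasPolynomialGrowth H)
    (hGH : ∀ a c, |a - c| ≤ 2 * (y - x) → G a ≤ H c) :
    ∫ z, ((y - x) - (W z.2.toNNReal z.1 - V z.2.toNNReal z.1)) * G (Y z.2.toNNReal z.1)
        ∂(P.prod (discountMeasure q))
      ≤ (∫ z, (h (W z.2.toNNReal z.1) - h (V z.2.toNNReal z.1)) ∂(P.prod (discountMeasure q)))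
        * ∫ z, H (Z z.2.toNNReal z.1) ∂(P.prod (discountMeasure q)) := by
  have hflow := hV.flow hX hh hW hxy.le
  have hε : 0 < y - x := sub_pos.2 hxy
  have hGi := hY.integrable_comp hX hm hh hq hG hGp
  have hHi := hZ.integrable_comp hX hm hh hq hH hHp
  have hki := integrable_rate_sub hX hh hV hW hq
  have hpos := ae_discountMeasure_pos q
  have hFi : Integrable (fun z : Ω × ℝ =>
      ((y - x) - (W z.2.toNNReal z.1 - V z.2.toNNReal z.1)) * G (Y z.2.toNNReal z.1))
      (P.prod (discountMeasure q)) := by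
    refine hGi.bdd_mul (c := y - x) (((hW.aemeasurable_uncurry hX hh hpos).sub
      (hV.aemeasurable_uncurry hX hh hpos)).const_sub _).aestronglyMeasurable ?_
    filter_upwards [ae_prod_discountMeasure hflow] with z hz
    have := hz.1 z.2.toNNReal
    rw [Real.norm_eq_abs, abs_of_nonneg] <;> linarith [this.1, this.2.1]
  set c : ℝ → ℝ := fun s => ∫ ω, (h (W s.toNNReal ω) - h (V s.toNNReal ω)) ∂P with hc
  set a : ℝ → ℝ := fun r => ∫ ω, H (Z r.toNNReal ω) ∂P with ha
  have hcI : IntegrableOn (fun s => Real.exp (-q * s) * c s) (Ioi 0) :=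
    integrableOn_exp_mul_integral hki
  have haI : IntegrableOn (fun s => Real.exp (-q * s) * a s) (Ioi 0) :=
    integrableOn_exp_mul_integral hHi
  rw [integral_prod_discountMeasure hFi, integral_prod_discountMeasure hki,
    integral_prod_discountMeasure hHi]
  have hconv := integral_posConvolution hcI haI (ContinuousLinearMap.mul ℝ ℝ)
  simp only [ContinuousLinearMap.mul_apply'] at hconv
  rw [← hconv]
  have hconvI : IntegrableOn (fun t => ∫ s in (0 : ℝ)..t,
      Real.exp (-q * s) * c s * (Real.exp (-q * (t - s)) * a (t - s))) (Ioi 0) := by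
    have := integrable_posConvolution hcI haI (ContinuousLinearMap.mul ℝ ℝ)
    unfold posConvolution at this
    rw [integrable_indicator_iff measurableSet_Ioi] at this
    simpa only [ContinuousLinearMap.mul_apply'] using this
  have hex : ∀ᵐ t, Integrable fun s => (Ioi (0 : ℝ)).indicator (fun s => Real.exp (-q * s) * c s) s
      * (Ioi (0 : ℝ)).indicator (fun s => Real.exp (-q * s) * a s) (t - s) :=
    Integrable.ae_convolution_exists (ContinuousLinearMap.mul ℝ ℝ)
      (hcI.integrable_indicator measurableSet_Ioi) (haI.integrable_indicator measurableSet_Ioi)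
  refine setIntegral_mono_on_ae (integrableOn_exp_mul_integral hFi) hconvI measurableSet_Ioi ?_
  filter_upwards [hex] with t hext ht
  have ht' : (0 : ℝ) < t := ht
  have hμ : ∀ᵐ s ∂(volume.restrict (Ioc 0 t)), 0 < s := by
    filter_upwards [ae_restrict_mem measurableSet_Ioc] with s hs using hs.1
  have hGt : Integrable (fun ω => G (Y t.toNNReal ω)) P :=
    hY.integrable_comp_apply hX hm hh hG hGp _
  have hprod : Integrable (fun z : Ω × ℝ =>
      (h (W z.2.toNNReal z.1) - h (V z.2.toNNReal z.1)) * G (Y t.toNNReal z.1))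
      (P.prod (volume.restrict (Ioc 0 t))) :=
    (hGt.comp_fst (volume.restrict (Ioc 0 t))).bdd_mul (c := α)
      (aemeasurable_rate_sub hX hh hV hW hμ).aestronglyMeasurable
      (Eventually.of_forall fun z => hh.abs_sub_le _ _)
  -- the loss of distance at time `t` is the integral of the differences of the rates up to `t`
  have e1 : ∫ ω, ((y - x) - (W t.toNNReal ω - V t.toNNReal ω)) * G (Y t.toNNReal ω) ∂P
      = ∫ s in (0 : ℝ)..t, ∫ ω, (h (W s.toNNReal ω) - h (V s.toNNReal ω)) * G (Y t.toNNReal ω) ∂P := by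
    rw [intervalIntegral.integral_of_le ht'.le]
    have := integral_prod_symm _ hprod
    rw [integral_prod _ hprod] at this
    rw [← this]
    refine integral_congr_ae ?_
    filter_upwards [hflow] with ω hω
    have h3 := (hω t.toNNReal).2.2
    rw [Real.coe_toNNReal _ ht'.le, intervalIntegral.integral_of_le ht'.le] at h3
    rw [integral_mul_const, h3]
    ring
  have e2 : ∀ s, Real.exp (-q * s) * c s * (Real.exp (-q * (t - s)) * a (t - s))
      = Real.exp (-q * t) * (c s * a (t - s)) := fun s => by
    have : Real.exp (-q * t) = Real.exp (-q * s) * Real.exp (-q * (t - s)) := by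
      rw [← Real.exp_add]; ring_nf
    rw [this]; ring
  -- the convolution of the two expectations exists at almost every time only
  have hext' : IntervalIntegrable (fun s => c s * a (t - s)) volume 0 t := by
    rw [intervalIntegrable_iff_integrableOn_Ioo_of_le ht'.le]
    have h1 := (hext.integrableOn (s := Ioo 0 t)).const_mul (Real.exp (q * t))
    refine IntegrableOn.congr_fun h1 (fun s hs => ?_) measurableSet_Ioo
    rw [indicator_of_mem (mem_Ioi.2 hs.1), indicator_of_mem (mem_Ioi.2 (sub_pos.2 hs.2)), e2,
      ← mul_assoc, ← Real.exp_add]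
    simp
  rw [e1]
  simp only [e2]
  rw [intervalIntegral.integral_const_mul]
  refine mul_le_mul_of_nonneg_left ?_ (Real.exp_pos _).le
  refine intervalIntegral.integral_mono_on_of_le_Ioo ht'.le ?_ hext' fun s hs => ?_
  · rw [intervalIntegrable_iff_integrableOn_Ioc_of_le ht'.le]
    exact hprod.integral_prod_right
  · have hst : (s.toNNReal + (t - s).toNNReal) = t.toNNReal := by
      rw [← Real.toNNReal_add hs.1.le (sub_pos.2 hs.2).le]; congr 1; ring
    rw [← hst]
    -- the Markov step at time `s`, over the remaining time `t - s`
    refine integral_mul_le_of_near hX hm hh (ε := y - x) (κ := α) hY hZ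
      (Real.toNNReal_pos.2 (sub_pos.2 hs.2)) hε ?_ ?_ ?_ ?_ hG hH hGp hHp hGH
    · refine AEStronglyMeasurable.sub ?_ ?_
      · obtain ⟨g, hg, hge⟩ := hW.adapted s.toNNReal
        exact ⟨fun ω => h (g ω), (hh.mono.measurable.comp hg.measurable).stronglyMeasurable,
          hge.fun_comp h⟩
      · obtain ⟨g, hg, hge⟩ := hV.adapted s.toNNReal
        exact ⟨fun ω => h (g ω), (hh.mono.measurable.comp hg.measurable).stronglyMeasurable,
          hge.fun_comp h⟩
    · filter_upwards [hflow] with ω hω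
      exact sub_nonneg.2 (hh.mono (hω _).1)
    · exact Eventually.of_forall fun ω => (le_abs_self _).trans (hh.abs_sub_le _ _)
    · filter_upwards [hnear] with ω hω
      exact hω _

end

section

/-! ### The running cost and its derivative -/

section RunningCost

variable {f : ℝ → ℝ}

lemma IsRunningCost.continuous (hf : IsRunningCost f) : Continuous f := hf.contDiff.continuous

lemma IsRunningCost.differentiable (hf : IsRunningCost f) : Differentiable ℝ f :=
  hf.contDiff.differentiable one_ne_zero

lemma IsRunningCost.continuous_deriv (hf : IsRunningCost f) : Continuous (deriv f) :=
  hf.contDiff.continuous_deriv le_rfl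

lemma IsRunningCost.monotone_deriv (hf : IsRunningCost f) : Monotone (deriv f) := by
  have := hf.convex.monotoneOn_deriv fun x _ => hf.differentiable x
  rwa [monotoneOn_univ] at this

lemma IsRunningCost.tangent_le (hf : IsRunningCost f) (a c : ℝ) :
    deriv f a * (c - a) ≤ f c - f a := by
  rcases lt_trichotomy a c with h | rfl | h
  · have := hf.convex.deriv_le_slope (mem_univ a) (mem_univ c) h (hf.differentiable a)
    rwa [slope_def_field, le_div_iff₀ (sub_pos.2 h)] at this
  · simp
  · have := hf.convex.slope_le_deriv (mem_univ c) (mem_univ a) h (hf.differentiable a)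
    rw [slope_def_field, div_le_iff₀ (sub_pos.2 h)] at this
    linarith

lemma IsRunningCost.hasPolynomialGrowth (hf : IsRunningCost f) : HasPolynomialGrowth f := by
  obtain ⟨k₁, k₂, N, h1, h2, h⟩ := hf.growth
  refine ⟨k₁ + k₂, N, by positivity, fun y => (h y).le.trans ?_⟩
  have h3 : (1 : ℝ) ≤ (1 + |y|) ^ N := one_le_pow₀ (by linarith [abs_nonneg y])
  have h4 : |y| ^ N ≤ (1 + |y|) ^ N := by gcongr; linarith
  nlinarith

lemma IsRunningCost.hasPolynomialGrowth_deriv (hf : IsRunningCost f) :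
    HasPolynomialGrowth (deriv f) := by
  obtain ⟨C, N, hC, h⟩ := hf.hasPolynomialGrowth.exists_bound (c := 1) zero_le_one
  refine ⟨2 * C * 2 ^ N, N, by positivity, fun y => ?_⟩
  have hB : ∀ z, |z - y| ≤ 1 → |f z| ≤ C * 2 ^ N * (1 + |y|) ^ N := fun z hz => by
    have h0 := abs_nonneg y
    have := h z (2 * (1 + |y|)) (by linarith) (by
      have : |z| ≤ |z - y| + |y| := by simpa using abs_add_le (z - y) y
      linarith)
    rwa [mul_pow, ← mul_assoc] at this
  have h1 := hf.tangent_le y (y + 1)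
  have h2 := hf.tangent_le y (y - 1)
  have b0 := abs_le.1 (hB y (by simp))
  have b1 := abs_le.1 (hB (y + 1) (by simp))
  have b2 := abs_le.1 (hB (y - 1) (by simp))
  rw [abs_le]
  constructor <;> linarith

end RunningCost

/-! ### The candidate for the derivative of the cost -/

variable {Ω : Type*} [MeasurableSpace Ω] {P : Measure Ω} {X : ℝ≥0 → Ω → ℝ}
  {α x y b q : ℝ} {h : ℝ → ℝ} {V W Z : ℝ≥0 → Ω → ℝ} {f : ℝ → ℝ}

/-- The discounted marginal running cost `E[∫_0^∞ e^{-qt} f'(V_t + c) dt]`. -/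
noncomputable def marginalCost (P : Measure Ω) (q : ℝ) (f : ℝ → ℝ) (V : ℝ≥0 → Ω → ℝ) (c : ℝ) : ℝ :=
  ∫ z, deriv f (V z.2.toNNReal z.1 + c) ∂(P.prod (discountMeasure q))

lemma integrable_marginalCost [IsProbabilityMeasure P] (hX : IsLevyProcess P X)
    (hm : HasPolynomialMoments P X) (hh : IsRate α h) (hV : IsStrongSolution P X h x V)
    (hq : 0 < q) (hf : IsRunningCost f) (c : ℝ) :
    Integrable (fun z : Ω × ℝ => deriv f (V z.2.toNNReal z.1 + c))
      (P.prod (discountMeasure q)) :=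
  hV.integrable_comp hX hm hh hq (G := fun y => deriv f (y + c))
    (hf.continuous_deriv.comp (by fun_prop)) (hf.hasPolynomialGrowth_deriv.comp_add_const c)

lemma marginalCost_le_of_le_add [IsProbabilityMeasure P] (hX : IsLevyProcess P X)
    (hm : HasPolynomialMoments P X) {h' : ℝ → ℝ} (hh : IsRate α h) (hh' : IsRate α h')
    (hV : IsStrongSolution P X h x V)
    (hW : IsStrongSolution P X h' y W) (hq : 0 < q) (hf : IsRunningCost f) {c d : ℝ}
    (hle : ∀ᵐ ω ∂P, ∀ t, V t ω + c ≤ W t ω + d) :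
    marginalCost P q f V c ≤ marginalCost P q f W d := by
  refine integral_mono_ae (integrable_marginalCost hX hm hh hV hq hf c)
    (integrable_marginalCost hX hm hh' hW hq hf d) ?_
  filter_upwards [ae_prod_discountMeasure (q := q) hle] with z hz
  exact hf.monotone_deriv (hz.1 _)

lemma continuous_marginalCost [IsProbabilityMeasure P] (hX : IsLevyProcess P X)
    (hm : HasPolynomialMoments P X) (hh : IsRate α h) (hV : IsStrongSolution P X h x V)
    (hq : 0 < q) (hf : IsRunningCost f) : Continuous (marginalCost P q f V) := by
  refine continuous_iff_continuousAt.2 fun c => ?_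
  refine continuousAt_of_dominated
    (bound := fun z => |deriv f (V z.2.toNNReal z.1 + (c - 1))|
      + |deriv f (V z.2.toNNReal z.1 + (c + 1))|)
    (Eventually.of_forall fun d => (integrable_marginalCost hX hm hh hV hq hf d).1) ?_
    ((integrable_marginalCost hX hm hh hV hq hf _).abs.add
      (integrable_marginalCost hX hm hh hV hq hf _).abs)
    (Eventually.of_forall fun z => (hf.continuous_deriv.comp (by fun_prop)).continuousAt)
  filter_upwards [Metric.ball_mem_nhds c one_pos] with d hd
  rw [Metric.mem_ball, Real.dist_eq, abs_lt] at hd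
  refine Eventually.of_forall fun z => ?_
  have h1 := hf.monotone_deriv
    (by linarith : V z.2.toNNReal z.1 + (c - 1) ≤ V z.2.toNNReal z.1 + d)
  have h2 := hf.monotone_deriv
    (by linarith : V z.2.toNNReal z.1 + d ≤ V z.2.toNNReal z.1 + (c + 1))
  have h3 := neg_abs_le (deriv f (V z.2.toNNReal z.1 + (c - 1)))
  have h4 := le_abs_self (deriv f (V z.2.toNNReal z.1 + (c + 1)))
  have h5 := abs_nonneg (deriv f (V z.2.toNNReal z.1 + (c - 1)))
  have h6 := abs_nonneg (deriv f (V z.2.toNNReal z.1 + (c + 1)))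
  rw [Real.norm_eq_abs, abs_le]
  constructor <;> linarith

section Family

variable {U : ℝ → ℝ≥0 → Ω → ℝ}

lemma monotone_marginalCost_family [IsProbabilityMeasure P] (hX : IsLevyProcess P X)
    (hm : HasPolynomialMoments P X) (hh : IsRate α h) (hU : ∀ x, IsStrongSolution P X h x (U x))
    (hq : 0 < q) (hf : IsRunningCost f) : Monotone fun x => marginalCost P q f (U x) 0 := by
  intro x y hxy
  refine marginalCost_le_of_le_add hX hm hh hh (hU x) (hU y) hq hf ?_
  filter_upwards [(hU x).flow hX hh (hU y) hxy] with ω hω t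
  linarith [(hω t).1]

/-- Continuity in the starting point: by the flow bounds `U y` lies between the spatial shifts of `U x`
by `±|y - x|`. -/
lemma continuous_marginalCost_family [IsProbabilityMeasure P] (hX : IsLevyProcess P X)
    (hm : HasPolynomialMoments P X) (hh : IsRate α h) (hU : ∀ x, IsStrongSolution P X h x (U x))
    (hq : 0 < q) (hf : IsRunningCost f) : Continuous fun x => marginalCost P q f (U x) 0 := by
  refine continuous_iff_continuousAt.2 fun x => ?_
  have hS := continuous_marginalCost hX hm hh (hU x) hq hf
  have hlo : Tendsto (fun y => marginalCost P q f (U x) (-|y - x|)) (𝓝 x)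
      (𝓝 (marginalCost P q f (U x) 0)) := by
    have : Continuous fun y => marginalCost P q f (U x) (-|y - x|) := hS.comp (by fun_prop)
    simpa using this.tendsto x
  have hhi : Tendsto (fun y => marginalCost P q f (U x) |y - x|) (𝓝 x)
      (𝓝 (marginalCost P q f (U x) 0)) := by
    have : Continuous fun y => marginalCost P q f (U x) |y - x| := hS.comp (by fun_prop)
    simpa using this.tendsto x
  refine tendsto_of_tendsto_of_tendsto_of_le_of_le hlo hhi (fun y => ?_) fun y => ?_
  · refine marginalCost_le_of_le_add hX hm hh hh (hU x) (hU y) hq hf ?_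
    rcases le_total x y with hxy | hxy
    · filter_upwards [(hU x).flow hX hh (hU y) hxy] with ω hω t
      linarith [(hω t).1, abs_nonneg (y - x)]
    · filter_upwards [(hU y).flow hX hh (hU x) hxy] with ω hω t
      linarith [(hω t).2.1, neg_le_abs (y - x)]
  · refine marginalCost_le_of_le_add hX hm hh hh (hU y) (hU x) hq hf ?_
    rcases le_total x y with hxy | hxy
    · filter_upwards [(hU x).flow hX hh (hU y) hxy] with ω hω t
      linarith [(hω t).2.1, le_abs_self (y - x)]
    · filter_upwards [(hU y).flow hX hh (hU x) hxy] with ω hω t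
      linarith [(hω t).1, abs_nonneg (y - x)]

end Family

/-! ### Increments of the cost -/

/-- The discounted total cost of a solution `V` of the equation with rate `h`. -/
noncomputable def totalCost (P : Measure Ω) (q β : ℝ) (f h : ℝ → ℝ) (V : ℝ≥0 → Ω → ℝ) : ℝ :=
  ∫ z, (f (V z.2.toNNReal z.1) + β * h (V z.2.toNNReal z.1)) ∂(P.prod (discountMeasure q))

lemma integrable_totalCost [IsProbabilityMeasure P] (hX : IsLevyProcess P X)
    (hm : HasPolynomialMoments P X) (hh : IsRate α h) (hV : IsStrongSolution P X h x V)
    (hq : 0 < q) (hf : IsRunningCost f) (β : ℝ) :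
    Integrable (fun z : Ω × ℝ => f (V z.2.toNNReal z.1) + β * h (V z.2.toNNReal z.1))
      (P.prod (discountMeasure q)) := by
  have := isFiniteMeasure_discountMeasure hq
  refine (hV.integrable_comp hX hm hh hq hf.continuous hf.hasPolynomialGrowth).add
    (Integrable.const_mul ?_ β)
  exact Integrable.of_bound (C := α) (hh.mono.measurable.comp_aemeasurable
    (hV.aemeasurable_uncurry hX hh (ae_discountMeasure_pos q))).aestronglyMeasurable
    (Eventually.of_forall fun z => hh.abs_le _)

/-- The expected discounted loss of distance between two solutions weighted by `G`. -/
noncomputable def weightedLoss (P : Measure Ω) (q : ℝ) (G : ℝ → ℝ) (d : ℝ)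
    (V W Y : ℝ≥0 → Ω → ℝ) : ℝ :=
  ∫ z, (d - (W z.2.toNNReal z.1 - V z.2.toNNReal z.1)) * G (Y z.2.toNNReal z.1)
    ∂(P.prod (discountMeasure q))

/-- The expected discounted difference of the controls of two solutions. -/
noncomputable def controlGap (P : Measure Ω) (q : ℝ) (h : ℝ → ℝ) (V W : ℝ≥0 → Ω → ℝ) : ℝ :=
  ∫ z, (h (W z.2.toNNReal z.1) - h (V z.2.toNNReal z.1)) ∂(P.prod (discountMeasure q))

lemma integrable_weightedLoss [IsProbabilityMeasure P] (hX : IsLevyProcess P X)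
    (hh : IsRate α h) (hV : IsStrongSolution P X h x V) (hW : IsStrongSolution P X h y W)
    (hxy : x ≤ y) {F : Ω × ℝ → ℝ} (hF : Integrable F (P.prod (discountMeasure q))) :
    Integrable (fun z : Ω × ℝ => ((y - x) - (W z.2.toNNReal z.1 - V z.2.toNNReal z.1)) * F z)
      (P.prod (discountMeasure q)) := by
  have hpos := ae_discountMeasure_pos q
  refine hF.bdd_mul (c := y - x) (((hW.aemeasurable_uncurry hX hh hpos).sub
    (hV.aemeasurable_uncurry hX hh hpos)).const_sub _).aestronglyMeasurable ?_
  filter_upwards [ae_prod_discountMeasure (hV.flow hX hh hW hxy)] with z hz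
  have := hz.1 z.2.toNNReal
  rw [Real.norm_eq_abs, abs_of_nonneg] <;> linarith [this.1, this.2.1]

/-- Convexity of the running cost bounds the increment of the total cost from both sides. -/
lemma totalCost_sub_bounds [IsProbabilityMeasure P] (hX : IsLevyProcess P X)
    (hm : HasPolynomialMoments P X) (hh : IsRate α h) (hV : IsStrongSolution P X h x V)
    (hW : IsStrongSolution P X h y W) (hxy : x ≤ y) (hq : 0 < q) (hf : IsRunningCost f) (β : ℝ) :
    (y - x) * marginalCost P q f V 0 - weightedLoss P q (deriv f) (y - x) V W V
        + β * controlGap P q h V W ≤ totalCost P q β f h W - totalCost P q β f h V ∧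
    totalCost P q β f h W - totalCost P q β f h V
      ≤ (y - x) * marginalCost P q f W 0 - weightedLoss P q (deriv f) (y - x) V W W
        + β * controlGap P q h V W := by
  have hV0 := integrable_marginalCost hX hm hh hV hq hf 0
  have hW0 := integrable_marginalCost hX hm hh hW hq hf 0
  simp only [add_zero] at hV0 hW0
  have hLV := integrable_weightedLoss hX hh hV hW hxy hV0
  have hLW := integrable_weightedLoss hX hh hV hW hxy hW0
  have hk := integrable_rate_sub hX hh hV hW hq
  have hTV := integrable_totalCost hX hm hh hV hq hf β
  have hTW := integrable_totalCost hX hm hh hW hq hf β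
  have hA : Integrable (fun z : Ω × ℝ => (y - x) * deriv f (V z.2.toNNReal z.1)
      - ((y - x) - (W z.2.toNNReal z.1 - V z.2.toNNReal z.1)) * deriv f (V z.2.toNNReal z.1))
      (P.prod (discountMeasure q)) := (hV0.const_mul _).sub hLV
  have hB : Integrable (fun z : Ω × ℝ => (y - x) * deriv f (W z.2.toNNReal z.1)
      - ((y - x) - (W z.2.toNNReal z.1 - V z.2.toNNReal z.1)) * deriv f (W z.2.toNNReal z.1))
      (P.prod (discountMeasure q)) := (hW0.const_mul _).sub hLW
  simp only [marginalCost, weightedLoss, controlGap, totalCost, add_zero]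
  rw [← integral_sub hTW hTV, ← integral_const_mul, ← integral_const_mul, ← integral_const_mul,
    ← integral_sub (hV0.const_mul _) hLV, ← integral_sub (hW0.const_mul _) hLW,
    ← integral_add hA (hk.const_mul β), ← integral_add hB (hk.const_mul β)]
  constructor
  · refine integral_mono (hA.add (hk.const_mul β)) (hTW.sub hTV) fun z => ?_
    have := hf.tangent_le (V z.2.toNNReal z.1) (W z.2.toNNReal z.1)
    beta_reduce
    linarith
  · refine integral_mono (hTW.sub hTV) (hB.add (hk.const_mul β)) fun z => ?_
    have := hf.tangent_le (W z.2.toNNReal z.1) (V z.2.toNNReal z.1)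
    beta_reduce
    linarith

/-- A rate of control which vanishes below `b` and is maximal above `b`. -/
structure IsThresholdRate (α b : ℝ) (h : ℝ → ℝ) : Prop extends IsRate α h where
  below : ∀ y, y < b → h y = 0
  above : ∀ y, b < y → h y = α

/-- The rates along two solutions differ only while the threshold separates them, and then both are
within their initial distance of it. -/
lemma IsThresholdRate.near (hh : IsThresholdRate α b h) (hX : IsLevyProcess P X)
    (hV : IsStrongSolution P X h x V) (hW : IsStrongSolution P X h y W) (hxy : x ≤ y) :
    ∀ᵐ ω ∂P, ∀ s : ℝ≥0, h (W s ω) - h (V s ω) ≠ 0 →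
      |V s ω - b| ≤ y - x ∧ |W s ω - b| ≤ y - x := by
  filter_upwards [hV.flow hX hh.toIsRate hW hxy] with ω hω s hs
  obtain ⟨h1, h2, -⟩ := hω s
  have h3 : V s ω ≤ b := by
    by_contra hlt
    rw [not_le] at hlt
    exact hs (by rw [hh.above _ hlt, hh.above _ (hlt.trans_le h1), sub_self])
  have h4 : b ≤ W s ω := by
    by_contra hlt
    rw [not_le] at hlt
    exact hs (by rw [hh.below _ hlt, hh.below _ (h1.trans_lt hlt), sub_self])
  rw [abs_le, abs_le]
  refine ⟨⟨?_, ?_⟩, ⟨?_, ?_⟩⟩ <;> linarith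

lemma controlGap_nonneg [IsProbabilityMeasure P] (hX : IsLevyProcess P X) (hh : IsRate α h)
    (hV : IsStrongSolution P X h x V) (hW : IsStrongSolution P X h y W) (hxy : x ≤ y) :
    0 ≤ controlGap P q h V W := by
  refine integral_nonneg_of_ae ?_
  filter_upwards [ae_prod_discountMeasure (hV.flow hX hh hW hxy)] with z hz
  exact sub_nonneg.2 (hh.mono (hz.1 _).1)

lemma hasPolynomialGrowth_const (c : ℝ) : HasPolynomialGrowth fun _ => c :=
  ⟨|c|, 0, abs_nonneg c, fun y => by simp⟩

/-- The total discounted loss of distance is at most the initial distance. This is the convolution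
bound for the constant weight `-1`. -/
lemma controlGap_le [IsProbabilityMeasure P] (hX : IsLevyProcess P X)
    (hm : HasPolynomialMoments P X) (hh : IsThresholdRate α b h)
    (hV : IsStrongSolution P X h x V) (hW : IsStrongSolution P X h y W)
    (hZ : IsStrongSolution P X h b Z) (hxy : x < y) (hq : 0 < q) :
    controlGap P q h V W ≤ y - x := by
  have hfin := isFiniteMeasure_discountMeasure hq
  have h1 := integral_mul_loss_le hX hm hh.toIsRate hV hW hV hZ hxy
    ((hh.near hX hV hW hxy.le).mono fun ω hω s hs => (hω s hs).1) hq (G := fun _ => -1)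
    (H := fun _ => -1) continuous_const continuous_const (hasPolynomialGrowth_const _)
    (hasPolynomialGrowth_const _) fun _ _ _ => le_rfl
  have hm1 : ∫ z : Ω × ℝ, (1 : ℝ) ∂(P.prod (discountMeasure q)) = 1 / q := by
    rw [integral_prod_discountMeasure (integrable_const _)]
    simp only [integral_const, probReal_univ, smul_eq_mul, mul_one]
    rw [integral_exp_mul_Ioi (by linarith : -q < 0)]
    simp
  have h2 : ∫ z, ((y - x) - (W z.2.toNNReal z.1 - V z.2.toNNReal z.1)) * (1 : ℝ)
      ∂(P.prod (discountMeasure q)) ≤ ∫ z, (y - x) * (1 : ℝ) ∂(P.prod (discountMeasure q)) := by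
    refine integral_mono_ae (integrable_weightedLoss hX hh.toIsRate hV hW hxy.le
      (integrable_const _)) (integrable_const _) ?_
    filter_upwards [ae_prod_discountMeasure (hV.flow hX hh.toIsRate hW hxy.le)] with z hz
    have := (hz.1 z.2.toNNReal).1
    linarith
  rw [integral_const_mul, hm1] at h2
  simp only [mul_neg, integral_neg, hm1] at h1
  have h3 : controlGap P q h V W * (1 / q) ≤ (y - x) * (1 / q) := by
    rw [controlGap]
    linarith
  exact le_of_mul_le_mul_right h3 (by positivity)

/-- The increments of the cost of the threshold `b` are controlled by the marginal cost as soon as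
the marginal cost at `b` is the unit price `β` of the control. -/
lemma totalCost_sub_sandwich [IsProbabilityMeasure P] (hX : IsLevyProcess P X)
    (hm : HasPolynomialMoments P X) (hh : IsThresholdRate α b h)
    (hV : IsStrongSolution P X h x V) (hW : IsStrongSolution P X h y W)
    (hZ : IsStrongSolution P X h b Z) (hxy : x < y) (hq : 0 < q) (hf : IsRunningCost f) {β : ℝ}
    (hβ : marginalCost P q f Z 0 = β) :
    (y - x) * (marginalCost P q f V 0
        - (marginalCost P q f Z (2 * (y - x)) - marginalCost P q f Z (-(2 * (y - x)))))
      ≤ totalCost P q β f h W - totalCost P q β f h V ∧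
    totalCost P q β f h W - totalCost P q β f h V
      ≤ (y - x) * (marginalCost P q f W 0
        + (marginalCost P q f Z (2 * (y - x)) - marginalCost P q f Z (-(2 * (y - x))))) := by
  have hε : 0 < y - x := sub_pos.2 hxy
  obtain ⟨hlow, hupp⟩ := totalCost_sub_bounds hX hm hh.toIsRate hV hW hxy.le hq hf β
  have hg0 := controlGap_nonneg (q := q) hX hh.toIsRate hV hW hxy.le
  have hg1 := controlGap_le hX hm hh hV hW hZ hxy hq
  have hnear := hh.near hX hV hW hxy.le
  set g := controlGap P q h V W with hg
  have h1 : weightedLoss P q (deriv f) (y - x) V W V ≤ g * marginalCost P q f Z (2 * (y - x)) :=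
    integral_mul_loss_le hX hm hh.toIsRate hV hW hV hZ hxy
      (hnear.mono fun ω hω s hs => (hω s hs).1) hq (G := deriv f)
      (H := fun y' => deriv f (y' + 2 * (y - x))) hf.continuous_deriv
      (hf.continuous_deriv.comp (by fun_prop)) hf.hasPolynomialGrowth_deriv
      (hf.hasPolynomialGrowth_deriv.comp_add_const _) fun a c hac =>
        hf.monotone_deriv (by linarith [(abs_le.1 hac).2])
  have h2 : g * marginalCost P q f Z (-(2 * (y - x)))
      ≤ weightedLoss P q (deriv f) (y - x) V W W := by
    have := integral_mul_loss_le hX hm hh.toIsRate hV hW hW hZ hxy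
      (hnear.mono fun ω hω s hs => (hω s hs).2) hq (G := fun y' => -deriv f y')
      (H := fun y' => -deriv f (y' + -(2 * (y - x)))) hf.continuous_deriv.neg
      (hf.continuous_deriv.comp (by fun_prop)).neg hf.hasPolynomialGrowth_deriv.neg
      (hf.hasPolynomialGrowth_deriv.comp_add_const _).neg fun a c hac =>
        neg_le_neg (hf.monotone_deriv (by linarith [(abs_le.1 hac).1]))
    simp only [mul_neg, integral_neg] at this
    simp only [marginalCost, weightedLoss, hg, controlGap]
    linarith
  have hm1 : marginalCost P q f Z 0 ≤ marginalCost P q f Z (2 * (y - x)) :=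
    marginalCost_le_of_le_add hX hm hh.toIsRate hh.toIsRate hZ hZ hq hf
      (Eventually.of_forall fun ω t => by linarith)
  have hm2 : marginalCost P q f Z (-(2 * (y - x))) ≤ marginalCost P q f Z 0 :=
    marginalCost_le_of_le_add hX hm hh.toIsRate hh.toIsRate hZ hZ hq hf
      (Eventually.of_forall fun ω t => by linarith)
  rw [hβ] at hm1 hm2
  set M := marginalCost P q f Z (2 * (y - x))
  set m := marginalCost P q f Z (-(2 * (y - x)))
  -- the terms `g β` of the control cost and of the weighted loss cancel up to these errors
  have h3 : g * (M - β) ≤ (y - x) * (M - m) :=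
    mul_le_mul hg1 (by linarith) (by linarith) hε.le
  have h4 : g * (β - m) ≤ (y - x) * (M - m) :=
    mul_le_mul hg1 (by linarith) (by linarith) hε.le
  constructor <;> nlinarith

/-! ### Differentiability from two-sided increment bounds -/

/-- In the application `R` is the marginal cost as a function of the starting point and `e` the error
of the spatial shifts. -/
lemma hasDerivAt_of_sandwich {v R e : ℝ → ℝ} (hR : Continuous R) (he : Continuous e)
    (he0 : e 0 = 0)
    (hs : ∀ x y, x < y → (y - x) * (R x - e (y - x)) ≤ v y - v x ∧
      v y - v x ≤ (y - x) * (R y + e (y - x))) (x : ℝ) : HasDerivAt v (R x) x := by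
  rw [hasDerivAt_iff_tendsto_slope]
  have hlo : Tendsto (fun y => min (R x) (R y) - e |y - x|) (𝓝[≠] x) (𝓝 (R x)) := by
    have : Continuous fun y => min (R x) (R y) - e |y - x| := by fun_prop
    have := this.tendsto x
    simp only [min_self, sub_self, abs_zero, he0, sub_zero] at this
    exact this.mono_left nhdsWithin_le_nhds
  have hhi : Tendsto (fun y => max (R x) (R y) + e |y - x|) (𝓝[≠] x) (𝓝 (R x)) := by
    have : Continuous fun y => max (R x) (R y) + e |y - x| := by fun_prop
    have := this.tendsto x
    simp only [max_self, sub_self, abs_zero, he0, add_zero] at this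
    exact this.mono_left nhdsWithin_le_nhds
  have hslope : ∀ᶠ y in 𝓝[≠] x, min (R x) (R y) - e |y - x| ≤ slope v x y ∧
      slope v x y ≤ max (R x) (R y) + e |y - x| := by
    filter_upwards [self_mem_nhdsWithin] with y hy
    rcases lt_or_gt_of_ne hy with hlt | hlt
    · obtain ⟨h1, h2⟩ := hs y x hlt
      have hp : 0 < x - y := sub_pos.2 hlt
      rw [slope_comm, slope_def_field, abs_sub_comm, abs_of_pos hp]
      rw [mul_comm, ← le_div_iff₀ hp] at h1
      rw [mul_comm, ← div_le_iff₀ hp] at h2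
      constructor
      · linarith [min_le_right (R x) (R y)]
      · linarith [le_max_left (R x) (R y)]
    · obtain ⟨h1, h2⟩ := hs x y hlt
      have hp : 0 < y - x := sub_pos.2 hlt
      rw [slope_def_field, abs_of_pos hp]
      rw [mul_comm, ← le_div_iff₀ hp] at h1
      rw [mul_comm, ← div_le_iff₀ hp] at h2
      constructor
      · linarith [min_le_left (R x) (R y)]
      · linarith [le_max_right (R x) (R y)]
  exact tendsto_of_tendsto_of_tendsto_of_le_of_le' hlo hhi (hslope.mono fun y hy => hy.1)
    (hslope.mono fun y hy => hy.2)

end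

section

variable {Ω : Type*} [MeasurableSpace Ω] {P : Measure Ω} {X : ℝ≥0 → Ω → ℝ}
  {α β x y b q : ℝ} {h : ℝ → ℝ} {V W : ℝ≥0 → Ω → ℝ} {f : ℝ → ℝ}

/-! ### Derivative of the cost of a threshold and of a constant rate -/

lemma hasDerivAt_totalCost_threshold [IsProbabilityMeasure P] (hX : IsLevyProcess P X)
    (hm : HasPolynomialMoments P X) (hh : IsThresholdRate α b h) {U : ℝ → ℝ≥0 → Ω → ℝ}
    (hU : ∀ x, IsStrongSolution P X h x (U x)) (hq : 0 < q) (hf : IsRunningCost f)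
    (hβ : marginalCost P q f (U b) 0 = β) (x : ℝ) :
    HasDerivAt (fun x => totalCost P q β f h (U x)) (marginalCost P q f (U x) 0) x := by
  have hc := continuous_marginalCost hX hm hh.toIsRate (hU b) hq hf
  refine hasDerivAt_of_sandwich
    (e := fun d => marginalCost P q f (U b) (2 * d) - marginalCost P q f (U b) (-(2 * d)))
    (continuous_marginalCost_family hX hm hh.toIsRate hU hq hf)
    ((hc.comp (by fun_prop)).sub (hc.comp (by fun_prop))) (by simp) (fun x y hxy => ?_) x
  exact totalCost_sub_sandwich hX hm hh (hU x) (hU y) (hU b) hxy hq hf hβ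

lemma isRate_const {r : ℝ} (hr : r ∈ Icc 0 α) : IsRate α fun _ => r :=
  ⟨monotone_const, fun _ => hr.1, fun _ => hr.2⟩

lemma isStrongSolution_const (r x : ℝ) :
    IsStrongSolution P X (fun _ => r) x fun t ω => x + X t ω - r * t where
  adapted t := by
    have h1 : Measurable[past X t] (X t) :=
      (comap_measurable (X t)).mono (le_iSup₂ (f := fun s (_ : s ≤ t) =>
        MeasurableSpace.comap (X s) inferInstance) t le_rfl) le_rfl
    exact ((h1.const_add x).sub_const _).aestronglyMeasurable
  equation := Eventually.of_forall fun ω t => by simp [mul_comm]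

/-- A constant rate does not contract the flow, and hence no term of contraction appears. -/
lemma hasDerivAt_totalCost_const [IsProbabilityMeasure P] (hX : IsLevyProcess P X)
    (hm : HasPolynomialMoments P X) {r : ℝ} (hr : r ∈ Icc 0 α) {U : ℝ → ℝ≥0 → Ω → ℝ}
    (hU : ∀ x, IsStrongSolution P X (fun _ => r) x (U x)) (hq : 0 < q) (hf : IsRunningCost f)
    (x : ℝ) :
    HasDerivAt (fun x => totalCost P q β f (fun _ => r) (U x)) (marginalCost P q f (U x) 0) x := by
  have hh := isRate_const hr
  refine hasDerivAt_of_sandwich (e := fun _ => 0)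
    (continuous_marginalCost_family hX hm hh hU hq hf) continuous_const rfl (fun x y hxy => ?_) x
  have hk : controlGap P q (fun _ => r) (U x) (U y) = 0 := by simp [controlGap]
  have hl : ∀ Y, weightedLoss P q (deriv f) (y - x) (U x) (U y) Y = 0 := fun Y => by
    refine integral_eq_zero_of_ae ?_
    filter_upwards [ae_prod_discountMeasure ((hU x).flow hX hh (hU y) hxy.le)] with z hz
    have := (hz.1 z.2.toNNReal).2.2
    simp only [sub_self, intervalIntegral.integral_zero, sub_zero] at this
    simp [this]
  have := totalCost_sub_bounds hX hm hh (hU x) (hU y) hxy.le hq hf β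
  simpa only [hk, hl, mul_zero, add_zero, sub_zero] using this

/-! ### Limits of solutions for vanishing and for maximal control -/

lemma IsStrongSolution.mem_Icc (hX : IsLevyProcess P X) (hh : IsRate α h)
    (hV : IsStrongSolution P X h x V) :
    ∀ᵐ ω ∂P, ∀ t : ℝ≥0, V t ω ∈ Icc (x + X t ω - α * t) (x + X t ω) := by
  filter_upwards [hV.solvesPath hX] with ω hω t
  have h1 := hω.2.2.integral_mem hh (measurable_of_rightContinuous hω.1) t.2
  have h2 := hω.2.2 t t.2
  simp only [NNReal.val_eq_coe, Real.toNNReal_coe] at h1 h2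
  constructor <;> linarith [h1.1, h1.2]

/-- If the rates converge pointwise to a constant, the solutions converge: by monotonicity the rate
along the solution is squeezed between the rates along the two extremal paths. -/
lemma tendsto_solution_of_tendsto_rate (hX : IsLevyProcess P X) {h : ℕ → ℝ → ℝ}
    (hh : ∀ n, IsRate α (h n)) {V : ℕ → ℝ≥0 → Ω → ℝ}
    (hV : ∀ n, IsStrongSolution P X (h n) x (V n)) {r : ℝ}
    (hr : ∀ y, Tendsto (fun n => h n y) atTop (𝓝 r)) :
    ∀ᵐ ω ∂P, ∀ t : ℝ≥0, Tendsto (fun n => V n t ω) atTop (𝓝 (x + X t ω - r * t)) := by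
  filter_upwards [ae_all_iff.2 fun n => (hV n).solvesPath hX,
    ae_all_iff.2 fun n => (hV n).mem_Icc hX (hh n)] with ω h1 h2 t
  have h3 : ∀ s : ℝ≥0, Tendsto (fun n => h n (V n s ω)) atTop (𝓝 r) := fun s =>
    tendsto_of_tendsto_of_tendsto_of_le_of_le (hr _) (hr _)
      (fun n => (hh n).mono (h2 n s).1) fun n => (hh n).mono (h2 n s).2
  have h4 : Tendsto (fun n => ∫ s in (0 : ℝ)..t, h n (V n s.toNNReal ω)) atTop
      (𝓝 (∫ _ in (0 : ℝ)..t, r)) := by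
    refine intervalIntegral.tendsto_integral_filter_of_dominated_convergence (fun _ => α)
      (Eventually.of_forall fun n => ?_)
      (Eventually.of_forall fun n => Eventually.of_forall fun s _ => (hh n).abs_le _)
      intervalIntegrable_const (Eventually.of_forall fun s _ => h3 _)
    exact ((h1 n).2.2.intervalIntegrable (hh n) (measurable_of_rightContinuous (h1 n).1)
      le_rfl t.2).aestronglyMeasurable_restrict_uIoc
  rw [intervalIntegral.integral_const, sub_zero, smul_eq_mul, mul_comm] at h4
  have h5 : ∀ n, V n t ω = x + X t ω - ∫ s in (0 : ℝ)..t, h n (V n s.toNNReal ω) := fun n => by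
    have := (h1 n).2.2 t t.2
    simp only [Real.toNNReal_coe] at this
    linarith
  simp only [h5]
  exact tendsto_const_nhds.sub h4

lemma tendsto_marginalCost_of_tendsto_rate [IsProbabilityMeasure P] (hX : IsLevyProcess P X)
    (hm : HasPolynomialMoments P X) {h : ℕ → ℝ → ℝ} (hh : ∀ n, IsRate α (h n))
    {V : ℕ → ℝ≥0 → Ω → ℝ} (hV : ∀ n, IsStrongSolution P X (h n) x (V n)) {r : ℝ}
    (hr : ∀ y, Tendsto (fun n => h n y) atTop (𝓝 r)) (hq : 0 < q) (hf : IsRunningCost f) :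
    Tendsto (fun n => marginalCost P q f (V n) 0) atTop
      (𝓝 (marginalCost P q f (fun t ω => x + X t ω - r * t) 0)) := by
  have hα := (hh 0).alpha_nonneg
  -- by monotonicity `f'` along the solutions is dominated by its values along the extremal paths
  have hlo := integrable_marginalCost hX hm (isRate_const ⟨hα, le_rfl⟩)
    (isStrongSolution_const α x) hq hf 0
  have hhi := integrable_marginalCost hX hm (isRate_const ⟨le_rfl, hα⟩)
    (isStrongSolution_const 0 x) hq hf 0
  refine tendsto_integral_of_dominated_convergence _
    (fun n => (integrable_marginalCost hX hm (hh n) (hV n) hq hf 0).1)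
    (hlo.abs.add hhi.abs) (fun n => ?_) ?_
  · filter_upwards [ae_prod_discountMeasure ((hV n).mem_Icc hX (hh n))] with z hz
    have h1 := hz.1 z.2.toNNReal
    have h2 := hf.monotone_deriv h1.1
    have h3 := hf.monotone_deriv h1.2
    simp only [zero_mul, sub_zero, add_zero, Pi.add_apply, Real.norm_eq_abs]
    rw [abs_le]
    constructor
    · linarith [neg_abs_le (deriv f (x + X z.2.toNNReal z.1 - α * z.2.toNNReal)),
        abs_nonneg (deriv f (x + X z.2.toNNReal z.1))]
    · linarith [le_abs_self (deriv f (x + X z.2.toNNReal z.1)),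
        abs_nonneg (deriv f (x + X z.2.toNNReal z.1 - α * z.2.toNNReal))]
  · filter_upwards [ae_prod_discountMeasure (tendsto_solution_of_tendsto_rate hX hh hV hr)]
      with z hz
    simp only [add_zero]
    exact (hf.continuous_deriv.tendsto _).comp (hz.1 z.2.toNNReal)

/-! ### The threshold rates and the marginal cost at the threshold -/

section Rate

variable {γ : ℝ} {ν : Measure ℝ}

lemma isThresholdRate_rate (hα : 0 < α) (b : ℝ) :
    IsThresholdRate α b (rate P X γ ν α (b : EReal)) := by
  have hle : ∀ y, rate P X γ ν α (b : EReal) y ∈ Icc 0 α := fun y => by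
    rw [rate]
    split_ifs with h1 h2
    · exact ⟨hα.le, le_rfl⟩
    · exact h2.2.2
    · exact ⟨le_rfl, hα.le⟩
  have hab : ∀ y, b < y → rate P X γ ν α (b : EReal) y = α := fun y hy =>
    if_pos (EReal.coe_lt_coe_iff.2 hy)
  have hbe : ∀ y, y < b → rate P X γ ν α (b : EReal) y = 0 := fun y hy => by
    rw [rate, if_neg (not_lt.2 (EReal.coe_le_coe_iff.2 hy.le)), if_neg]
    exact fun h => hy.ne (EReal.coe_eq_coe_iff.1 h.1)
  refine ⟨⟨fun y z hyz => ?_, fun y => (hle y).1, fun y => (hle y).2⟩, hbe, hab⟩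
  rcases hyz.eq_or_lt with rfl | hlt
  · exact le_rfl
  rcases lt_or_ge y b with hy | hy
  · rw [hbe y hy]
    exact (hle z).1
  · rw [hab z (hy.trans_lt hlt)]
    exact (hle y).2

lemma rate_add (b c y : ℝ) :
    rate P X γ ν α ((b + c : ℝ) : EReal) (y + c) = rate P X γ ν α (b : EReal) y := by
  have h : ((y + c : ℝ) : EReal) = ((b + c : ℝ) : EReal) ↔ (y : EReal) = (b : EReal) := by
    rw [EReal.coe_eq_coe_iff, EReal.coe_eq_coe_iff, add_left_inj]
  simp only [rate, EReal.coe_lt_coe_iff, add_lt_add_iff_right]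
  classical
  exact if_congr Iff.rfl rfl (if_congr (and_congr_left' h) rfl rfl)

lemma rate_top (y : ℝ) : rate P X γ ν α ⊤ y = 0 := by simp [rate]

lemma rate_bot (y : ℝ) : rate P X γ ν α ⊥ y = α := by simp [rate]

/-- Solutions of the equation for translated thresholds are translates of each other. -/
lemma IsStrongSolution.eq_add_const (hX : IsLevyProcess P X) (hh : IsRate α h) {h' : ℝ → ℝ} {c : ℝ}
    (hV : IsStrongSolution P X h x V) (hW : IsStrongSolution P X h' (x + c) W)
    (hc : ∀ y, h' (y + c) = h y) : ∀ᵐ ω ∂P, ∀ t, W t ω = V t ω + c := by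
  filter_upwards [hV.solvesPath hX, hW.solvesPath hX] with ω h1 h2 t
  have h3 : SolvesPath h (fun t => X t.toNNReal ω + x) fun t => W t.toNNReal ω - c := by
    intro t ht
    have h4 := h2.2.2 t ht
    have h5 : ∀ s : ℝ, h (W s.toNNReal ω - c) = h' (W s.toNNReal ω) := fun s => by
      rw [← hc, sub_add_cancel]
    simp only [h5]
    linarith
  have h6 := h1.2.2.unique h3 hh (measurable_of_rightContinuous h1.1) t.2
  simp only [NNReal.val_eq_coe, Real.toNNReal_coe] at h6
  linarith

variable {U : ℝ → ℝ → ℝ≥0 → Ω → ℝ}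

lemma discountedIntegrable_rho [IsProbabilityMeasure P] (hX : IsLevyProcess P X)
    (hm : HasPolynomialMoments P X) (hα : 0 < α) (hq : 0 < q) (hf : IsRunningCost f)
    (hU : ∀ b x : ℝ, IsStrongSolution P X (rate P X γ ν α (b : EReal)) x (U b x)) (b : ℝ) :
    DiscountedIntegrable P q fun t ω => deriv f (U b b t ω) := by
  rw [discountedIntegrable_iff]
  simpa only [add_zero] using
    integrable_marginalCost hX hm (isThresholdRate_rate hα b).toIsRate (hU b b) hq hf 0

lemma rho_eq_marginalCost [IsProbabilityMeasure P] (hX : IsLevyProcess P X)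
    (hm : HasPolynomialMoments P X) (hα : 0 < α) (hq : 0 < q) (hf : IsRunningCost f)
    (hU : ∀ b x : ℝ, IsStrongSolution P X (rate P X γ ν α (b : EReal)) x (U b x)) (b : ℝ) :
    rho P q f U b = marginalCost P q f (U b b) 0 := by
  rw [rho, discounted_eq_integral_prod
    (discountedIntegrable_iff.1 (discountedIntegrable_rho hX hm hα hq hf hU b))]
  simp only [marginalCost, add_zero]

lemma rho_add_eq_marginalCost [IsProbabilityMeasure P] (hX : IsLevyProcess P X)
    (hm : HasPolynomialMoments P X) (hα : 0 < α) (hq : 0 < q) (hf : IsRunningCost f)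
    (hU : ∀ b x : ℝ, IsStrongSolution P X (rate P X γ ν α (b : EReal)) x (U b x)) (b c : ℝ) :
    rho P q f U (b + c) = marginalCost P q f (U b b) c := by
  rw [rho_eq_marginalCost hX hm hα hq hf hU]
  refine integral_congr_ae ?_
  filter_upwards [ae_prod_discountMeasure ((hU b b).eq_add_const hX
    (isThresholdRate_rate hα b).toIsRate (hU (b + c) (b + c)) (rate_add b c))] with z hz
  simp only [hz.1, add_zero]

lemma continuous_rho [IsProbabilityMeasure P] (hX : IsLevyProcess P X)
    (hm : HasPolynomialMoments P X) (hα : 0 < α) (hq : 0 < q) (hf : IsRunningCost f)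
    (hU : ∀ b x : ℝ, IsStrongSolution P X (rate P X γ ν α (b : EReal)) x (U b x)) :
    Continuous (rho P q f U) := by
  have h1 : rho P q f U = marginalCost P q f (U 0 0) := funext fun c => by
    rw [← rho_add_eq_marginalCost hX hm hα hq hf hU, zero_add]
  rw [h1]
  exact continuous_marginalCost hX hm (isThresholdRate_rate hα 0).toIsRate (hU 0 0) hq hf

lemma monotone_rho [IsProbabilityMeasure P] (hX : IsLevyProcess P X)
    (hm : HasPolynomialMoments P X) (hα : 0 < α) (hq : 0 < q) (hf : IsRunningCost f)
    (hU : ∀ b x : ℝ, IsStrongSolution P X (rate P X γ ν α (b : EReal)) x (U b x)) :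
    Monotone (rho P q f U) := by
  intro a b hab
  have hh := (isThresholdRate_rate (P := P) (X := X) (γ := γ) (ν := ν) hα 0).toIsRate
  rw [← zero_add a, ← zero_add b, rho_add_eq_marginalCost hX hm hα hq hf hU,
    rho_add_eq_marginalCost hX hm hα hq hf hU]
  exact marginalCost_le_of_le_add hX hm hh hh (hU 0 0) (hU 0 0) hq hf
    (Eventually.of_forall fun ω t => by linarith)

/-! ### The candidate threshold -/

lemma lt_beta_of_lt_bStar {b : ℝ} (hb : (b : EReal) < bStar P q β f U) : rho P q f U b < β := by
  by_contra! hle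
  exact hb.not_ge (sInf_le ⟨b, sub_nonneg.2 hle, rfl⟩)

lemma beta_le_of_bStar_lt (hmono : Monotone (rho P q f U)) {b : ℝ}
    (hb : bStar P q β f U < (b : EReal)) : β ≤ rho P q f U b := by
  obtain ⟨_, ⟨a, ha, rfl⟩, hab⟩ := sInf_lt_iff.1 hb
  exact (sub_nonneg.1 ha).trans (hmono (EReal.coe_lt_coe_iff.1 hab).le)

/-- At a finite threshold `b*` the infimum is attained with equality, as `ρ` is continuous. -/
lemma rho_eq_beta_of_bStar_eq (hmono : Monotone (rho P q f U)) (hcont : Continuous (rho P q f U))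
    {b : ℝ} (hb : bStar P q β f U = (b : EReal)) : rho P q f U b = β := by
  refine le_antisymm ?_ ?_
  · refine le_of_tendsto (hcont.continuousWithinAt (s := Iio b)) ?_
    filter_upwards [self_mem_nhdsWithin] with a ha
    exact (lt_beta_of_lt_bStar (hb ▸ EReal.coe_lt_coe_iff.2 ha)).le
  · refine ge_of_tendsto (hcont.continuousWithinAt (s := Ioi b)) ?_
    filter_upwards [self_mem_nhdsWithin] with a ha
    exact beta_le_of_bStar_lt hmono (hb ▸ EReal.coe_lt_coe_iff.2 ha)

/-! ### The cost of a refraction strategy -/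

lemma discountedIntegrable_and_value_eq [IsProbabilityMeasure P] (hX : IsLevyProcess P X)
    (hm : HasPolynomialMoments P X) (hh : IsRate α h) (hq : 0 < q) (hf : IsRunningCost f)
    {b : EReal} (hb : ∀ y, rate P X γ ν α b y = h y)
    (hV : IsStrongSolution P X h x (controlled X α U b x)) :
    DiscountedIntegrable P q (costRate P X γ ν α β f U b x) ∧
      value P X γ ν q α β f U b x = totalCost P q β f h (controlled X α U b x) := by
  have h1 := integrable_totalCost hX hm hh hV hq hf β
  have h2 : Integrable (fun z : Ω × ℝ => costRate P X γ ν α β f U b x z.2.toNNReal z.1)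
      (P.prod (discountMeasure q)) := by simpa only [costRate, hb] using h1
  refine ⟨discountedIntegrable_iff.2 h2, ?_⟩
  rw [value, discounted_eq_integral_prod h2]
  simp only [costRate, hb, totalCost]

lemma controlled_coe {Ω : Type*} {X : ℝ≥0 → Ω → ℝ} {U : ℝ → ℝ → ℝ≥0 → Ω → ℝ} (b x : ℝ) : controlled X α U (b : EReal) x = U b x := by
  funext t ω
  simp [controlled]

lemma controlled_top {Ω : Type*} {X : ℝ≥0 → Ω → ℝ} {U : ℝ → ℝ → ℝ≥0 → Ω → ℝ} (x : ℝ) : controlled X α U ⊤ x = fun t ω => x + X t ω - 0 * t := by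
  funext t ω
  simp [controlled]

lemma controlled_bot {Ω : Type*} {X : ℝ≥0 → Ω → ℝ} {U : ℝ → ℝ → ℝ≥0 → Ω → ℝ} (x : ℝ) : controlled X α U ⊥ x = fun t ω => x + X t ω - α * t := by
  funext t ω
  simp [controlled]

/-- The cost of the refraction strategy at `b*` is finite and differentiable, and its derivative is
the discounted marginal running cost. -/
lemma hasDerivAt_value_bStar [IsProbabilityMeasure P] (hX : IsLevyProcess P X)
    (hm : HasPolynomialMoments P X) (hα : 0 < α) (hq : 0 < q) (hf : IsRunningCost f)
    (hU : ∀ b x : ℝ, IsStrongSolution P X (rate P X γ ν α (b : EReal)) x (U b x)) {b : EReal}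
    (hb : b = bStar P q β f U) (x : ℝ) :
    DiscountedIntegrable P q (costRate P X γ ν α β f U b x) ∧
      HasDerivAt (value P X γ ν q α β f U b)
        (marginalCost P q f (controlled X α U b x) 0) x := by
  induction b with
  | bot =>
    have hr : α ∈ Icc 0 α := ⟨hα.le, le_rfl⟩
    have hV : ∀ x, IsStrongSolution P X (fun _ => α) x (controlled X α U ⊥ x) := fun x => by
      rw [controlled_bot]
      exact isStrongSolution_const α x
    have h1 := fun x => discountedIntegrable_and_value_eq (β := β) hX hm (isRate_const hr) hq hf
      (rate_bot (P := P) (X := X) (γ := γ) (ν := ν)) (hV x)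
    refine ⟨(h1 x).1, ?_⟩
    rw [funext fun x => (h1 x).2]
    exact hasDerivAt_totalCost_const hX hm hr hV hq hf x
  | top =>
    have hr : (0 : ℝ) ∈ Icc 0 α := ⟨le_rfl, hα.le⟩
    have hV : ∀ x, IsStrongSolution P X (fun _ => (0 : ℝ)) x (controlled X α U ⊤ x) := fun x => by
      rw [controlled_top]
      exact isStrongSolution_const 0 x
    have h1 := fun x => discountedIntegrable_and_value_eq (β := β) hX hm (isRate_const hr) hq hf
      (rate_top (P := P) (X := X) (γ := γ) (ν := ν)) (hV x)
    refine ⟨(h1 x).1, ?_⟩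
    rw [funext fun x => (h1 x).2]
    exact hasDerivAt_totalCost_const hX hm hr hV hq hf x
  | coe b =>
    have hh := isThresholdRate_rate (P := P) (X := X) (γ := γ) (ν := ν) hα b
    have hV : ∀ x, IsStrongSolution P X (rate P X γ ν α (b : EReal)) x
        (controlled X α U (b : EReal) x) := fun x => by
      rw [controlled_coe]
      exact hU b x
    have h1 := fun x => discountedIntegrable_and_value_eq (β := β) hX hm hh.toIsRate hq hf
      (fun y => rfl) (hV x)
    refine ⟨(h1 x).1, ?_⟩
    rw [funext fun x => (h1 x).2]
    refine hasDerivAt_totalCost_threshold hX hm hh hV hq hf ?_ x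
    rw [controlled_coe, ← rho_eq_marginalCost hX hm hα hq hf hU]
    exact rho_eq_beta_of_bStar_eq (monotone_rho hX hm hα hq hf hU)
      (continuous_rho hX hm hα hq hf hU) hb.symm

/-- Without control the marginal cost is the limit of those for thresholds tending to `+∞`, and
these do not exceed `ρ` at the threshold while the threshold lies above the initial state. -/
lemma marginalCost_top_le [IsProbabilityMeasure P] (hX : IsLevyProcess P X)
    (hm : HasPolynomialMoments P X) (hα : 0 < α) (hq : 0 < q) (hf : IsRunningCost f)
    (hU : ∀ b x : ℝ, IsStrongSolution P X (rate P X γ ν α (b : EReal)) x (U b x))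
    (hρ : ∀ b, rho P q f U b ≤ β) (x : ℝ) :
    marginalCost P q f (fun t ω => x + X t ω - 0 * t) 0 ≤ β := by
  have hh := fun n : ℕ => isThresholdRate_rate (P := P) (X := X) (γ := γ) (ν := ν) hα (n : ℝ)
  refine le_of_tendsto (tendsto_marginalCost_of_tendsto_rate hX hm (fun n => (hh n).toIsRate)
    (fun n => hU n x) (fun y => ?_) hq hf) ?_
  · refine tendsto_const_nhds.congr' ?_
    filter_upwards [tendsto_natCast_atTop_atTop.eventually_gt_atTop y] with n hn
    exact ((hh n).below y hn).symm
  · filter_upwards [tendsto_natCast_atTop_atTop.eventually_ge_atTop x] with n hn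
    refine le_trans ?_ (hρ n)
    rw [rho_eq_marginalCost hX hm hα hq hf hU]
    exact monotone_marginalCost_family hX hm (hh n).toIsRate (hU n) hq hf hn

lemma le_marginalCost_bot [IsProbabilityMeasure P] (hX : IsLevyProcess P X)
    (hm : HasPolynomialMoments P X) (hα : 0 < α) (hq : 0 < q) (hf : IsRunningCost f)
    (hU : ∀ b x : ℝ, IsStrongSolution P X (rate P X γ ν α (b : EReal)) x (U b x))
    (hρ : ∀ b, β ≤ rho P q f U b) (x : ℝ) :
    β ≤ marginalCost P q f (fun t ω => x + X t ω - α * t) 0 := by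
  have hh := fun n : ℕ => isThresholdRate_rate (P := P) (X := X) (γ := γ) (ν := ν) hα (-n : ℝ)
  refine ge_of_tendsto (tendsto_marginalCost_of_tendsto_rate hX hm (fun n => (hh n).toIsRate)
    (fun n => hU (-n) x) (fun y => ?_) hq hf) ?_
  · refine tendsto_const_nhds.congr' ?_
    filter_upwards [tendsto_natCast_atTop_atTop.eventually_gt_atTop (-y)] with n hn
    exact ((hh n).above y (by linarith)).symm
  · filter_upwards [tendsto_natCast_atTop_atTop.eventually_ge_atTop (-x)] with n hn
    refine (hρ (-n)).trans ?_
    rw [rho_eq_marginalCost hX hm hα hq hf hU]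
    exact monotone_marginalCost_family hX hm (hh n).toIsRate (hU (-n)) hq hf (by linarith)

lemma slope_conditions_bStar [IsProbabilityMeasure P] (hX : IsLevyProcess P X)
    (hm : HasPolynomialMoments P X) (hα : 0 < α) (hq : 0 < q) (hf : IsRunningCost f)
    (hU : ∀ b x : ℝ, IsStrongSolution P X (rate P X γ ν α (b : EReal)) x (U b x)) {b : EReal}
    (hb : b = bStar P q β f U) (x : ℝ) :
    (b < (x : EReal) → β ≤ marginalCost P q f (controlled X α U b x) 0) ∧
    ((x : EReal) = b → marginalCost P q f (controlled X α U b x) 0 = β) ∧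
    ((x : EReal) < b → marginalCost P q f (controlled X α U b x) 0 ≤ β) := by
  have hmono := monotone_rho hX hm hα hq hf hU
  induction b with
  | bot =>
    rw [controlled_bot]
    refine ⟨fun _ => le_marginalCost_bot hX hm hα hq hf hU (fun b => ?_) x,
      fun h => absurd h (EReal.coe_ne_bot x), fun h => absurd h not_lt_bot⟩
    exact beta_le_of_bStar_lt hmono (hb ▸ EReal.bot_lt_coe b)
  | top =>
    rw [controlled_top]
    refine ⟨fun h => absurd h not_top_lt, fun h => absurd h (EReal.coe_ne_top x),
      fun _ => marginalCost_top_le hX hm hα hq hf hU (fun b => ?_) x⟩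
    exact (lt_beta_of_lt_bStar (hb ▸ EReal.coe_lt_top b)).le
  | coe b =>
    have hR := monotone_marginalCost_family hX hm
      (isThresholdRate_rate (P := P) (X := X) (γ := γ) (ν := ν) hα b).toIsRate (hU b) hq hf
    have hβ : marginalCost P q f (U b b) 0 = β := by
      rw [← rho_eq_marginalCost hX hm hα hq hf hU]
      exact rho_eq_beta_of_bStar_eq hmono (continuous_rho hX hm hα hq hf hU) hb.symm
    rw [controlled_coe]
    refine ⟨fun h => ?_, fun h => ?_, fun h => ?_⟩
    · exact hβ.symm.le.trans (hR (EReal.coe_lt_coe_iff.1 h).le)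
    · rw [EReal.coe_eq_coe_iff.1 h, hβ]
    · exact (hR (EReal.coe_lt_coe_iff.1 h).le).trans hβ.le

end Rate

end

end Refraction

/-! ### The slope of the cost at the candidate threshold -/

theorem mainTheorem4 {Ω : Type*} [MeasurableSpace Ω] (P : Measure Ω) [IsProbabilityMeasure P]
    (X : ℝ≥0 → Ω → ℝ) (hX : Refraction.IsLevyProcess P X)
    (γ σ : ℝ) (ν : Measure ℝ) (hν : Refraction.HasTriplet P X γ σ ν)
    (hexp : Refraction.HasExpMoment ν)
    (q α β : ℝ) (hq : 0 < q) (hα : 0 < α)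
    (f : ℝ → ℝ) (hf : Refraction.IsRunningCost f)
    (U : ℝ → ℝ → ℝ≥0 → Ω → ℝ)
    (hU : ∀ b x : ℝ, Refraction.IsUniqueStrongSolution P X
      (Refraction.rate P X γ ν α (b : EReal)) x (U b x)) :
    -- the quantities that define the threshold and the cost are well defined
    (∀ b : ℝ, Refraction.DiscountedIntegrable P q (fun t ω => deriv f (U b b t ω))) ∧
    (∀ x : ℝ, Refraction.DiscountedIntegrable P q
      (Refraction.costRate P X γ ν α β f U (Refraction.bStar P q β f U) x)) ∧
    -- the cost is differentiable in the initial state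
    Differentiable ℝ
      (Refraction.value P X γ ν q α β f U (Refraction.bStar P q β f U)) ∧
    -- the slope conditions
    ∀ x : ℝ,
      (Refraction.bStar P q β f U < (x : EReal) →
        β ≤ deriv (Refraction.value P X γ ν q α β f U (Refraction.bStar P q β f U)) x) ∧
      ((x : EReal) = Refraction.bStar P q β f U →
        deriv (Refraction.value P X γ ν q α β f U (Refraction.bStar P q β f U)) x = β) ∧
      ((x : EReal) < Refraction.bStar P q β f U →
        deriv (Refraction.value P X γ ν q α β f U (Refraction.bStar P q β f U)) x ≤ β) := by
  have hm : Refraction.HasPolynomialMoments P X := fun n =>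
    hν.exists_moment_bound hexp hX.measurable n
  have hS := fun b x : ℝ => (hU b x).1
  have hd := fun x => Refraction.hasDerivAt_value_bStar (β := β) hX hm hα hq hf hS rfl x
  refine ⟨fun b => Refraction.discountedIntegrable_rho hX hm hα hq hf hS b, fun x => (hd x).1,
    fun x => (hd x).2.differentiableAt, fun x => ?_⟩
  rw [(hd x).2.deriv]
  exact Refraction.slope_conditions_bStar hX hm hα hq hf hS rfl x
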